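/- Let $d,\ell\ge 1$ be natural numbers, $\alpha\in(0,d)$, $p=\frac{d}{d-\alpha}$ and $\beta\in(0,1)$. A function $\Psi$ between Euclidean spaces is called positively $q$-homogeneous if $\Psi(\lambda y)=\lambda^q\Psi(y)$ for all $y$ and all $\lambda>0$. Let $K\colon\mathbb{R}^d\to\mathbb{R}^\ell$ be positively $(\alpha-d)$-homogeneous, let $\Phi\colon\mathbb{R}^\ell\to\mathbb{R}$ be positively $p$-homogeneous, and let the restrictions of $K$ and $\Phi$ to the unit spheres of $\mathbb{R}^d$ and $\mathbb{R}^\ell$ be Lipschitz. Let $\Omega\subset\mathbb{R}^d$ be a bounded domain (a non-empty, bounded, connected open set) with $C^{1,\beta}$ smooth boundary: in a neighborhood of any boundary point and in suitable orthogonal coordinates, $\Omega$ coincides with the strict subgraph of a differentiable function of $d-1$ variables whose gradient is $\beta$-Hölder. Write $K*f(x)=\int_{\mathbb{R}^d}K(x-y)f(y)\,dy$, and let $\sigma$ be the surface measure on the unit sphere $S^{d-1}$. Then all the integrals below, including those defining $K*f$, converge absolutely, and the following are equivalent. (i) There is a constant $C$ such that $$\Big|\int_\Omega\Phi\big(K*f(x)\big)\,dx\Big|\le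 C\,\|f\|_{L_1(\mathbb{R}^d)}^p$$ for every bounded (measurable) compactly supported function $f\colon\mathbb{R}^d\to\mathbb{R}$. (ii) For every $\xi\in S^{d-1}$, $$\int_{\zeta\in S^{d-1},\ \langle\zeta,\xi\rangle>0}\Phi(K(\zeta))\,d\sigma(\zeta)=0\quad\text{and}\quad\int_{\zeta\in S^{d-1},\ \langle\zeta,\xi\rangle>0}\Phi(-K(\zeta))\,d\sigma(\zeta)=0.$$ -/

import Mathlib

open MeasureTheory Set Metric
open scoped NNReal RealInnerProductSpace

/-- The Euclidean space `ℝ^n`. -/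
abbrev Euc (n : ℕ) : Type := EuclideanSpace ℝ (Fin n)

/-- `Ψ` is positively `q`-homogeneous: `Ψ (t y) = t ^ q Ψ y` for all `y` and all `t > 0`. -/
def PosHomogeneous {E F : Type*} [AddCommGroup E] [Module ℝ E] [AddCommGroup F] [Module ℝ F]
    (q : ℝ) (Ψ : E → F) : Prop :=
  ∀ (y : E) (t : ℝ), 0 < t → Ψ (t • y) = t ^ q • Ψ y

/-- The restriction of `Ψ` to the unit sphere is Lipschitz. -/
def LipschitzOnUnitSphere {E F : Type*} [NormedAddCommGroup E] [NormedAddCommGroup F]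
    (Ψ : E → F) : Prop :=
  ∃ L : ℝ≥0, LipschitzOnWith L Ψ (sphere (0 : E) 1)

/-- A bounded domain: a non-empty connected bounded open set. -/
structure IsBoundedDomain {d : ℕ} (Ω : Set (Euc d)) : Prop where
  isOpen : IsOpen Ω
  isConnected : IsConnected Ω
  isBounded : Bornology.IsBounded Ω

/-- The boundary of the open set `Ω` is `C^{1,β}` smooth: near any boundary point `z`, in suitable
orthogonal coordinates (`ν` is the direction of the last axis, the other coordinates run through the
hyperplane orthogonal to `ν`), `Ω` is the strict subgraph of a differentiable function `h` with
`β`-Hölder gradient. -/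
def HasC1HolderBoundary {d : ℕ} (β : ℝ≥0) (Ω : Set (Euc d)) : Prop :=
  ∀ z ∈ frontier Ω, ∃ ν : Euc d, ‖ν‖ = 1 ∧ ∃ (h : (ℝ ∙ ν)ᗮ → ℝ) (C : ℝ≥0) (r : ℝ), 0 < r ∧
    (∀ y ∈ ball ((ℝ ∙ ν)ᗮ.orthogonalProjectionOnto z) r, DifferentiableAt ℝ h y) ∧
    HolderOnWith C β (gradient h) (ball ((ℝ ∙ ν)ᗮ.orthogonalProjectionOnto z) r) ∧
    ∀ x ∈ ball z r, x ∈ Ω ↔ ⟪ν, x⟫ < h ((ℝ ∙ ν)ᗮ.orthogonalProjectionOnto x)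

/-- `(K * f)(x) = ∫ K(x - y) f(y) dy` for a vector-valued kernel `K` and a scalar function `f`. -/
noncomputable def kernelConv {d l : ℕ} (K : Euc d → Euc l) (f : Euc d → ℝ) (x : Euc d) : Euc l :=
  ∫ y, f y • K (x - y)

/-- (Lebesgue measurable) bounded compactly supported functions on `ℝ^d`. -/
structure IsBoundedCompactlySupported {d : ℕ} (f : Euc d → ℝ) : Prop where
  aestronglyMeasurable : AEStronglyMeasurable f volume
  bounded : ∃ M : ℝ, ∀ x, |f x| ≤ M
  hasCompactSupport : HasCompactSupport f

/-- The inequality `|∫_Ω Φ(K * f)| ≲ ‖f‖_{L_1}^p` with a constant independent of `f`. -/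
def PhiInequality {d l : ℕ} (Ω : Set (Euc d)) (K : Euc d → Euc l) (Φ : Euc l → ℝ) (p : ℝ) : Prop :=
  ∃ C : ℝ, ∀ f : Euc d → ℝ, IsBoundedCompactlySupported f →
    |∫ x in Ω, Φ (kernelConv K f x)| ≤ C * (∫ x, |f x|) ^ p

/-- The integral of `g` over the open half-sphere `{ζ ∈ S^{d-1} : ⟪ζ, ξ⟫ > 0}` with respect to the
surface measure. -/
noncomputable def halfSphereIntegral {d : ℕ} (ξ : Euc d) (g : Euc d → ℝ) : ℝ :=
  ∫ ζ in {ζ : sphere (0 : Euc d) 1 | 0 < ⟪(ζ : Euc d), ξ⟫}, g ζ ∂(volume : Measure (Euc d)).toSphere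

/-! Put `γ = d - α`, so that `γ * p = d`: the composition of `Φ` with `K` is homogeneous of the
critical degree `-d`, and every dyadic scale contributes equally to its integral. Boundedness over
infinitely many scales therefore requires cancellation at each scale. Let `scaleDiff` be the
difference of `Φ ∘ K` cut off near the origin at two consecutive dyadic scales. It is supported in
the unit ball, and in polar coordinates its integral over a half-space is a half-sphere integral
times a nonzero radial constant (`setIntegral_halfSpace_scaleDiff`,
`integral_scaleProfile_ne_zero`). Condition (ii) thus says that `scaleDiff`, for `K` and for `-K`,
integrates to zero over half-spaces, and hence over the whole space.

Sufficiency. Cut `K` off at scale `t` and halve `t` repeatedly. The increment of `Φ` of the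
convolution is local: it is a bounded density times a bump average of `|f|` at scale `t`. Fubini
attributes it to points `y` with weight `|f y|` (`integral_scaleJump_eq`), so it suffices to bound,
for each `y`, the sum over scales by a constant times the `(p-1)`-th power of the `L_1` norm. Near
`y` at scale `t`, replace `f` by a point mass. The error is an increment of `massAt ^ (p - 1)`
between `t` and `2 * t`, and telescopes (`exists_abs_bump_mul_scaleJump_sub_le`). For the point
mass, the integral over `Ω` is compared with a half-space: cancellation leaves at most `dist (y, ∂Ω)
/ t` when this distance is below `t`, plus `t ^ β` from the Hölder boundary
(`abs_setIntegral_le_of_halfSpace`). Both sums over dyadic `t` are bounded independently of `y`.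
These estimates meet in `exists_abs_localJump_le` and are summed in `phiInequality_of_halfSpace`.

Necessity. Every direction `ξ` is the outer normal at some boundary point `z`, found by maximizing a
linear functional. Testing the inequality on approximations of a unit mass at `z` bounds the
integrals of the cut-off `Φ ∘ K` over `Ω` uniformly in the scale. Each halving changes them by the
half-space integral of `scaleDiff`, up to summable errors, so that integral vanishes
(`PhiInequality.setIntegral_halfSpace_eq_zero`). -/

set_option linter.unusedSectionVars false

/-! ### Elementary inequalities for powers and the decay profile -/

/-- The decay profile `(1 + r) ^ (-γ)`. -/
noncomputable def dec (γ r : ℝ) : ℝ := (1 + r) ^ (-γ)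

lemma dec_pos {γ r : ℝ} (hr : 0 ≤ r) : 0 < dec γ r := Real.rpow_pos_of_pos (by linarith) _

lemma dec_le_one {γ r : ℝ} (hγ : 0 < γ) (hr : 0 ≤ r) : dec γ r ≤ 1 :=
  Real.rpow_le_one_of_one_le_of_nonpos (by linarith) (by linarith)

lemma dec_le_mul_of_le {γ a b C : ℝ} (hγ : 0 < γ) (ha : 0 ≤ a) (hb : 0 ≤ b) (hC : 0 < C)
    (h : 1 + b ≤ C * (1 + a)) : dec γ a ≤ C ^ γ * dec γ b := by
  unfold dec
  have h1 : (C * (1 + a)) ^ (-γ) ≤ (1 + b) ^ (-γ) :=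
    Real.rpow_le_rpow_of_nonpos (by linarith) h (by linarith)
  rw [Real.mul_rpow hC.le (by linarith), Real.rpow_neg hC.le] at h1
  have hCγ : 0 < C ^ γ := Real.rpow_pos_of_pos hC _
  rw [inv_mul_le_iff₀ hCγ] at h1
  exact h1

lemma dec_half_le {γ r : ℝ} (hγ : 0 < γ) (hr : 0 ≤ r) : dec γ (r / 2) ≤ 2 ^ γ * dec γ r :=
  dec_le_mul_of_le hγ (by positivity) hr two_pos (by linarith)

lemma one_sub_dec_le {γ r : ℝ} (hγ : 0 < γ) (hr : 0 ≤ r) : 1 - dec γ r ≤ γ * r := by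
  unfold dec
  rw [Real.rpow_def_of_pos (by linarith)]
  have h1 := Real.add_one_le_exp (Real.log (1 + r) * -γ)
  have h2 := Real.log_le_sub_one_of_pos (show 0 < 1 + r by linarith)
  nlinarith

/-- The ratio `(1 + r / 2) / (1 + r)` falls short of one by exactly `r / (2 * (1 + r))`, and `log x
≤ x - 1` followed by `1 + y ≤ exp y` turns this into a gain. The lower bound is what allows kernel
errors to be paid for by increments of the mass between scales. -/
lemma dec_half_sub_dec_ge {γ r : ℝ} (hγ : 0 < γ) (hr : 0 ≤ r) :
    γ / 2 * (dec γ r * (r / (1 + r))) ≤ dec γ (r / 2) - dec γ r := by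
  have h1 : dec γ (r / 2) = dec γ r * ((1 + r / 2) / (1 + r)) ^ (-γ) := by
    unfold dec
    rw [← Real.mul_rpow (by linarith) (by positivity)]
    congr 1
    field_simp
  have hx : 0 < (1 + r / 2) / (1 + r) := by positivity
  have h2 : γ / 2 * (r / (1 + r)) + 1 ≤ ((1 + r / 2) / (1 + r)) ^ (-γ) := by
    rw [Real.rpow_def_of_pos hx]
    refine le_trans ?_ (Real.add_one_le_exp _)
    have h3 := Real.log_le_sub_one_of_pos hx
    have h4 : (1 + r / 2) / (1 + r) - 1 = -(1 / 2 * (r / (1 + r))) := by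
      field_simp
      ring
    rw [h4] at h3
    nlinarith
  rw [h1]
  nlinarith [dec_pos (γ := γ) hr]

/-- Comparison of an increment with the increment of a power. -/
lemma sub_mul_rpow_le {a b C s : ℝ} (ha : 0 < a) (hab : a ≤ b) (hb : b ≤ C * a) (hs : 0 < s) :
    (b - a) * a ^ (s - 1) ≤ C / s * (b ^ s - a ^ s) := by
  have hx : 0 < b / a := div_pos (by linarith) ha
  have hxC : b / a ≤ C := by rwa [div_le_iff₀ ha]
  have hx1 : 1 ≤ b / a := by rwa [one_le_div ha]
  -- The exponent `s` may be below one, so convexity of the power is not available. The bound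
  -- through `log` costs a factor `b / a`, which the assumption `b ≤ C * a` absorbs.
  have h1 : s * (1 - (b / a)⁻¹) + 1 ≤ (b / a) ^ s := by
    rw [Real.rpow_def_of_pos hx]
    refine le_trans ?_ (Real.add_one_le_exp _)
    have := Real.one_sub_inv_le_log_of_pos hx
    nlinarith
  have h2 : b / a - 1 ≤ C / s * ((b / a) ^ s - 1) := by
    rw [div_mul_eq_mul_div, le_div_iff₀ hs]
    have h3 : (b / a - 1) = (b / a) * (1 - (b / a)⁻¹) := by
      rw [mul_sub, mul_inv_cancel₀ hx.ne', mul_one]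
    have h4 : 0 ≤ 1 - (b / a)⁻¹ := by
      have := inv_le_one_of_one_le₀ hx1
      linarith
    calc (b / a - 1) * s = (b / a) * (s * (1 - (b / a)⁻¹)) := by rw [h3]; ring
      _ ≤ C * (s * (1 - (b / a)⁻¹)) := by gcongr
      _ ≤ C * ((b / a) ^ s - 1) := by
        apply mul_le_mul_of_nonneg_left <;> linarith
  have hb0 : 0 ≤ b := by linarith
  rw [Real.div_rpow hb0 ha.le] at h2
  have has : 0 < a ^ s := Real.rpow_pos_of_pos ha _
  have h5 := mul_le_mul_of_nonneg_right h2 has.le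
  have e1 : (b / a - 1) * a ^ s = (b - a) * a ^ (s - 1) := by
    rw [Real.rpow_sub_one ha.ne']; field_simp
  have e2 : C / s * (b ^ s / a ^ s - 1) * a ^ s = C / s * (b ^ s - a ^ s) := by
    field_simp
  rwa [e1, e2] at h5

/-! ### Homogeneous functions that are Lipschitz on the sphere -/

section Homogeneous

variable {E F : Type*} [NormedAddCommGroup E] [NormedSpace ℝ E]
  [NormedAddCommGroup F] [NormedSpace ℝ F] {q : ℝ} {Ψ : E → F}

lemma PosHomogeneous.eq_norm_rpow_smul (h : PosHomogeneous q Ψ) {z : E} (hz : z ≠ 0) :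
    Ψ z = ‖z‖ ^ q • Ψ (‖z‖⁻¹ • z) := by
  have h1 := h (‖z‖⁻¹ • z) ‖z‖ (norm_pos_iff.2 hz)
  rwa [smul_smul, mul_inv_cancel₀ (norm_ne_zero_iff.2 hz), one_smul] at h1

lemma PosHomogeneous.map_zero (h : PosHomogeneous q Ψ) (hq : q ≠ 0) : Ψ 0 = 0 := by
  have h1 := h 0 2 two_pos
  rw [smul_zero] at h1
  have h2 : ((2 : ℝ) ^ q - 1) • Ψ 0 = 0 := by rw [sub_smul, one_smul, ← h1, sub_self]
  rcases smul_eq_zero.1 h2 with h3 | h3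
  · exfalso
    have h4 : (2 : ℝ) ^ q = 1 := by linarith
    have h5 := congrArg Real.log h4
    rw [Real.log_rpow two_pos, Real.log_one] at h5
    rcases mul_eq_zero.1 h5 with h6 | h6
    · exact hq h6
    · exact (Real.log_pos one_lt_two).ne' h6
  · exact h3

lemma inv_norm_smul_mem_sphere {z : E} (hz : z ≠ 0) : ‖z‖⁻¹ • z ∈ sphere (0 : E) 1 := by
  simp [norm_smul, hz]

/-- After multiplication by `‖z‖`, the difference of directions is `z - w` plus the radial
correction `(‖w‖ - ‖z‖) • (‖w‖⁻¹ • w)`, and each has norm at most `‖z - w‖`. -/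
lemma norm_mul_norm_normalize_sub_le {z w : E} (hz : z ≠ 0) (hw : w ≠ 0) :
    ‖z‖ * ‖‖z‖⁻¹ • z - ‖w‖⁻¹ • w‖ ≤ 2 * ‖z - w‖ := by
  have hz' := norm_ne_zero_iff.2 hz
  have hw' := norm_ne_zero_iff.2 hw
  have h1 : ‖z‖ • (‖z‖⁻¹ • z - ‖w‖⁻¹ • w) = (z - w) + (‖w‖ - ‖z‖) • (‖w‖⁻¹ • w) := by
    rw [smul_sub, smul_smul, mul_inv_cancel₀ hz', sub_smul, smul_smul ‖w‖, mul_inv_cancel₀ hw']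
    simp
  calc ‖z‖ * ‖‖z‖⁻¹ • z - ‖w‖⁻¹ • w‖ = ‖‖z‖ • (‖z‖⁻¹ • z - ‖w‖⁻¹ • w)‖ := by
        rw [norm_smul, norm_norm]
    _ ≤ ‖z - w‖ + ‖(‖w‖ - ‖z‖) • (‖w‖⁻¹ • w)‖ := by rw [h1]; exact norm_add_le _ _
    _ ≤ ‖z - w‖ + ‖z - w‖ := by
        gcongr
        rw [norm_smul, norm_smul, norm_inv, norm_norm, inv_mul_cancel₀ hw', mul_one,
          norm_sub_rev z w]
        exact abs_norm_sub_norm_le w z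
    _ = 2 * ‖z - w‖ := by ring

lemma LipschitzOnUnitSphere.norm_mul_norm_sub_le {L : ℝ≥0}
    (hL : LipschitzOnWith L Ψ (sphere (0 : E) 1)) {z w : E} (hz : z ≠ 0) (hw : w ≠ 0) :
    ‖z‖ * ‖Ψ (‖z‖⁻¹ • z) - Ψ (‖w‖⁻¹ • w)‖ ≤ 2 * L * ‖z - w‖ := by
  have h1 := hL.norm_sub_le (inv_norm_smul_mem_sphere hz) (inv_norm_smul_mem_sphere hw)
  have h2 := norm_mul_norm_normalize_sub_le hz hw
  calc _ ≤ ‖z‖ * (L * ‖‖z‖⁻¹ • z - ‖w‖⁻¹ • w‖) := by gcongr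
    _ = L * (‖z‖ * ‖‖z‖⁻¹ • z - ‖w‖⁻¹ • w‖) := by ring
    _ ≤ L * (2 * ‖z - w‖) := by gcongr
    _ = _ := by ring

lemma LipschitzOnUnitSphere.exists_bound (h : LipschitzOnUnitSphere Ψ) :
    ∃ M : ℝ, 0 < M ∧ ∀ z ∈ sphere (0 : E) 1, ‖Ψ z‖ ≤ M := by
  obtain ⟨L, hL⟩ := h
  rcases (sphere (0 : E) 1).eq_empty_or_nonempty with h0 | ⟨e, he⟩
  · exact ⟨1, one_pos, by simp [h0]⟩
  · refine ⟨‖Ψ e‖ + L * 2 + 1, by positivity, fun z hz => ?_⟩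
    have h1 := hL.norm_sub_le hz he
    have h2 : ‖z - e‖ ≤ 2 := by
      have := norm_sub_le z e
      rw [mem_sphere_zero_iff_norm] at hz he
      linarith
    have h3 : (L : ℝ) * ‖z - e‖ ≤ L * 2 := by gcongr
    have h4 := norm_sub_norm_le (Ψ z) (Ψ e)
    linarith

lemma PosHomogeneous.exists_norm_le (h : PosHomogeneous q Ψ) (hL : LipschitzOnUnitSphere Ψ)
    (hq : q ≠ 0) : ∃ M : ℝ, 0 < M ∧ ∀ z, ‖Ψ z‖ ≤ M * ‖z‖ ^ q := by
  obtain ⟨M, hM, hb⟩ := hL.exists_bound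
  refine ⟨M, hM, fun z => ?_⟩
  by_cases hz : z = 0
  · rw [hz, h.map_zero hq, norm_zero, norm_zero]
    positivity
  · rw [h.eq_norm_rpow_smul hz, norm_smul, Real.norm_of_nonneg (by positivity), mul_comm]
    gcongr
    exact hb _ (inv_norm_smul_mem_sphere hz)

/-- Convexity: the graph of the power lies above its tangent line at `a`. This is Bernoulli's
inequality for `b / a`, and no order between `a` and `b` is needed. -/
lemma rpow_sub_rpow_le {a b p : ℝ} (hp : 1 ≤ p) (ha : 0 ≤ a) (hb : 0 ≤ b) :
    a ^ p - b ^ p ≤ p * a ^ (p - 1) * (a - b) := by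
  rcases ha.eq_or_lt with rfl | ha
  · rw [Real.zero_rpow (by linarith)]
    rcases hp.eq_or_lt with rfl | hp
    · simp
    · rw [Real.zero_rpow (by linarith)]
      have : 0 ≤ b ^ p := by positivity
      linarith
  · have h1 := one_add_mul_self_le_rpow_one_add (s := b / a - 1)
      (by have : 0 ≤ b / a := by positivity
          linarith) hp
    have h2 : (1 + (b / a - 1)) ^ p = b ^ p / a ^ p := by
      rw [← Real.div_rpow hb ha.le]; ring_nf
    rw [h2] at h1
    have hap : 0 < a ^ p := by positivity
    have h3 := mul_le_mul_of_nonneg_right h1 hap.le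
    rw [div_mul_cancel₀ _ hap.ne'] at h3
    rw [Real.rpow_sub_one ha.ne']
    have e : p * (a ^ p / a) * (a - b) = a ^ p - (1 + p * (b / a - 1)) * a ^ p := by
      field_simp; ring
    linarith

/-- Local Lipschitz estimate for functions that are homogeneous of degree at least one. -/
lemma PosHomogeneous.exists_norm_sub_le (h : PosHomogeneous q Ψ) (hL : LipschitzOnUnitSphere Ψ)
    (hq : 1 ≤ q) : ∃ C : ℝ, 0 < C ∧ ∀ (R : ℝ) (z w : E), ‖z‖ ≤ R → ‖w‖ ≤ R →
      ‖Ψ z - Ψ w‖ ≤ C * (R ^ (q - 1) * ‖z - w‖) := by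
  obtain ⟨M, hM, hb⟩ := hL.exists_bound
  have hbd : ∀ z, z ≠ 0 → ‖Ψ (‖z‖⁻¹ • z)‖ ≤ M := fun z hz => hb _ (inv_norm_smul_mem_sphere hz)
  obtain ⟨L, hL⟩ := hL
  have h0 : Ψ 0 = 0 := h.map_zero (by linarith)
  have key : ∀ (R : ℝ) (z w : E), ‖z‖ ≤ R → ‖w‖ ≤ ‖z‖ →
      ‖Ψ z - Ψ w‖ ≤ (q * M + 2 * L) * (R ^ (q - 1) * ‖z - w‖) := by
    intro R z w hz hwz
    have hR : ‖z‖ ^ (q - 1) ≤ R ^ (q - 1) :=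
      Real.rpow_le_rpow (norm_nonneg _) hz (by linarith)
    refine le_trans ?_ (show (q * M + 2 * L) * (‖z‖ ^ (q - 1) * ‖z - w‖) ≤ _ by gcongr)
    by_cases hz0 : z = 0
    · have hw0 : w = 0 := by simpa [hz0] using hwz
      simp [hz0, hw0]
    have hzp : 0 < ‖z‖ := norm_pos_iff.2 hz0
    by_cases hw0 : w = 0
    · rw [hw0, h0, sub_zero, sub_zero, h.eq_norm_rpow_smul hz0, norm_smul,
        Real.norm_of_nonneg (by positivity)]
      have e : ‖z‖ ^ (q - 1) * ‖z‖ = ‖z‖ ^ q := by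
        rw [Real.rpow_sub_one hzp.ne']; field_simp
      rw [e, mul_comm]
      gcongr
      refine (hbd z hz0).trans ?_
      have : (0 : ℝ) ≤ L := L.2
      nlinarith
    have hwp : 0 < ‖w‖ := norm_pos_iff.2 hw0
    -- The radial change is taken at the direction of the longer vector and the angular change at
    -- the smaller radius. The latter radius factor pays for the `1 / ‖z‖` in the angular Lipschitz
    -- bound.
    have e1 : Ψ z - Ψ w = (‖z‖ ^ q - ‖w‖ ^ q) • Ψ (‖z‖⁻¹ • z) +
        ‖w‖ ^ q • (Ψ (‖z‖⁻¹ • z) - Ψ (‖w‖⁻¹ • w)) := by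
      rw [smul_sub, sub_smul, ← h.eq_norm_rpow_smul hz0, ← h.eq_norm_rpow_smul hw0]
      abel
    have h2 : ‖w‖ ^ q ≤ ‖z‖ ^ q := Real.rpow_le_rpow (norm_nonneg _) hwz (by linarith)
    have h3 : ‖z‖ ^ q - ‖w‖ ^ q ≤ q * ‖z‖ ^ (q - 1) * ‖z - w‖ := by
      refine (rpow_sub_rpow_le hq hzp.le hwp.le).trans ?_
      gcongr
      exact norm_sub_norm_le z w
    have h4 := LipschitzOnUnitSphere.norm_mul_norm_sub_le hL hz0 hw0
    have h5 : ‖w‖ ^ q ≤ ‖z‖ ^ (q - 1) * ‖z‖ := by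
      rw [Real.rpow_sub_one hzp.ne', div_mul_cancel₀ _ hzp.ne']; exact h2
    calc ‖Ψ z - Ψ w‖ ≤ (‖z‖ ^ q - ‖w‖ ^ q) * ‖Ψ (‖z‖⁻¹ • z)‖ +
          ‖w‖ ^ q * ‖Ψ (‖z‖⁻¹ • z) - Ψ (‖w‖⁻¹ • w)‖ := by
          rw [e1]
          refine (norm_add_le _ _).trans ?_
          rw [norm_smul, norm_smul, Real.norm_of_nonneg (by linarith),
            Real.norm_of_nonneg (by positivity)]
      _ ≤ (q * ‖z‖ ^ (q - 1) * ‖z - w‖) * M +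
          ‖z‖ ^ (q - 1) * ‖z‖ * ‖Ψ (‖z‖⁻¹ • z) - Ψ (‖w‖⁻¹ • w)‖ := by
          gcongr
          exact hbd z hz0
      _ = (q * ‖z‖ ^ (q - 1) * ‖z - w‖) * M +
          ‖z‖ ^ (q - 1) * (‖z‖ * ‖Ψ (‖z‖⁻¹ • z) - Ψ (‖w‖⁻¹ • w)‖) := by ring
      _ ≤ (q * ‖z‖ ^ (q - 1) * ‖z - w‖) * M +
          ‖z‖ ^ (q - 1) * (2 * L * ‖z - w‖) := by gcongr
      _ = _ := by ring
  refine ⟨q * M + 2 * L, by positivity, fun R z w hz hw => ?_⟩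
  rcases le_total ‖w‖ ‖z‖ with hwz | hwz
  · exact key R z w hz hwz
  · rw [norm_sub_rev, norm_sub_rev z w]
    exact key R w z hw hwz

lemma PosHomogeneous.continuous (h : PosHomogeneous q Ψ) (hL : LipschitzOnUnitSphere Ψ)
    (hq : 1 ≤ q) : Continuous Ψ := by
  obtain ⟨C, hC, hb⟩ := h.exists_norm_sub_le hL hq
  rw [continuous_iff_continuousAt]
  intro z
  rw [ContinuousAt, tendsto_iff_norm_sub_tendsto_zero]
  have h1 : Filter.Tendsto (fun w => C * ((‖z‖ + 1) ^ (q - 1) * ‖w - z‖)) (nhds z) (nhds 0) := by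
    have : Continuous (fun w => C * ((‖z‖ + 1) ^ (q - 1) * ‖w - z‖)) := by fun_prop
    simpa using this.tendsto z
  refine squeeze_zero' (Filter.Eventually.of_forall fun _ => norm_nonneg _) ?_ h1
  filter_upwards [ball_mem_nhds z one_pos] with w hw
  refine hb _ w z ?_ (by linarith)
  rw [mem_ball_iff_norm] at hw
  have := norm_le_norm_add_norm_sub z w
  rw [norm_sub_rev] at this
  linarith

/-! ### Cut-off kernels and their regularity -/

/-- A kernel with decay `(1 + ‖z‖) ^ (-γ)` that is Lipschitz. -/
structure TameKernel (C γ : ℝ) (G : E → F) : Prop where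
  norm_le : ∀ z, ‖G z‖ ≤ C * dec γ ‖z‖
  sub_le : ∀ z w, ‖G z - G w‖ ≤ C * ‖z - w‖

/-- The kernel `K` cut off near the origin at the scale `1 / s`. -/
noncomputable def cutKer (γ s : ℝ) (K : E → F) (z : E) : F :=
  (min 1 (s * ‖z‖)) ^ (γ + 1) • K z

lemma TameKernel.mono {C C' γ : ℝ} {G : E → F} (h : TameKernel C γ G) (hC : C ≤ C') :
    TameKernel C' γ G := by
  refine ⟨fun z => (h.norm_le z).trans ?_, fun z w => (h.sub_le z w).trans ?_⟩
  · have := dec_pos (γ := γ) (norm_nonneg z)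
    gcongr
  · gcongr

lemma TameKernel.lipschitzWith {C γ : ℝ} {G : E → F} (h : TameKernel C γ G) :
    LipschitzWith C.toNNReal G := by
  refine LipschitzWith.of_dist_le_mul fun z w => ?_
  rw [dist_eq_norm, dist_eq_norm]
  refine (h.sub_le z w).trans ?_
  gcongr
  exact Real.le_coe_toNNReal C

lemma TameKernel.continuous {C γ : ℝ} {G : E → F} (h : TameKernel C γ G) : Continuous G :=
  h.lipschitzWith.continuous

/-- Dilating the argument changes only the cut-off scale and a scalar, so one kernel, cut off at
scale one, yields the estimates at all scales. -/
lemma PosHomogeneous.smul_cutKer {γ : ℝ} {K : E → F} (h : PosHomogeneous (-γ) K) {t s : ℝ}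
    (ht : 0 < t) (z : E) : cutKer γ s K (t • z) = t ^ (-γ) • cutKer γ (s * t) K z := by
  unfold cutKer
  rw [h z t ht, smul_comm, norm_smul, Real.norm_of_nonneg ht.le, mul_assoc]

lemma cutKer_of_one_le {γ s : ℝ} {K : E → F} {z : E} (hz : 1 ≤ s * ‖z‖) : cutKer γ s K z = K z := by
  rw [cutKer, min_eq_left hz, Real.one_rpow, one_smul]

/-- The radial profile `min r (r ^ (-γ))` of the cut-off kernel is Lipschitz. -/
lemma abs_radial_sub_le {γ : ℝ} (hγ : 0 < γ) {a b : ℝ} (ha : 0 < a) (hab : a ≤ b) :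
    |min a (a ^ (-γ)) - min b (b ^ (-γ))| ≤ (1 + γ) * (b - a) := by
  have hb : 0 < b := by linarith
  have h1 : b ^ (-γ) ≤ a ^ (-γ) := Real.rpow_le_rpow_of_nonpos ha hab (by linarith)
  have key : ∀ x y : ℝ, 1 ≤ x → x ≤ y → x ^ (-γ) - y ^ (-γ) ≤ γ * (y - x) := by
    intro x y hx hxy
    have hx0 : 0 < x := by linarith
    have e : y ^ (-γ) = x ^ (-γ) * (y / x) ^ (-γ) := by
      rw [← Real.mul_rpow hx0.le (div_nonneg (by linarith) hx0.le)]; congr 1; field_simp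
    have h2 := one_sub_dec_le hγ (r := y / x - 1) (by rw [sub_nonneg, one_le_div hx0]; exact hxy)
    have e2 : dec γ (y / x - 1) = (y / x) ^ (-γ) := by unfold dec; congr 1; ring
    rw [e2] at h2
    have h3 : x ^ (-γ) ≤ 1 := Real.rpow_le_one_of_one_le_of_nonpos hx (by linarith)
    have h4 : 0 < x ^ (-γ) := by positivity
    have h5 : y / x - 1 ≤ y - x := by
      rw [div_sub_one hx0.ne', div_le_iff₀ hx0]
      nlinarith
    have h6 : 0 ≤ y / x - 1 := by rw [sub_nonneg, one_le_div hx0]; exact hxy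
    rw [e]
    calc x ^ (-γ) - x ^ (-γ) * (y / x) ^ (-γ) = x ^ (-γ) * (1 - (y / x) ^ (-γ)) := by ring
      _ ≤ x ^ (-γ) * (γ * (y / x - 1)) := by gcongr
      _ ≤ 1 * (γ * (y / x - 1)) := by gcongr
      _ ≤ γ * (y - x) := by rw [one_mul]; gcongr
  have small : ∀ x : ℝ, 0 < x → x ≤ 1 → min x (x ^ (-γ)) = x := fun x hx hx1 =>
    min_eq_left (hx1.trans (Real.one_le_rpow_of_pos_of_le_one_of_nonpos hx hx1 (by linarith)))
  have large : ∀ x : ℝ, 1 ≤ x → min x (x ^ (-γ)) = x ^ (-γ) := fun x hx =>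
    min_eq_right ((Real.rpow_le_one_of_one_le_of_nonpos hx (by linarith)).trans hx)
  have hγab : 0 ≤ γ * (b - a) := mul_nonneg hγ.le (by linarith)
  rcases le_total b 1 with hb1 | hb1
  · rw [small a ha (by linarith), small b hb hb1, abs_le]
    constructor <;> nlinarith
  rcases le_total 1 a with ha1 | ha1
  · rw [large a ha1, large b hb1, abs_le]
    have := key a b ha1 hab
    constructor <;> nlinarith
  · rw [small a ha ha1, large b hb1, abs_le]
    have h2 := key 1 b le_rfl hb1
    rw [Real.one_rpow] at h2
    have h3 : b ^ (-γ) ≤ 1 := Real.rpow_le_one_of_one_le_of_nonpos hb1 (by linarith)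
    have h5 : γ * (b - 1) ≤ γ * (b - a) := by gcongr
    constructor <;> nlinarith

/-- The cut-off exponent `γ + 1` makes the kernel homogeneous of degree one inside the unit ball,
hence Lipschitz through the origin. Outside the ball it is the original kernel, and the minimum
selects the right regime. -/
lemma PosHomogeneous.cutKer_one_eq {γ : ℝ} (hγ : 0 < γ) {K : E → F} (h : PosHomogeneous (-γ) K)
    {z : E} (hz : z ≠ 0) :
    cutKer γ 1 K z = min ‖z‖ (‖z‖ ^ (-γ)) • K (‖z‖⁻¹ • z) := by
  have hzp : 0 < ‖z‖ := norm_pos_iff.2 hz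
  rw [cutKer, one_mul, h.eq_norm_rpow_smul hz, smul_smul]
  congr 1
  rcases le_total ‖z‖ 1 with h1 | h1
  · rw [min_eq_right h1, ← Real.rpow_add hzp, min_eq_left]
    · simp
    · exact h1.trans (Real.one_le_rpow_of_pos_of_le_one_of_nonpos hzp h1 (by linarith))
  · rw [min_eq_left h1, Real.one_rpow, one_mul, min_eq_right]
    exact (Real.rpow_le_one_of_one_le_of_nonpos h1 (by linarith)).trans h1

/-- In the product of radial profile and angular part, the profile is Lipschitz and at most `‖z‖`.
The second fact compensates the blow-up of the angular Lipschitz constant at the origin. -/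
lemma PosHomogeneous.exists_tameKernel_cutKer_one {γ : ℝ} (hγ : 0 < γ) {K : E → F}
    (h : PosHomogeneous (-γ) K) (hL : LipschitzOnUnitSphere K) :
    ∃ C, 0 < C ∧ TameKernel C γ (cutKer γ 1 K) := by
  obtain ⟨M, hM, hb⟩ := hL.exists_bound
  have hbd : ∀ z, z ≠ 0 → ‖K (‖z‖⁻¹ • z)‖ ≤ M := fun z hz => hb _ (inv_norm_smul_mem_sphere hz)
  obtain ⟨L, hL⟩ := hL
  have h0 : cutKer γ 1 K 0 = 0 := by rw [cutKer, h.map_zero (by linarith), smul_zero]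
  refine ⟨2 ^ γ * M + (1 + γ) * M + 2 * L, by positivity, ?_, ?_⟩
  · intro z
    by_cases hz : z = 0
    · rw [hz, h0, norm_zero]
      exact mul_nonneg (by positivity) (dec_pos (norm_nonneg _)).le
    have hzp : 0 < ‖z‖ := norm_pos_iff.2 hz
    rw [h.cutKer_one_eq hγ hz, norm_smul, Real.norm_of_nonneg (by positivity)]
    have h1 : min ‖z‖ (‖z‖ ^ (-γ)) ≤ 2 ^ γ * dec γ ‖z‖ := by
      have e : (2 : ℝ) ^ γ * dec γ ‖z‖ = ((1 + ‖z‖) / 2) ^ (-γ) := by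
        rw [Real.div_rpow (by positivity) (by norm_num), dec, Real.rpow_neg two_pos.le]
        field_simp
      rw [e]
      rcases le_total ‖z‖ 1 with h1 | h1
      · refine (min_le_left _ _).trans (h1.trans ?_)
        exact Real.one_le_rpow_of_pos_of_le_one_of_nonpos (by positivity) (by linarith)
          (by linarith)
      · exact (min_le_right _ _).trans
          (Real.rpow_le_rpow_of_nonpos (by positivity) (by linarith) (by linarith))
    have hd := dec_pos (γ := γ) (norm_nonneg z)
    calc min ‖z‖ (‖z‖ ^ (-γ)) * ‖K (‖z‖⁻¹ • z)‖ ≤ (2 ^ γ * dec γ ‖z‖) * M := by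
          gcongr
          exact hbd z hz
      _ = (2 ^ γ * M) * dec γ ‖z‖ := by ring
      _ ≤ _ := by
          gcongr
          have : 0 ≤ (1 + γ) * M + 2 * L := by positivity
          linarith
  · have key : ∀ z w : E, ‖z‖ ≤ ‖w‖ → ‖cutKer γ 1 K z - cutKer γ 1 K w‖ ≤
        (2 ^ γ * M + (1 + γ) * M + 2 * L) * ‖z - w‖ := by
      intro z w hzw
      by_cases hw : w = 0
      · have hz : z = 0 := by simpa [hw] using hzw
        simp [hz, hw]
      by_cases hz : z = 0
      · rw [hz, h0, zero_sub, zero_sub, norm_neg, norm_neg, h.cutKer_one_eq hγ hw, norm_smul,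
          Real.norm_of_nonneg (by positivity), mul_comm]
        gcongr
        · refine (hbd w hw).trans ?_
          have : 0 ≤ 2 ^ γ * M + γ * M + 2 * L := by positivity
          linarith
        · exact min_le_left _ _
      have hzp : 0 < ‖z‖ := norm_pos_iff.2 hz
      set ρ : ℝ → ℝ := fun r => min r (r ^ (-γ)) with hρ
      have e1 : cutKer γ 1 K z - cutKer γ 1 K w = (ρ ‖z‖ - ρ ‖w‖) • K (‖w‖⁻¹ • w) +
          ρ ‖z‖ • (K (‖z‖⁻¹ • z) - K (‖w‖⁻¹ • w)) := by
        rw [h.cutKer_one_eq hγ hz, h.cutKer_one_eq hγ hw, smul_sub, sub_smul]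
        abel
      have h2 : |ρ ‖z‖ - ρ ‖w‖| ≤ (1 + γ) * ‖z - w‖ := by
        refine (abs_radial_sub_le hγ hzp hzw).trans ?_
        gcongr
        rw [norm_sub_rev]
        exact norm_sub_norm_le w z
      have h3 : ρ ‖z‖ ≤ ‖z‖ := min_le_left _ _
      have h3' : 0 ≤ ρ ‖z‖ := le_min hzp.le (by positivity)
      have h4 := LipschitzOnUnitSphere.norm_mul_norm_sub_le hL hz hw
      calc _ ≤ |ρ ‖z‖ - ρ ‖w‖| * ‖K (‖w‖⁻¹ • w)‖ +
            ρ ‖z‖ * ‖K (‖z‖⁻¹ • z) - K (‖w‖⁻¹ • w)‖ := by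
            rw [e1]
            refine (norm_add_le _ _).trans ?_
            rw [norm_smul, norm_smul, Real.norm_eq_abs, Real.norm_of_nonneg h3']
        _ ≤ ((1 + γ) * ‖z - w‖) * M + ‖z‖ * ‖K (‖z‖⁻¹ • z) - K (‖w‖⁻¹ • w)‖ := by
            gcongr
            exact hbd w hw
        _ ≤ ((1 + γ) * ‖z - w‖) * M + 2 * L * ‖z - w‖ := by gcongr
        _ = ((1 + γ) * M + 2 * L) * ‖z - w‖ := by ring
        _ ≤ _ := by
            gcongr
            have : 0 ≤ 2 ^ γ * M := by positivity
            linarith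
    intro z w
    rcases le_total ‖z‖ ‖w‖ with hzw | hzw
    · exact key z w hzw
    · rw [norm_sub_rev, norm_sub_rev z w]
      exact key w z hzw

lemma PosHomogeneous.cutKer_two_eq {γ : ℝ} {K : E → F} (h : PosHomogeneous (-γ) K) (z : E) :
    cutKer γ 2 K z = (2 : ℝ) ^ γ • cutKer γ 1 K ((2 : ℝ) • z) := by
  rw [h.smul_cutKer two_pos, smul_smul, ← Real.rpow_add two_pos]
  simp

lemma TameKernel.two_smul {C γ : ℝ} (hC : 0 < C) (hγ : 0 < γ) {G : E → F} (h : TameKernel C γ G) :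
    TameKernel (2 ^ γ * 2 * C) γ (fun z => (2 : ℝ) ^ γ • G ((2 : ℝ) • z)) := by
  have h2 : (0 : ℝ) < 2 ^ γ := by positivity
  refine ⟨fun z => ?_, fun z w => ?_⟩
  · rw [norm_smul, Real.norm_of_nonneg h2.le]
    have h3 : dec γ ‖(2 : ℝ) • z‖ ≤ 1 ^ γ * dec γ ‖z‖ := by
      rw [norm_smul, Real.norm_of_nonneg two_pos.le]
      exact dec_le_mul_of_le hγ (by positivity) (by positivity) one_pos
        (by have := norm_nonneg z
            linarith)
    rw [Real.one_rpow, one_mul] at h3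
    have hd := dec_pos (γ := γ) (norm_nonneg z)
    calc 2 ^ γ * ‖G ((2 : ℝ) • z)‖ ≤ 2 ^ γ * (C * dec γ ‖(2 : ℝ) • z‖) := by
          gcongr; exact h.norm_le _
      _ ≤ 2 ^ γ * (C * dec γ ‖z‖) := by gcongr
      _ = 2 ^ γ * C * dec γ ‖z‖ := by ring
      _ ≤ _ := by
        gcongr
        linarith
  · rw [← smul_sub, norm_smul, Real.norm_of_nonneg h2.le]
    calc 2 ^ γ * ‖G ((2 : ℝ) • z) - G ((2 : ℝ) • w)‖ ≤ 2 ^ γ * (C * ‖(2 : ℝ) • z - (2 : ℝ) • w‖) := by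
          gcongr; exact h.sub_le _ _
      _ = _ := by
          rw [← smul_sub, norm_smul, Real.norm_of_nonneg two_pos.le]; ring

/-- Replacing the argument of a tame kernel costs at most an increment of the decay profile. -/
lemma TameKernel.norm_sub_dec_smul_le {C γ : ℝ} (hC : 0 < C) (hγ : 0 < γ) {G : E → F}
    (h : TameKernel C γ G) {z w : E} (hz : ‖z‖ ≤ 2) :
    ‖G w - dec γ ‖z - w‖ • G z‖ ≤
      C * (2 ^ (γ + 1) * (1 + γ) + 2 * (3 ^ γ + 1)) * (2 / γ) *
        (dec γ (‖z - w‖ / 2) - dec γ ‖z - w‖) := by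
  set r := ‖z - w‖ with hr
  have hr0 : 0 ≤ r := norm_nonneg _
  have hd := dec_pos (γ := γ) hr0
  have hGz : ‖G z‖ ≤ C := (h.norm_le z).trans
    (mul_le_of_le_one_right hC.le (dec_le_one hγ (norm_nonneg _)))
  have main : ‖G w - dec γ r • G z‖ ≤
      C * (2 ^ (γ + 1) * (1 + γ) + 2 * (3 ^ γ + 1)) * (dec γ r * (r / (1 + r))) := by
    -- For `r ≤ 1` the Lipschitz bounds give `O(r)`, while `dec γ r / (1 + r)` is bounded below. For
    -- `r ≥ 1` both terms are `O(dec γ r)`, because `‖z‖ ≤ 2` forces `1 + r ≤ 3 * (1 + ‖w‖)`, and `r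
    -- / (1 + r)` is at least one half.
    rcases le_total r 1 with h1 | h1
    · have e : G w - dec γ r • G z = (G w - G z) + (1 - dec γ r) • G z := by
        rw [sub_smul, one_smul]; abel
      have h2 : ‖G w - dec γ r • G z‖ ≤ C * ((1 + γ) * r) := by
        rw [e]
        refine (norm_add_le _ _).trans ?_
        have h3 := h.sub_le w z
        rw [norm_sub_rev w z, ← hr] at h3
        have h4 := one_sub_dec_le hγ hr0
        have h5 : 0 ≤ 1 - dec γ r := by linarith [dec_le_one hγ hr0]
        rw [norm_smul, Real.norm_of_nonneg h5]
        calc _ ≤ C * r + (γ * r) * C := by gcongr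
          _ = _ := by ring
      have h6 : (1 : ℝ) ≤ 2 ^ (γ + 1) * (dec γ r * (1 / (1 + r))) := by
        have e2 : dec γ r * (1 / (1 + r)) = (1 + r) ^ (-(γ + 1)) := by
          rw [dec, neg_add, ← sub_eq_add_neg, Real.rpow_sub_one (by positivity)]
          ring
        have h7 : (2 : ℝ) ^ (-(γ + 1)) ≤ (1 + r) ^ (-(γ + 1)) :=
          Real.rpow_le_rpow_of_nonpos (by positivity) (by linarith) (by linarith)
        rw [e2]
        calc (1 : ℝ) = 2 ^ (γ + 1) * 2 ^ (-(γ + 1)) := by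
              rw [← Real.rpow_add two_pos]; simp
          _ ≤ _ := by gcongr
      calc _ ≤ C * ((1 + γ) * r) := h2
        _ ≤ C * ((1 + γ) * r) * (2 ^ (γ + 1) * (dec γ r * (1 / (1 + r)))) :=
          le_mul_of_one_le_right (by positivity) h6
        _ = C * (2 ^ (γ + 1) * (1 + γ)) * (dec γ r * (r / (1 + r))) := by ring
        _ ≤ _ := by
          gcongr
          have : (0 : ℝ) ≤ 2 * (3 ^ γ + 1) := by positivity
          linarith
    · have h2 : dec γ ‖w‖ ≤ 3 ^ γ * dec γ r := by
        refine dec_le_mul_of_le hγ (norm_nonneg _) hr0 (by norm_num) ?_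
        have := _root_.norm_sub_le z w
        linarith [norm_nonneg w]
      have h3 : ‖G w - dec γ r • G z‖ ≤ C * (3 ^ γ + 1) * dec γ r := by
        refine (_root_.norm_sub_le _ _).trans ?_
        rw [norm_smul, Real.norm_of_nonneg hd.le]
        calc _ ≤ C * (3 ^ γ * dec γ r) + dec γ r * C := by
              gcongr
              exact (h.norm_le w).trans (by gcongr)
          _ = _ := by ring
      have h4 : 1 ≤ 2 * (r / (1 + r)) := by
        rw [← mul_div_assoc, le_div_iff₀ (by positivity)]; linarith
      calc _ ≤ C * (3 ^ γ + 1) * dec γ r := h3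
        _ ≤ C * (3 ^ γ + 1) * dec γ r * (2 * (r / (1 + r))) :=
          le_mul_of_one_le_right (by positivity) h4
        _ = C * (2 * (3 ^ γ + 1)) * (dec γ r * (r / (1 + r))) := by ring
        _ ≤ _ := by
          gcongr
          have : (0 : ℝ) ≤ 2 ^ (γ + 1) * (1 + γ) := by positivity
          linarith
  refine main.trans ?_
  have h8 := dec_half_sub_dec_ge hγ hr0
  have h9 : dec γ r * (r / (1 + r)) ≤ 2 / γ * (dec γ (r / 2) - dec γ r) := by
    rw [div_mul_eq_mul_div, le_div_iff₀ hγ]; linarith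
  calc _ ≤ C * (2 ^ (γ + 1) * (1 + γ) + 2 * (3 ^ γ + 1)) *
        (2 / γ * (dec γ (r / 2) - dec γ r)) := by gcongr
    _ = _ := by ring

end Homogeneous

/-! ### Polar coordinates -/

section Polar

/-- Integration in polar coordinates of a product of a radial function and a function of the
direction. -/
lemma integral_radial_mul_angular {d : ℕ} {f : Euc d → ℝ} {τ : ℝ → ℝ}
    {ψ : Euc d → ℝ} (h : ∀ u, u ≠ 0 → f u = τ ‖u‖ * ψ (‖u‖⁻¹ • u)) (hd : 0 < d) :
    ∫ u, f u = (∫ ζ : sphere (0 : Euc d) 1, ψ ζ ∂(volume : Measure (Euc d)).toSphere) *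
      ∫ r : Ioi (0 : ℝ), τ r ∂(Measure.volumeIoiPow (d - 1)) := by
  have hdim : Module.finrank ℝ (Euc d) = d := by simp
  have : Nontrivial (Euc d) := Module.nontrivial_of_finrank_pos (R := ℝ) (by rw [hdim]; exact hd)
  have hmp := (volume : Measure (Euc d)).measurePreserving_homeomorphUnitSphereProd
  rw [hdim] at hmp
  calc ∫ u, f u = ∫ x : ({(0)}ᶜ : Set (Euc d)), f x.1 ∂((volume : Measure (Euc d)).comap (↑)) := by
        rw [integral_subtype_comap (measurableSet_singleton _).compl f,
          restrict_compl_singleton]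
    _ = ∫ x : ({(0)}ᶜ : Set (Euc d)), (fun q : sphere (0 : Euc d) 1 × Ioi (0 : ℝ) =>
          ψ q.1 * τ q.2) (homeomorphUnitSphereProd (Euc d) x)
          ∂((volume : Measure (Euc d)).comap (↑)) := by
        congr 1
        ext x
        rw [h x.1 x.2, mul_comm]
        simp
    _ = ∫ q, ψ q.1 * τ q.2 ∂((volume : Measure (Euc d)).toSphere.prod
          (Measure.volumeIoiPow (d - 1))) :=
        hmp.integral_comp (Homeomorph.measurableEmbedding _)
          (fun q : sphere (0 : Euc d) 1 × Ioi (0 : ℝ) => ψ q.1 * τ q.2)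
    _ = _ := integral_prod_mul (fun ζ : sphere (0 : Euc d) 1 => ψ ζ)
          (fun r : Ioi (0 : ℝ) => τ r)

end Polar

/-! ### The difference between two consecutive cut-offs -/

section ScaleDiff

variable {E F : Type*} [NormedAddCommGroup E] [NormedSpace ℝ E]
  [NormedAddCommGroup F] [NormedSpace ℝ F] {γ p : ℝ}

/-- The difference of `Φ ∘ K` cut off at two consecutive dyadic scales. -/
noncomputable def scaleDiff (γ : ℝ) (Φ : F → ℝ) (K : E → F) (u : E) : ℝ :=
  Φ (cutKer γ 2 K u) - Φ (cutKer γ 1 K u)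

/-- The radial factor of `scaleDiff`. -/
noncomputable def scaleProfile (γ p r : ℝ) : ℝ :=
  (((min 1 (2 * r)) ^ (γ + 1)) ^ p - ((min 1 (1 * r)) ^ (γ + 1)) ^ p) * (r ^ (-γ)) ^ p

/-- Away from the origin the cut-off multiplies `K` by a positive number depending on `‖u‖` alone,
which homogeneity pulls out of `Φ`. Radius and direction therefore separate. -/
lemma scaleDiff_eq {Φ : F → ℝ} {K : E → F} (hΦ : PosHomogeneous p Φ)
    (hK : PosHomogeneous (-γ) K) {u : E} (hu : u ≠ 0) :
    scaleDiff γ Φ K u = scaleProfile γ p ‖u‖ * Φ (K (‖u‖⁻¹ • u)) := by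
  have hup : 0 < ‖u‖ := norm_pos_iff.2 hu
  have e : ∀ s : ℝ, 0 < s → Φ (cutKer γ s K u) =
      ((min 1 (s * ‖u‖)) ^ (γ + 1)) ^ p * (‖u‖ ^ (-γ)) ^ p * Φ (K (‖u‖⁻¹ • u)) := by
    intro s hs
    have h1 : 0 < min 1 (s * ‖u‖) := lt_min one_pos (by positivity)
    rw [cutKer, hΦ _ _ (by positivity), hK.eq_norm_rpow_smul hu, hΦ _ _ (by positivity),
      smul_eq_mul, smul_eq_mul, mul_assoc]
  rw [scaleDiff, e 2 two_pos, e 1 one_pos, scaleProfile]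
  ring

/-- Neither cut-off acts outside the unit ball. This is the source of all locality below. -/
lemma scaleDiff_eq_zero {Φ : F → ℝ} {K : E → F} {u : E} (hu : 1 ≤ ‖u‖) :
    scaleDiff γ Φ K u = 0 := by
  rw [scaleDiff, cutKer_of_one_le (by linarith), cutKer_of_one_le (by linarith), sub_self]

lemma PosHomogeneous.exists_tameKernel_cutKer (hγ : 0 < γ) {K : E → F}
    (h : PosHomogeneous (-γ) K) (hL : LipschitzOnUnitSphere K) :
    ∃ C, 0 < C ∧ TameKernel C γ (cutKer γ 1 K) ∧ TameKernel C γ (cutKer γ 2 K) := by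
  obtain ⟨C, hC, hT⟩ := h.exists_tameKernel_cutKer_one hγ hL
  have h2 := hT.two_smul hC hγ
  have e : (fun z => (2 : ℝ) ^ γ • cutKer γ 1 K ((2 : ℝ) • z)) = cutKer γ 2 K := by
    ext z; rw [h.cutKer_two_eq]
  rw [e] at h2
  refine ⟨2 ^ γ * 2 * C, by positivity, hT.mono ?_, h2⟩
  have : (1 : ℝ) ≤ 2 ^ γ := Real.one_le_rpow one_le_two hγ.le
  nlinarith

lemma continuous_scaleDiff (hγ : 0 < γ) (hp : 1 ≤ p) {Φ : F → ℝ} {K : E → F}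
    (hΦ : PosHomogeneous p Φ) (hΦL : LipschitzOnUnitSphere Φ)
    (hK : PosHomogeneous (-γ) K) (hKL : LipschitzOnUnitSphere K) :
    Continuous (scaleDiff γ Φ K) := by
  obtain ⟨C, -, h1, h2⟩ := hK.exists_tameKernel_cutKer hγ hKL
  have hc := hΦ.continuous hΦL hp
  exact (hc.comp h2.continuous).sub (hc.comp h1.continuous)

lemma exists_abs_scaleDiff_le (hγ : 0 < γ) (hp : 1 ≤ p) {Φ : F → ℝ} {K : E → F}
    (hΦ : PosHomogeneous p Φ) (hΦL : LipschitzOnUnitSphere Φ)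
    (hK : PosHomogeneous (-γ) K) (hKL : LipschitzOnUnitSphere K) :
    ∃ M, 0 < M ∧ ∀ u, |scaleDiff γ Φ K u| ≤ M := by
  obtain ⟨C, hC, h1, h2⟩ := hK.exists_tameKernel_cutKer hγ hKL
  obtain ⟨B, hB, hb⟩ := hΦ.exists_norm_le hΦL (by linarith)
  have key : ∀ {G : E → F}, TameKernel C γ G → ∀ u, |Φ (G u)| ≤ B * C ^ p := by
    intro G hG u
    refine (hb _).trans ?_
    have : ‖G u‖ ≤ C := (hG.norm_le u).trans
      (mul_le_of_le_one_right hC.le (dec_le_one hγ (norm_nonneg _)))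
    gcongr
  refine ⟨B * C ^ p + B * C ^ p, by positivity, fun u => ?_⟩
  exact (abs_sub _ _).trans (add_le_add (key h2 u) (key h1 u))

lemma PosHomogeneous.neg {q : ℝ} {K : E → F} (h : PosHomogeneous q K) :
    PosHomogeneous q (fun z => -K z) := by
  intro y t ht
  simp only [h y t ht, smul_neg]

lemma LipschitzOnUnitSphere.neg {K : E → F} (h : LipschitzOnUnitSphere K) :
    LipschitzOnUnitSphere (fun z => -K z) := by
  obtain ⟨L, hL⟩ := h
  exact ⟨L, hL.neg⟩

end ScaleDiff

/-! ### Integrals over half-spaces and half-spheres -/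

section HalfSpace

variable {d : ℕ} {F : Type*} [NormedAddCommGroup F] [NormedSpace ℝ F] {γ p : ℝ}

/-- The open half-space with outer normal `ξ`. -/
def halfSpace (ξ : Euc d) : Set (Euc d) := {u | ⟪ξ, u⟫ < 0}

lemma isOpen_halfSpace (ξ : Euc d) : IsOpen (halfSpace ξ) :=
  isOpen_lt (by fun_prop) (by fun_prop)

/-- The radial factor does not depend on `K` and `Φ`, so it can be read off from the model pair `‖z‖
^ (-γ)` and `|w| ^ p`. For that pair `scaleDiff` is continuous, nonnegative, compactly supported and
not identically zero, so its integral, a multiple of the radial one, is positive. -/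
lemma integral_scaleProfile_ne_zero (hd : 0 < d) (hγ : 0 < γ) (hp : 1 ≤ p) :
    ∫ r : Ioi (0 : ℝ), scaleProfile γ p r ∂(Measure.volumeIoiPow (d - 1)) ≠ 0 := by
  set K : Euc d → ℝ := fun z => ‖z‖ ^ (-γ) with hKdef
  set Φ : ℝ → ℝ := fun w => |w| ^ p with hΦdef
  have hK : PosHomogeneous (-γ) K := fun y t ht => by
    simp only [hKdef, norm_smul, Real.norm_of_nonneg ht.le, smul_eq_mul]
    rw [Real.mul_rpow ht.le (norm_nonneg _)]
  have hΦ : PosHomogeneous p Φ := fun y t ht => by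
    simp only [hΦdef, smul_eq_mul, abs_mul, abs_of_pos ht]
    rw [Real.mul_rpow ht.le (abs_nonneg _)]
  have hKL : LipschitzOnUnitSphere K := by
    refine ⟨0, LipschitzOnWith.of_dist_le_mul fun x hx y hy => ?_⟩
    rw [mem_sphere_zero_iff_norm] at hx hy
    simp [hKdef, hx, hy]
  have hΦL : LipschitzOnUnitSphere Φ := by
    refine ⟨0, LipschitzOnWith.of_dist_le_mul fun x hx y hy => ?_⟩
    rw [mem_sphere_zero_iff_norm, Real.norm_eq_abs] at hx hy
    simp [hΦdef, hx, hy]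
  have hform : ∀ u : Euc d, u ≠ 0 → scaleDiff γ Φ K u = scaleProfile γ p ‖u‖ * 1 := by
    intro u hu
    rw [scaleDiff_eq hΦ hK hu]
    have : ‖‖u‖⁻¹ • u‖ = 1 := by simpa using inv_norm_smul_mem_sphere hu
    simp [hΦdef, hKdef, this]
  have h1 := integral_radial_mul_angular (ψ := fun _ => 1) hform hd
  have hcont := continuous_scaleDiff hγ hp hΦ hΦL hK hKL
  have h0 : scaleDiff γ Φ K 0 = 0 := by
    simp [scaleDiff, cutKer, Real.zero_rpow (show γ + 1 ≠ 0 by linarith)]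
  have hnn : 0 ≤ scaleDiff γ Φ K := by
    intro u
    by_cases hu : u = 0
    · rw [hu, h0]; rfl
    · rw [hform u hu, mul_one, scaleProfile]
      have hup : 0 < ‖u‖ := norm_pos_iff.2 hu
      refine mul_nonneg (sub_nonneg.2 ?_) (by positivity)
      gcongr
      linarith
  have : Nontrivial (Euc d) :=
    Module.nontrivial_of_finrank_pos (R := ℝ) (by simpa using hd)
  -- At radius one half the finer cut-off is already inactive while the coarser one still damps the
  -- kernel.
  obtain ⟨e, he⟩ := exists_norm_eq (Euc d) (show (0 : ℝ) ≤ 1 / 2 by norm_num)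
  have hne : scaleDiff γ Φ K e ≠ 0 := by
    have he0 : e ≠ 0 := by
      intro h; rw [h, norm_zero] at he; norm_num at he
    rw [hform e he0, he, scaleProfile]
    have h2 : (((1 : ℝ) / 2) ^ (γ + 1)) ^ p < 1 :=
      Real.rpow_lt_one (by positivity) (Real.rpow_lt_one (by positivity) (by norm_num)
        (by linarith)) (by linarith)
    have e1 : min (1 : ℝ) (2 * (1 / 2)) = 1 := by norm_num
    have e2 : min (1 : ℝ) (1 * (1 / 2)) = 1 / 2 := by norm_num
    rw [e1, e2, Real.one_rpow, Real.one_rpow]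
    have : 0 < (((1 : ℝ) / 2) ^ (-γ)) ^ p := by positivity
    have h3 : 0 < 1 - (((1 : ℝ) / 2) ^ (γ + 1)) ^ p := by linarith
    positivity
  have hcs : HasCompactSupport (scaleDiff γ Φ K) := by
    refine HasCompactSupport.of_support_subset_isCompact (isCompact_closedBall (0 : Euc d) 1) ?_
    intro u hu
    rw [mem_closedBall_zero_iff]
    by_contra hc
    exact hu (scaleDiff_eq_zero (by linarith))
  have hpos : 0 < ∫ u, scaleDiff γ Φ K u :=
    hcont.integral_pos_of_hasCompactSupport_nonneg_nonzero hcs hnn hne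
  intro hz
  rw [h1, hz, mul_zero] at hpos
  exact lt_irrefl _ hpos

/-- A half-space is a cone, so its indicator depends on the direction only and joins the angular
factor. The sign in `-ξ` appears because `halfSpace ξ` lies on the side opposite to its outer
normal. -/
lemma setIntegral_halfSpace_scaleDiff (hd : 0 < d) {Φ : F → ℝ} {K : Euc d → F}
    (hΦ : PosHomogeneous p Φ) (hK : PosHomogeneous (-γ) K) (ξ : Euc d) :
    ∫ u in halfSpace ξ, scaleDiff γ Φ K u = halfSphereIntegral (-ξ) (fun ζ => Φ (K ζ)) *
      ∫ r : Ioi (0 : ℝ), scaleProfile γ p r ∂(Measure.volumeIoiPow (d - 1)) := by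
  rw [← integral_indicator (isOpen_halfSpace ξ).measurableSet]
  have hmeas : MeasurableSet {ζ : sphere (0 : Euc d) 1 | 0 < ⟪(ζ : Euc d), -ξ⟫} :=
    (isOpen_lt (by fun_prop) (by fun_prop)).measurableSet
  have hset : ∀ u : Euc d, u ∈ halfSpace ξ ↔ 0 < ⟪u, -ξ⟫ := by
    intro u
    rw [halfSpace, mem_ofPred_eq, inner_neg_right, real_inner_comm, neg_pos]
  rw [integral_radial_mul_angular (τ := scaleProfile γ p)
    (ψ := (halfSpace ξ).indicator fun ζ => Φ (K ζ)) ?_ hd, halfSphereIntegral,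
    ← integral_indicator hmeas]
  · congr 2
    ext ζ
    by_cases h : (ζ : Euc d) ∈ halfSpace ξ
    · rw [indicator_of_mem h]
      exact (indicator_of_mem (s := {ζ : sphere (0 : Euc d) 1 | 0 < ⟪(ζ : Euc d), -ξ⟫})
        ((hset _).1 h) (fun ζ : sphere (0 : Euc d) 1 => Φ (K ζ))).symm
    · rw [indicator_of_notMem h]
      exact (indicator_of_notMem (s := {ζ : sphere (0 : Euc d) 1 | 0 < ⟪(ζ : Euc d), -ξ⟫})
        (fun h' => h ((hset _).2 h')) (fun ζ : sphere (0 : Euc d) 1 => Φ (K ζ))).symm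
  · intro u hu
    have hup : 0 < ‖u‖⁻¹ := inv_pos.2 (norm_pos_iff.2 hu)
    have hiff : ‖u‖⁻¹ • u ∈ halfSpace ξ ↔ u ∈ halfSpace ξ := by
      simp only [halfSpace, mem_ofPred_eq, inner_smul_right]
      exact ⟨fun h => by_contra fun h' => by nlinarith, fun h => by nlinarith⟩
    by_cases h : u ∈ halfSpace ξ
    · rw [indicator_of_mem h, indicator_of_mem (hiff.2 h), scaleDiff_eq hΦ hK hu]
    · rw [indicator_of_notMem h, indicator_of_notMem (fun h' => h (hiff.1 h')), mul_zero]

/-- A slab in the unit ball has measure at most proportional to its width. -/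
lemma volume_slab_le {ξ : Euc d} (hξ : ‖ξ‖ = 1) {η : ℝ} :
    volume {u : Euc d | ‖u‖ ≤ 1 ∧ |⟪ξ, u⟫| ≤ η} ≤ ENNReal.ofReal (2 ^ d * η) := by
  obtain ⟨i⟩ : Nonempty (Fin d) := by
    by_contra hne
    rw [not_nonempty_iff] at hne
    have : ξ = 0 := Subsingleton.elim _ _
    simp [this] at hξ
  -- Complete `ξ` to an orthonormal basis. In its coordinates the slab lies in a box with one side
  -- `2 * η` and the others equal to two.
  have horth : Orthonormal ℝ (({i} : Set (Fin d)).domRestrict fun _ : Fin d => ξ) := by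
    refine ⟨fun _ => hξ, fun a b hab => ?_⟩
    exact absurd (Subsingleton.elim a b) hab
  obtain ⟨b, hb⟩ := horth.exists_orthonormalBasis_extension_of_card_eq (by simp)
  have hbi : b i = ξ := hb i rfl
  have hmp := (PiLp.volume_preserving_ofLp (Fin d)).comp b.measurePreserving_repr
  set S : Set (Fin d → ℝ) := Set.pi univ fun j => if j = i then Icc (-η) η else Icc (-1) 1 with hS
  have hsub : {u : Euc d | ‖u‖ ≤ 1 ∧ |⟪ξ, u⟫| ≤ η} ⊆
      ((WithLp.ofLp : Euc d → Fin d → ℝ) ∘ b.repr) ⁻¹' S := by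
    rintro u ⟨hu1, hu2⟩
    simp only [hS, mem_preimage, mem_pi, mem_univ, true_imp_iff, Function.comp]
    intro j
    rw [b.repr_apply_apply]
    split_ifs with hj
    · rw [hj, hbi]; exact abs_le.1 hu2
    · refine abs_le.1 ((abs_real_inner_le_norm _ _).trans ?_)
      rw [b.orthonormal.1 j, one_mul]; exact hu1
  have hSm : MeasurableSet S := by
    refine MeasurableSet.univ_pi fun j => ?_
    split_ifs <;> exact measurableSet_Icc
  calc _ ≤ volume (((WithLp.ofLp : Euc d → Fin d → ℝ) ∘ b.repr) ⁻¹' S) := measure_mono hsub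
    _ = volume S := hmp.measure_preimage hSm.nullMeasurableSet
    _ = ∏ j, (if j = i then ENNReal.ofReal (2 * η) else ENNReal.ofReal 2) := by
        rw [hS, volume_pi_pi]
        refine Finset.prod_congr rfl fun j _ => ?_
        split_ifs <;> rw [Real.volume_Icc] <;> congr 1 <;> ring
    _ = ENNReal.ofReal (2 ^ d * η) := by
        have : ∀ j : Fin d, (if j = i then ENNReal.ofReal (2 * η) else ENNReal.ofReal 2) =
            ENNReal.ofReal 2 * (if j = i then ENNReal.ofReal η else 1) := by
          intro j
          split_ifs
          · rw [ENNReal.ofReal_mul two_pos.le]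
          · rw [mul_one]
        simp only [this]
        rw [Finset.prod_mul_distrib, Finset.prod_const, Finset.prod_ite_eq' Finset.univ i,
          ENNReal.ofReal_mul (by positivity), ENNReal.ofReal_pow two_pos.le]
        simp

/-- If the integrals over all half-spaces vanish, so does the integral over the whole space. -/
lemma integral_eq_zero_of_halfSpace {g : Euc d → ℝ} (hg : Integrable g) (hd : 0 < d)
    (h : ∀ ξ : Euc d, ‖ξ‖ = 1 → ∫ u in halfSpace ξ, g u = 0) : ∫ u, g u = 0 := by
  have : Nontrivial (Euc d) :=
    Module.nontrivial_of_finrank_pos (R := ℝ) (by simpa using hd)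
  obtain ⟨ξ, hξ⟩ := exists_norm_eq (Euc d) (zero_le_one (α := ℝ))
  have hm := (isOpen_halfSpace ξ).measurableSet
  rw [← integral_add_compl hm hg, h ξ hξ, zero_add, ← h (-ξ) (by rw [norm_neg, hξ])]
  -- The complement of `halfSpace ξ` is `halfSpace (-ξ)` up to the bounding hyperplane, which is a
  -- null set.
  refine setIntegral_congr_set ?_
  have hnull : volume ((LinearMap.ker (innerₗ (Euc d) ξ) : Submodule ℝ (Euc d)) : Set (Euc d)) = 0 := by
    refine Measure.addHaar_submodule _ _ fun htop => ?_
    have h1 : ξ ∈ LinearMap.ker (innerₗ (Euc d) ξ) := by rw [htop]; trivial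
    have h2 : ⟪ξ, ξ⟫ = 0 := h1
    rw [real_inner_self_eq_norm_sq, hξ] at h2
    norm_num at h2
  have hae : ∀ᵐ u : Euc d, ⟪ξ, u⟫ ≠ 0 := by
    rw [ae_iff]
    refine measure_mono_null ?_ hnull
    intro u hu
    simp only [ne_eq, not_not, mem_ofPred_eq] at hu
    exact hu
  filter_upwards [hae] with u hu
  refine propext ?_
  change ¬ (⟪ξ, u⟫ < 0) ↔ ⟪-ξ, u⟫ < 0
  rw [inner_neg_left, neg_lt_zero, not_lt]
  exact ⟨fun h => lt_of_le_of_ne h (Ne.symm hu), le_of_lt⟩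

end HalfSpace

/-! ### First-order Taylor estimate with Hölder gradient -/

section Taylor

variable {E : Type*} [NormedAddCommGroup E] [InnerProductSpace ℝ E] [CompleteSpace E]

/-- Mean value inequality for `h` minus its linear part at `a`, on the convex intersection of the
given ball with the closed ball about `a` of radius `‖b - a‖`. There the derivative deviates by at
most `C * ‖b - a‖ ^ β`. -/
lemma abs_sub_sub_inner_gradient_le {h : E → ℝ} {c : E} {r : ℝ} {C β : ℝ≥0}
    (hd : ∀ y ∈ ball c r, DifferentiableAt ℝ h y)
    (hH : HolderOnWith C β (gradient h) (ball c r)) {a b : E} (ha : a ∈ ball c r)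
    (hb : b ∈ ball c r) :
    |h b - h a - ⟪gradient h a, b - a⟫| ≤ C * ‖b - a‖ ^ (β : ℝ) * ‖b - a‖ := by
  have hbound : ∀ y ∈ ball c r ∩ closedBall a ‖b - a‖,
      ‖fderiv ℝ h y - fderiv ℝ h a‖ ≤ C * ‖b - a‖ ^ (β : ℝ) := by
    rintro y ⟨hy1, hy2⟩
    rw [← toDual_gradient, ← toDual_gradient, ← map_sub, LinearIsometryEquiv.norm_map,
      ← dist_eq_norm]
    refine (hH.dist_le hy1 ha).trans ?_
    gcongr
    exact hy2
  have h1 := Convex.norm_image_sub_le_of_norm_fderiv_le' (𝕜 := ℝ)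
    (fun y hy => hd y (mem_of_mem_inter_left hy)) hbound
    ((convex_ball c r).inter (convex_closedBall a ‖b - a‖))
    (x := a) (y := b) ⟨ha, by simp⟩ ⟨hb, by simp [dist_eq_norm]⟩
  rw [← toDual_gradient] at h1
  exact h1

end Taylor

/-! ### Tangent half-spaces of the domain -/

section Domain

variable {d : ℕ} {Ω : Set (Euc d)}

/-- Near `z`, up to an error of order `‖x - z‖ ^ (1 + β)`, the set `Ω` is the half-space with outer
normal `ξ`. -/
structure IsTangent (Ω : Set (Euc d)) (β C r : ℝ) (z ξ : Euc d) : Prop where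
  norm_eq : ‖ξ‖ = 1
  mem : ∀ x, ‖x - z‖ < r → ⟪ξ, x - z⟫ < -(C * ‖x - z‖ ^ (1 + β)) → x ∈ Ω
  notMem : ∀ x, ‖x - z‖ < r → C * ‖x - z‖ ^ (1 + β) < ⟪ξ, x - z⟫ → x ∉ Ω

lemma IsTangent.mono {β C C' r r' : ℝ} {z ξ : Euc d} (h : IsTangent Ω β C r z ξ) (hC : C ≤ C')
    (hr : r' ≤ r) : IsTangent Ω β C' r' z ξ := by
  have key : ∀ x : Euc d, C * ‖x - z‖ ^ (1 + β) ≤ C' * ‖x - z‖ ^ (1 + β) := fun x => by gcongr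
  exact ⟨h.norm_eq, fun x hx h1 => h.mem x (by linarith) (by linarith [key x]),
    fun x hx h1 => h.notMem x (by linarith) (by linarith [key x])⟩

/-- The outer normal is the normalization of `ν - ∇h`, and the deviation from the tangent hyperplane
is the Taylor remainder of `h`. Halving the radius keeps the ball about `z` within the chart about
`z₀`. -/
lemma exists_isTangent_of_subgraph (hΩ : IsOpen Ω) {β : ℝ≥0} {z₀ ν : Euc d} (hν : ‖ν‖ = 1)
    {h : (ℝ ∙ ν)ᗮ → ℝ} {C : ℝ≥0} {r : ℝ}
    (hd : ∀ y ∈ ball ((ℝ ∙ ν)ᗮ.orthogonalProjectionOnto z₀) r, DifferentiableAt ℝ h y)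
    (hH : HolderOnWith C β (gradient h) (ball ((ℝ ∙ ν)ᗮ.orthogonalProjectionOnto z₀) r))
    (hx : ∀ x ∈ ball z₀ r, x ∈ Ω ↔ ⟪ν, x⟫ < h ((ℝ ∙ ν)ᗮ.orthogonalProjectionOnto x))
    {z : Euc d} (hz : z ∈ frontier Ω) (hz₀ : z ∈ ball z₀ (r / 2)) :
    ∃ ξ, IsTangent Ω β C (r / 2) z ξ := by
  set P := (ℝ ∙ ν)ᗮ.orthogonalProjectionOnto with hP
  have hPle : ∀ v, ‖P v‖ ≤ ‖v‖ := fun v => Submodule.norm_orthogonalProjectionOnto_apply_le _ v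
  have hr : 0 < r := by
    have := pos_of_mem_ball hz₀
    linarith
  have hPball : ∀ x ∈ ball z₀ r, P x ∈ ball (P z₀) r := by
    intro x hx
    rw [mem_ball_iff_norm] at hx ⊢
    rw [← map_sub]
    exact (hPle _).trans_lt hx
  have hzr : z ∈ ball z₀ r := ball_subset_ball (by linarith) hz₀
  -- A boundary point lies on the graph: strictly above it, continuity of `h` would keep a
  -- neighbourhood out of `Ω`; strictly below it, the point would belong to the open set `Ω`.
  have hzeq : ⟪ν, z⟫ = h (P z) := by
    apply le_antisymm
    · by_contra hlt
      push Not at hlt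
      have hcont : ContinuousAt (fun x => ⟪ν, x⟫ - h (P x)) z := by
        refine ContinuousAt.sub (by fun_prop) ?_
        exact ContinuousAt.comp (f := fun x => P x) (hd _ (hPball z hzr)).continuousAt
          P.continuous.continuousAt
      have hev : ∀ᶠ x in nhds z, x ∉ Ω := by
        have h1 := hcont.eventually (lt_mem_nhds (show 0 < ⟪ν, z⟫ - h (P z) by linarith))
        filter_upwards [h1, isOpen_ball.mem_nhds hzr] with x h2 h3 h4
        have := (hx x h3).1 h4
        linarith
      exact (mem_closure_iff_frequently.1 (frontier_subset_closure hz)) hev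
    · by_contra hlt
      push Not at hlt
      have : z ∈ Ω := (hx z hzr).2 hlt
      rw [hΩ.frontier_eq] at hz
      exact hz.2 this
  set w := gradient h (P z) with hw
  set n : Euc d := ν - (w : Euc d) with hn
  have hνw : ⟪ν, (w : Euc d)⟫ = 0 :=
    Submodule.mem_orthogonal_singleton_iff_inner_right.1 w.2
  -- The component of `n` along `ν` is one. Hence passing to the unit normal does not worsen the
  -- constant `C`.
  have hn1 : 1 ≤ ‖n‖ := by
    have h1 : ⟪ν, n⟫ = 1 := by
      rw [hn, inner_sub_right, hνw, real_inner_self_eq_norm_sq, hν]; norm_num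
    have h2 := real_inner_le_norm ν n
    rw [h1, hν, one_mul] at h2
    exact h2
  have hn0 : 0 < ‖n‖ := by linarith
  have hinner : ∀ x, ⟪n, x - z⟫ = ⟪ν, x⟫ - ⟪ν, z⟫ - ⟪w, P x - P z⟫ := by
    intro x
    rw [hn, inner_sub_left, inner_sub_right ν, ← map_sub,
      Submodule.inner_orthogonalProjectionOnto_eq_of_mem_left]
  have herr : ∀ x, ‖x - z‖ < r / 2 →
      |h (P x) - h (P z) - ⟪w, P x - P z⟫| ≤ C * ‖x - z‖ ^ (1 + (β : ℝ)) := by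
    intro x hxz
    have hxr : x ∈ ball z₀ r := by
      rw [mem_ball_iff_norm] at hz₀ ⊢
      calc ‖x - z₀‖ = ‖(x - z) + (z - z₀)‖ := by rw [sub_add_sub_cancel]
        _ ≤ ‖x - z‖ + ‖z - z₀‖ := norm_add_le _ _
        _ < r := by linarith
    refine (abs_sub_sub_inner_gradient_le hd hH (hPball z hzr) (hPball x hxr)).trans ?_
    have h1 : ‖P x - P z‖ ≤ ‖x - z‖ := by rw [← map_sub]; exact hPle _
    calc C * ‖P x - P z‖ ^ (β : ℝ) * ‖P x - P z‖ ≤ C * ‖x - z‖ ^ (β : ℝ) * ‖x - z‖ := by gcongr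
      _ = C * ‖x - z‖ ^ (1 + (β : ℝ)) := by
        rcases (norm_nonneg (x - z)).eq_or_lt with h0 | h0
        · rw [← h0, Real.zero_rpow (show 1 + (β : ℝ) ≠ 0 by positivity)]; ring
        · rw [add_comm, Real.rpow_add_one h0.ne']; ring
  have hball : ∀ x, ‖x - z‖ < r / 2 → x ∈ ball z₀ r := by
    intro x hxz
    rw [mem_ball_iff_norm] at hz₀ ⊢
    calc ‖x - z₀‖ = ‖(x - z) + (z - z₀)‖ := by rw [sub_add_sub_cancel]
      _ ≤ ‖x - z‖ + ‖z - z₀‖ := norm_add_le _ _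
      _ < r := by linarith
  have hscale : ∀ x, ⟪n, x - z⟫ = ‖n‖ * ⟪‖n‖⁻¹ • n, x - z⟫ := by
    intro x
    rw [real_inner_smul_left, ← mul_assoc, mul_inv_cancel₀ hn0.ne', one_mul]
  refine ⟨‖n‖⁻¹ • n, by simp [norm_smul, hn0.ne'], fun x hxz hlt => ?_, fun x hxz hlt => ?_⟩
  · rw [hx x (hball x hxz)]
    have h1 := (abs_le.1 (herr x hxz)).1
    have h2 := hinner x
    have h3 := hscale x
    have h4 : 0 ≤ C * ‖x - z‖ ^ (1 + (β : ℝ)) := by positivity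
    have h5 : ‖n‖ * ⟪‖n‖⁻¹ • n, x - z⟫ < -(C * ‖x - z‖ ^ (1 + (β : ℝ))) := by nlinarith
    linarith
  · rw [hx x (hball x hxz)]
    have h1 := (abs_le.1 (herr x hxz)).2
    have h2 := hinner x
    have h3 := hscale x
    have h4 : 0 ≤ C * ‖x - z‖ ^ (1 + (β : ℝ)) := by positivity
    have h5 : C * ‖x - z‖ ^ (1 + (β : ℝ)) < ‖n‖ * ⟪‖n‖⁻¹ • n, x - z⟫ := by nlinarith
    linarith

/-- A bounded open set with `C^{1,β}` boundary is uniformly close to half-spaces at its boundary. -/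
lemma HasC1HolderBoundary.exists_isTangent (hΩ : IsOpen Ω) (hb : Bornology.IsBounded Ω) {β : ℝ≥0}
    (h : HasC1HolderBoundary β Ω) :
    ∃ C r : ℝ, 0 ≤ C ∧ 0 < r ∧ ∀ z ∈ frontier Ω, ∃ ξ, IsTangent Ω β C r z ξ := by
  have hcomp : IsCompact (frontier Ω) :=
    hb.isCompact_closure.of_isClosed_subset isClosed_frontier frontier_subset_closure
  have key : ∃ C r : ℝ, 0 ≤ C ∧ 0 < r ∧ ∀ z ∈ frontier Ω, z ∈ frontier Ω →
      ∃ ξ, IsTangent Ω β C r z ξ := by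
    -- Uniformity comes from compactness of the boundary: the existence of common constants on `s`
    -- holds locally and survives finite unions, with the larger `C` and the smaller `r`.
    refine hcomp.induction_on (p := fun s => ∃ C r : ℝ, 0 ≤ C ∧ 0 < r ∧
      ∀ z ∈ s, z ∈ frontier Ω → ∃ ξ, IsTangent Ω β C r z ξ) ⟨0, 1, le_rfl, one_pos, by simp⟩ ?_ ?_ ?_
    · rintro s t hst ⟨C, r, hC, hr, H⟩
      exact ⟨C, r, hC, hr, fun z hz => H z (hst hz)⟩
    · rintro s t ⟨C, r, hC, hr, H⟩ ⟨C', r', hC', hr', H'⟩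
      refine ⟨max C C', min r r', le_max_of_le_left hC, lt_min hr hr', ?_⟩
      rintro z (hz | hz) hzf
      · obtain ⟨ξ, hξ⟩ := H z hz hzf
        exact ⟨ξ, hξ.mono (le_max_left _ _) (min_le_left _ _)⟩
      · obtain ⟨ξ, hξ⟩ := H' z hz hzf
        exact ⟨ξ, hξ.mono (le_max_right _ _) (min_le_right _ _)⟩
    · intro z₀ hz₀
      obtain ⟨ν, hν, g, C, r, hr, hd, hH, hx⟩ := h z₀ hz₀
      refine ⟨ball z₀ (r / 2), mem_nhdsWithin_of_mem_nhds (ball_mem_nhds _ (by linarith)),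
        C, r / 2, C.2, by linarith, fun z hz hzf => ?_⟩
      exact exists_isTangent_of_subgraph hΩ hν hd hH hx hzf hz
  obtain ⟨C, r, hC, hr, H⟩ := key
  exact ⟨C, r, hC, hr, fun z hz => H z hz hz⟩

/-- Every direction is an outer normal at some boundary point. -/
lemma exists_mem_frontier_max (hΩ : IsOpen Ω) (hne : Ω.Nonempty)
    (hb : Bornology.IsBounded Ω) {ξ : Euc d} (hξ : ‖ξ‖ = 1) :
    ∃ z ∈ frontier Ω, ∀ x ∈ Ω, ⟪ξ, x⟫ ≤ ⟪ξ, z⟫ := by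
  obtain ⟨z, hz, hmax⟩ := hb.isCompact_closure.exists_isMaxOn hne.closure
    (f := fun x => ⟪ξ, x⟫) (by fun_prop)
  refine ⟨z, ?_, fun x hx => hmax (subset_closure hx)⟩
  rw [hΩ.frontier_eq]
  refine ⟨hz, fun hzΩ => ?_⟩
  obtain ⟨ε, hε, hball⟩ := Metric.isOpen_iff.1 hΩ z hzΩ
  have h1 : z + (ε / 2) • ξ ∈ Ω := by
    apply hball
    rw [mem_ball_iff_norm, add_sub_cancel_left, norm_smul, hξ, Real.norm_of_nonneg (by linarith)]
    linarith
  have h2 : ⟪ξ, z + (ε / 2) • ξ⟫ ≤ ⟪ξ, z⟫ := hmax (subset_closure h1)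
  rw [inner_add_right, real_inner_smul_right, real_inner_self_eq_norm_sq, hξ] at h2
  linarith

/-- If the normals differed, a small step from `z` along `ξ₀ - ξ` would go inward for `ξ`, linearly
in the step and so beating the error of order `1 + β`, while increasing `⟪ξ₀, ·⟫`. It would reach a
point of `Ω` beyond the maximum. -/
lemma IsTangent.eq_of_max {β C r : ℝ} (hβ : 0 < β) (hC : 0 ≤ C) (hr : 0 < r) {z ξ ξ₀ : Euc d}
    (h : IsTangent Ω β C r z ξ) (hξ₀ : ‖ξ₀‖ = 1) (hmax : ∀ x ∈ Ω, ⟪ξ₀, x⟫ ≤ ⟪ξ₀, z⟫) :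
    ξ = ξ₀ := by
  by_contra hne
  have hlt : ⟪ξ, ξ₀⟫ < 1 := inner_lt_one_iff_real_of_norm_eq_one h.norm_eq hξ₀ |>.2 hne
  set u := ξ₀ - ξ with hu
  have hu1 : ⟪ξ, u⟫ = ⟪ξ, ξ₀⟫ - 1 := by
    rw [hu, inner_sub_right, real_inner_self_eq_norm_sq, h.norm_eq]; norm_num
  have hu2 : ⟪ξ₀, u⟫ = 1 - ⟪ξ, ξ₀⟫ := by
    rw [hu, inner_sub_right, real_inner_self_eq_norm_sq, hξ₀, real_inner_comm]; norm_num
  have hT : Filter.Tendsto (fun s : ℝ => C * (s ^ β * ‖u‖ ^ (1 + β)) + s * ‖u‖)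
      (nhdsWithin 0 (Ioi 0)) (nhds 0) := by
    have hc : Continuous (fun s : ℝ => C * (s ^ β * ‖u‖ ^ (1 + β)) + s * ‖u‖) := by
      have : Continuous (fun s : ℝ => s ^ β) := Real.continuous_rpow_const hβ.le
      fun_prop
    have := hc.tendsto 0
    rw [Real.zero_rpow hβ.ne'] at this
    simp only [zero_mul, mul_zero, add_zero] at this
    exact this.mono_left nhdsWithin_le_nhds
  have hev := hT.eventually (gt_mem_nhds (show (0 : ℝ) < min (1 - ⟪ξ, ξ₀⟫) r from
    lt_min (by linarith) hr))
  obtain ⟨s, hs1, hs0⟩ := (hev.and self_mem_nhdsWithin).exists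
  have hs0 : 0 < s := hs0
  have hA : 0 ≤ C * (s ^ β * ‖u‖ ^ (1 + β)) := by positivity
  have hB : 0 ≤ s * ‖u‖ := by positivity
  have hs2 := lt_min_iff.1 hs1
  have hnorm : ‖z + s • u - z‖ = s * ‖u‖ := by
    rw [add_sub_cancel_left, norm_smul, Real.norm_of_nonneg hs0.le]
  have hmem : z + s • u ∈ Ω := by
    refine h.mem _ (by rw [hnorm]; linarith) ?_
    rw [hnorm, add_sub_cancel_left, real_inner_smul_right, hu1,
      Real.mul_rpow hs0.le (norm_nonneg _), add_comm 1 β, Real.rpow_add_one hs0.ne']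
    have h3 : C * (s ^ β * ‖u‖ ^ (1 + β)) < 1 - ⟪ξ, ξ₀⟫ := by linarith
    rw [add_comm 1 β] at h3
    nlinarith
  have h4 := hmax _ hmem
  rw [inner_add_right, real_inner_smul_right, hu2] at h4
  nlinarith

/-! ### Rescaled integrals over the domain -/

/-- Change of variables under translations and dilations. -/
lemma integral_comp_rescale {V : Type*} [NormedAddCommGroup V] [NormedSpace ℝ V] (F : Euc d → V)
    {t : ℝ} (ht : 0 < t) (y : Euc d) :
    ∫ x, F (t⁻¹ • (x - y)) = t ^ d • ∫ u, F u := by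
  rw [integral_sub_right_eq_self (fun x => F (t⁻¹ • x)) y, Measure.integral_comp_smul]
  congr 1
  simp [abs_of_pos ht]

lemma setIntegral_comp_rescale {V : Type*} [NormedAddCommGroup V] [NormedSpace ℝ V]
    (hΩ : MeasurableSet Ω) (g : Euc d → V) {t : ℝ} (ht : 0 < t) (y : Euc d) :
    ∫ x in Ω, g (t⁻¹ • (x - y)) = t ^ d • ∫ u, ((fun u => y + t • u) ⁻¹' Ω).indicator g u := by
  rw [← integral_indicator hΩ, ← integral_comp_rescale _ ht y]
  congr 1
  ext x
  have hx : y + t • (t⁻¹ • (x - y)) = x := by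
    rw [smul_smul, mul_inv_cancel₀ ht.ne', one_smul, add_sub_cancel]
  by_cases h : x ∈ Ω
  · rw [indicator_of_mem h, indicator_of_mem]
    rw [mem_preimage, hx]; exact h
  · rw [indicator_of_notMem h, indicator_of_notMem]
    rw [mem_preimage, hx]; exact h

variable {g : Euc d → ℝ} {M : ℝ}

/-- Replacement of a domain by a half-space in an integral at the scale `t` near the boundary. -/
lemma IsTangent.abs_setIntegral_sub_le (hΩ : MeasurableSet Ω) (hg : Integrable g)
    (hM : ∀ u, |g u| ≤ M) (hsupp : ∀ u, 1 ≤ ‖u‖ → g u = 0) {β C r : ℝ} (hβ : 0 < β) (hC : 0 ≤ C)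
    {z ξ : Euc d} (h : IsTangent Ω β C r z ξ) {y : Euc d} {t : ℝ} (ht : 0 < t)
    (hyz : ‖y - z‖ ≤ t) (htr : 2 * t ≤ r) :
    |(∫ x in Ω, g (t⁻¹ • (x - y))) - t ^ d * ∫ u in halfSpace ξ, g u| ≤
      t ^ d * (M * (2 ^ d * (‖y - z‖ / t + C * 2 ^ (1 + β) * t ^ β))) := by
  have hM0 : 0 ≤ M := (abs_nonneg _).trans (hM 0)
  -- Half-width, in rescaled coordinates, of the slab where the two domains may differ: the shift
  -- from `y` to `z`, plus the boundary error `C * (2 * t) ^ (1 + β)` divided by `t`. Inside the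
  -- unit ball but off this slab, membership in both domains agrees.
  set η := ‖y - z‖ / t + C * 2 ^ (1 + β) * t ^ β with hη
  have hη0 : 0 ≤ η := by positivity
  set S : Set (Euc d) := {u | ‖u‖ ≤ 1 ∧ |⟪ξ, u⟫| ≤ η} with hS
  have hSm : MeasurableSet S := by
    have h1 : IsClosed {u : Euc d | ‖u‖ ≤ 1} := isClosed_le (by fun_prop) (by fun_prop)
    have h2 : IsClosed {u : Euc d | |⟪ξ, u⟫| ≤ η} := isClosed_le (by fun_prop) (by fun_prop)
    exact (h1.inter h2).measurableSet
  have hSv := volume_slab_le (d := d) h.norm_eq (η := η)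
  have hHm := (isOpen_halfSpace ξ).measurableSet
  have hAm : MeasurableSet ((fun u => y + t • u) ⁻¹' Ω) := by
    have : Measurable (fun u : Euc d => y + t • u) := by fun_prop
    exact this hΩ
  rw [setIntegral_comp_rescale hΩ g ht y, smul_eq_mul, ← mul_sub, abs_mul,
    abs_of_pos (by positivity), ← integral_indicator hHm,
    ← integral_sub (hg.indicator hAm) (hg.indicator hHm)]
  gcongr
  classical
  set A : Set (Euc d) := (fun u => y + t • u) ⁻¹' Ω with hA
  have hpt : ∀ u, ‖A.indicator g u - (halfSpace ξ).indicator g u‖ ≤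
      S.indicator (fun _ => M) u := by
    intro u
    rcases le_or_gt 1 ‖u‖ with hu | hu
    · have h0 := hsupp u hu
      have : ∀ B : Set (Euc d), B.indicator g u = 0 := fun B => by
        rw [indicator_apply, h0, ite_self]
      rw [this, this, sub_zero, norm_zero]
      exact indicator_nonneg (fun _ _ => hM0) _
    by_cases hin : |⟪ξ, u⟫| ≤ η
    · rw [indicator_of_mem (show u ∈ S from ⟨hu.le, hin⟩), Real.norm_eq_abs]
      have := hM u
      rw [indicator_apply, indicator_apply]
      split_ifs
      · simpa using hM0
      · simpa using this
      · simpa using this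
      · simpa using hM0
    · rw [indicator_of_notMem (show u ∉ S from fun h' => hin h'.2)]
      push Not at hin
      have hxz : ‖y + t • u - z‖ < 2 * t := by
        calc ‖y + t • u - z‖ = ‖(y - z) + t • u‖ := by congr 1; abel
          _ ≤ ‖y - z‖ + t * ‖u‖ := by
            refine (norm_add_le _ _).trans ?_
            rw [norm_smul, Real.norm_of_nonneg ht.le]
          _ < 2 * t := by nlinarith
      have hpow : C * ‖y + t • u - z‖ ^ (1 + β) ≤ t * (C * 2 ^ (1 + β) * t ^ β) := by
        have h1 : ‖y + t • u - z‖ ^ (1 + β) ≤ (2 * t) ^ (1 + β) := by gcongr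
        rw [Real.mul_rpow two_pos.le ht.le] at h1
        have h2 : t ^ (1 + β) = t * t ^ β := by
          rw [add_comm, Real.rpow_add_one ht.ne', mul_comm]
        rw [h2] at h1
        calc _ ≤ C * (2 ^ (1 + β) * (t * t ^ β)) := by gcongr
          _ = _ := by ring
      have hin1 : ⟪ξ, y + t • u - z⟫ = ⟪ξ, y - z⟫ + t * ⟪ξ, u⟫ := by
        rw [← real_inner_smul_right, ← inner_add_right]; congr 1; abel
      have hin2 := abs_real_inner_le_norm ξ (y - z)
      rw [h.norm_eq, one_mul] at hin2
      have hin3 := abs_le.1 hin2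
      have hteta : t * η = ‖y - z‖ + t * (C * 2 ^ (1 + β) * t ^ β) := by
        rw [hη]; field_simp
      have hiff : u ∈ A ↔ u ∈ halfSpace ξ := by
        rcases lt_or_ge ⟪ξ, u⟫ 0 with hneg | hpos
        · rw [abs_of_neg hneg] at hin
          have hmul : t * η < t * -⟪ξ, u⟫ := by gcongr
          refine iff_of_true (h.mem _ (by linarith) ?_) hneg
          rw [hin1]
          linarith
        · rw [abs_of_nonneg hpos] at hin
          have hmul : t * η < t * ⟪ξ, u⟫ := by gcongr
          refine iff_of_false (h.notMem _ (by linarith) ?_) (not_lt.2 hpos)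
          rw [hin1]
          linarith
      have : A.indicator g u = (halfSpace ξ).indicator g u := by
        by_cases hu' : u ∈ halfSpace ξ
        · rw [indicator_of_mem hu', indicator_of_mem (hiff.2 hu')]
        · rw [indicator_of_notMem hu', indicator_of_notMem (fun h' => hu' (hiff.1 h'))]
      rw [this, sub_self, norm_zero]
  have hSfin : volume S < ⊤ := hSv.trans_lt ENNReal.ofReal_lt_top
  have hint : Integrable (S.indicator fun _ => M) := by
    rw [integrable_indicator_iff hSm]
    exact integrableOn_const hSfin.ne
  refine (norm_integral_le_of_norm_le hint (Filter.Eventually.of_forall hpt)).trans ?_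
  rw [integral_indicator hSm, setIntegral_const, smul_eq_mul, mul_comm]
  gcongr
  exact ENNReal.toReal_le_of_le_ofReal (by positivity) hSv

/-- Integrals at the scale `t` of functions whose integrals over half-spaces vanish. -/
lemma abs_setIntegral_le_of_halfSpace (hd : 0 < d) (hΩ : IsOpen Ω) (hne : Ω.Nonempty)
    (hb : Bornology.IsBounded Ω) (hg : Integrable g)
    (hM : ∀ u, |g u| ≤ M) (hsupp : ∀ u, 1 ≤ ‖u‖ → g u = 0)
    (hhalf : ∀ ξ : Euc d, ‖ξ‖ = 1 → ∫ u in halfSpace ξ, g u = 0)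
    {β C r : ℝ} (hβ : 0 < β) (hC : 0 ≤ C)
    (h : ∀ z ∈ frontier Ω, ∃ ξ, IsTangent Ω β C r z ξ) (y : Euc d) {t : ℝ} (ht : 0 < t)
    (htr : 2 * t ≤ r) :
    |∫ x in Ω, g (t⁻¹ • (x - y))| ≤ t ^ d * (M * (2 ^ d *
      ((if infDist y (frontier Ω) < t then infDist y (frontier Ω) / t else 0) +
        C * 2 ^ (1 + β) * t ^ β))) := by
  have hM0 : 0 ≤ M := (abs_nonneg _).trans (hM 0)
  have : Nontrivial (Euc d) :=
    Module.nontrivial_of_finrank_pos (R := ℝ) (by simpa using hd)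
  obtain ⟨ξ₀, hξ₀⟩ := exists_norm_eq (Euc d) (zero_le_one (α := ℝ))
  obtain ⟨z₀, hz₀, -⟩ := exists_mem_frontier_max hΩ hne hb hξ₀
  have hcomp : IsCompact (frontier Ω) :=
    hb.isCompact_closure.of_isClosed_subset isClosed_frontier frontier_subset_closure
  obtain ⟨z, hz, hdist⟩ := hcomp.exists_infDist_eq_dist ⟨z₀, hz₀⟩ y
  split_ifs with hlt
  · obtain ⟨ξ, hξ⟩ := h z hz
    rw [hdist, dist_eq_norm] at hlt
    have h1 := hξ.abs_setIntegral_sub_le hΩ.measurableSet hg hM hsupp hβ hC ht hlt.le htr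
    rw [hhalf ξ hξ.norm_eq, mul_zero, sub_zero] at h1
    rwa [hdist, dist_eq_norm]
  · push Not at hlt
    -- The ball of radius `t` does not meet the boundary, so by connectedness it lies inside `Ω` or
    -- misses it. In the first case the integral is over the whole space and vanishes by
    -- cancellation.
    have hz0 : ∫ x in Ω, g (t⁻¹ • (x - y)) = 0 := by
      have hdisj : ball y t ∩ frontier Ω = ∅ := by
        rw [← disjoint_iff_inter_eq_empty]
        exact (disjoint_ball_infDist (s := frontier Ω)).mono_left (ball_subset_ball hlt)
      have hg0 : ∀ x, x ∉ ball y t → g (t⁻¹ • (x - y)) = 0 := by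
        intro x hx
        rw [mem_ball_iff_norm, not_lt] at hx
        apply hsupp
        rw [norm_smul, norm_inv, Real.norm_of_nonneg ht.le, inv_mul_eq_div, one_le_div ht]
        exact hx
      by_cases h1 : (ball y t ∩ Ω).Nonempty
      · have h2 : ball y t ⊆ Ω := by
          refine (convex_ball y t).isPreconnected.subset_left_of_subset_union hΩ
            isClosed_closure.isOpen_compl
            (disjoint_compl_right.mono_left subset_closure) (fun x hx => ?_) h1
          by_cases hxΩ : x ∈ Ω
          · exact Or.inl hxΩ
          · refine Or.inr fun hxc => ?_
            have h3 : x ∈ ball y t ∩ frontier Ω := ⟨hx, by rw [hΩ.frontier_eq]; exact ⟨hxc, hxΩ⟩⟩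
            rw [hdisj] at h3
            exact h3
        rw [setIntegral_eq_integral_of_forall_compl_eq_zero (fun x hx => hg0 x (fun h' => hx (h2 h'))),
          integral_comp_rescale g ht y, integral_eq_zero_of_halfSpace hg hd hhalf, smul_zero]
      · refine setIntegral_eq_zero_of_forall_eq_zero fun x hx => hg0 x fun hx' => h1 ⟨x, hx', hx⟩
    rw [hz0, abs_zero]
    positivity

end Domain

/-! ### Convolutions and mass at a given scale -/

section ScaledConv

variable {d : ℕ} {F : Type*} [NormedAddCommGroup F] [NormedSpace ℝ F] {γ p t C : ℝ}
  {f : Euc d → ℝ} {G : Euc d → F}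

/-- The convolution with the kernel `G` dilated to the scale `t`. -/
noncomputable def scaledConv (t : ℝ) (G : Euc d → F) (f : Euc d → ℝ) (x : Euc d) : F :=
  ∫ y, f y • G (t⁻¹ • (x - y))

/-- The mass of `f` near `y` at the scale `t`. -/
noncomputable def massAt (γ t : ℝ) (f : Euc d → ℝ) (y : Euc d) : ℝ :=
  ∫ y', |f y'| * dec γ (t⁻¹ * ‖y - y'‖)

/-- The signed mass of `f` near `y` at the scale `t`. -/
noncomputable def signedMassAt (γ t : ℝ) (f : Euc d → ℝ) (y : Euc d) : ℝ :=
  ∫ y', f y' * dec γ (t⁻¹ * ‖y - y'‖)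

lemma TameKernel.norm_le_const (hC : 0 < C) (hγ : 0 < γ) (hG : TameKernel C γ G) (z : Euc d) :
    ‖G z‖ ≤ C :=
  (hG.norm_le z).trans (mul_le_of_le_one_right hC.le (dec_le_one hγ (norm_nonneg _)))

lemma TameKernel.integrable_smul (hC : 0 < C) (hγ : 0 < γ) (hG : TameKernel C γ G)
    (hf : Integrable f) (t : ℝ) (x : Euc d) :
    Integrable (fun y => f y • G (t⁻¹ • (x - y))) := by
  refine (hf.norm.mul_const C).mono' ?_ (Filter.Eventually.of_forall fun y => ?_)
  · have : Continuous fun y => G (t⁻¹ • (x - y)) := hG.continuous.comp (by fun_prop)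
    exact hf.1.smul this.aestronglyMeasurable
  · rw [norm_smul]
    gcongr
    exact hG.norm_le_const hC hγ _

lemma continuous_dec_norm (γ t : ℝ) (ht : 0 < t) (y : Euc d) :
    Continuous fun y' => dec γ (t⁻¹ * ‖y - y'‖) := by
  unfold dec
  refine Continuous.rpow_const (by fun_prop) fun y' => Or.inl ?_
  have : 0 ≤ t⁻¹ * ‖y - y'‖ := by positivity
  linarith

lemma integrable_mul_dec (hγ : 0 < γ) (ht : 0 < t) {f : Euc d → ℝ} (hf : Integrable f) (y : Euc d) :
    Integrable fun y' => f y' * dec γ (t⁻¹ * ‖y - y'‖) := by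
  refine hf.norm.mono' ?_ (Filter.Eventually.of_forall fun y' => ?_)
  · exact hf.1.mul (continuous_dec_norm γ t ht y).aestronglyMeasurable
  · have h0 : 0 ≤ t⁻¹ * ‖y - y'‖ := by positivity
    rw [norm_mul, Real.norm_of_nonneg (dec_pos h0).le]
    exact mul_le_of_le_one_right (norm_nonneg _) (dec_le_one hγ h0)

lemma massAt_nonneg (γ : ℝ) (ht : 0 < t) (f : Euc d → ℝ) (y : Euc d) : 0 ≤ massAt γ t f y :=
  integral_nonneg fun y' => mul_nonneg (abs_nonneg _)
    (dec_pos (γ := γ) (show 0 ≤ t⁻¹ * ‖y - y'‖ by positivity)).le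

lemma massAt_le (hγ : 0 < γ) (ht : 0 < t) (hf : Integrable f) (y : Euc d) :
    massAt γ t f y ≤ ∫ y', |f y'| := by
  refine integral_mono (integrable_mul_dec hγ ht hf.abs y) hf.abs fun y' => ?_
  exact mul_le_of_le_one_right (abs_nonneg _) (dec_le_one hγ (by positivity))

lemma massAt_pos (hγ : 0 < γ) (ht : 0 < t) (hf : Integrable f) (h : 0 < ∫ y', |f y'|) (y : Euc d) :
    0 < massAt γ t f y := by
  have hnn : 0 ≤ fun y' => |f y'| * dec γ (t⁻¹ * ‖y - y'‖) := fun y' =>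
    mul_nonneg (abs_nonneg _) (dec_pos (by positivity)).le
  rw [massAt, integral_pos_iff_support_of_nonneg hnn (integrable_mul_dec hγ ht hf.abs y)]
  rw [integral_pos_iff_support_of_nonneg (fun y' => abs_nonneg _) hf.abs] at h
  convert h using 2
  ext y'
  have := dec_pos (γ := γ) (show 0 ≤ t⁻¹ * ‖y - y'‖ by positivity)
  simp [this.ne']

lemma abs_signedMassAt_le (ht : 0 < t) (y : Euc d) :
    |signedMassAt γ t f y| ≤ massAt γ t f y := by
  refine abs_integral_le_integral_abs.trans_eq ?_
  refine integral_congr_ae (Filter.Eventually.of_forall fun y' => ?_)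
  have h0 : 0 ≤ t⁻¹ * ‖y - y'‖ := by positivity
  simp only [abs_mul, abs_of_pos (dec_pos (γ := γ) h0)]

lemma signedMassAt_abs (γ t : ℝ) (f : Euc d → ℝ) (y : Euc d) :
    signedMassAt γ t (fun y => |f y|) y = massAt γ t f y := rfl

lemma massAt_two_mul (γ t : ℝ) (f : Euc d → ℝ) (y : Euc d) :
    massAt γ (2 * t) f y = ∫ y', |f y'| * dec γ (t⁻¹ * ‖y - y'‖ / 2) := by
  unfold massAt
  congr 1
  ext y'
  rw [mul_inv]
  ring_nf

lemma integrable_mul_dec_half (hγ : 0 < γ) (ht : 0 < t) {f : Euc d → ℝ} (hf : Integrable f)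
    (y : Euc d) : Integrable fun y' => f y' * dec γ (t⁻¹ * ‖y - y'‖ / 2) := by
  convert integrable_mul_dec hγ (show 0 < 2 * t by positivity) hf y using 4
  rw [mul_inv]
  ring

lemma massAt_two_mul_le (hγ : 0 < γ) (ht : 0 < t) (hf : Integrable f) (y : Euc d) :
    massAt γ (2 * t) f y ≤ 2 ^ γ * massAt γ t f y := by
  rw [massAt_two_mul, massAt, ← integral_const_mul]
  refine integral_mono (integrable_mul_dec_half hγ ht hf.abs y)
    ((integrable_mul_dec hγ ht hf.abs y).const_mul _) fun y' => ?_
  have := dec_half_le hγ (show 0 ≤ t⁻¹ * ‖y - y'‖ by positivity)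
  calc |f y'| * dec γ (t⁻¹ * ‖y - y'‖ / 2) ≤ |f y'| * (2 ^ γ * dec γ (t⁻¹ * ‖y - y'‖)) := by gcongr
    _ = _ := by ring

lemma massAt_two_mul_sub (hγ : 0 < γ) (ht : 0 < t) (hf : Integrable f) (y : Euc d) :
    massAt γ (2 * t) f y - massAt γ t f y =
      ∫ y', |f y'| * (dec γ (t⁻¹ * ‖y - y'‖ / 2) - dec γ (t⁻¹ * ‖y - y'‖)) := by
  rw [massAt_two_mul, massAt, ← integral_sub (integrable_mul_dec_half hγ ht hf.abs y)
    (integrable_mul_dec hγ ht hf.abs y)]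
  simp only [mul_sub]

lemma dec_le_dec_half (hγ : 0 < γ) {r : ℝ} (hr : 0 ≤ r) : dec γ r ≤ dec γ (r / 2) :=
  Real.rpow_le_rpow_of_nonpos (by positivity) (by linarith) (by linarith)

lemma massAt_le_two_mul (hγ : 0 < γ) (ht : 0 < t) (hf : Integrable f) (y : Euc d) :
    massAt γ t f y ≤ massAt γ (2 * t) f y := by
  rw [← sub_nonneg, massAt_two_mul_sub hγ ht hf]
  exact integral_nonneg fun y' => mul_nonneg (abs_nonneg _)
    (sub_nonneg.2 (dec_le_dec_half hγ (by positivity)))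

lemma massAt_le_of_norm_sub_le (hγ : 0 < γ) (ht : 0 < t) (hf : Integrable f) {x y : Euc d}
    (h : ‖x - y‖ ≤ 2 * t) : massAt γ t f x ≤ 3 ^ γ * massAt γ t f y := by
  rw [massAt, massAt, ← integral_const_mul]
  refine integral_mono (integrable_mul_dec hγ ht hf.abs x)
    ((integrable_mul_dec hγ ht hf.abs y).const_mul _) fun y' => ?_
  have h1 : dec γ (t⁻¹ * ‖x - y'‖) ≤ 3 ^ γ * dec γ (t⁻¹ * ‖y - y'‖) := by
    refine dec_le_mul_of_le hγ (by positivity) (by positivity) (by norm_num) ?_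
    have h2 : ‖y - y'‖ ≤ ‖x - y‖ + ‖x - y'‖ := by
      rw [← sub_sub_sub_cancel_left y' y x, add_comm]
      exact _root_.norm_sub_le _ _
    have h3 : t⁻¹ * ‖y - y'‖ ≤ t⁻¹ * (2 * t + ‖x - y'‖) := by gcongr; linarith
    rw [mul_add, mul_comm 2 t, ← mul_assoc, inv_mul_cancel₀ ht.ne', one_mul] at h3
    have : 0 ≤ t⁻¹ * ‖x - y'‖ := by positivity
    linarith
  calc |f y'| * dec γ (t⁻¹ * ‖x - y'‖) ≤ |f y'| * (3 ^ γ * dec γ (t⁻¹ * ‖y - y'‖)) := by gcongr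
    _ = _ := by ring

lemma norm_inv_smul_sub (ht : 0 < t) (x y : Euc d) : ‖t⁻¹ • (x - y)‖ = t⁻¹ * ‖x - y‖ := by
  rw [norm_smul, norm_inv, Real.norm_of_nonneg ht.le]

lemma TameKernel.norm_scaledConv_le (hγ : 0 < γ) (ht : 0 < t) (hG : TameKernel C γ G)
    (hf : Integrable f) (x : Euc d) : ‖scaledConv t G f x‖ ≤ C * massAt γ t f x := by
  rw [massAt, ← integral_const_mul]
  refine norm_integral_le_of_norm_le ((integrable_mul_dec hγ ht hf.abs x).const_mul C)
    (Filter.Eventually.of_forall fun y => ?_)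
  rw [norm_smul, Real.norm_eq_abs]
  have := hG.norm_le (t⁻¹ • (x - y))
  rw [norm_inv_smul_sub ht] at this
  calc _ ≤ |f y| * (C * dec γ (t⁻¹ * ‖x - y‖)) := by gcongr
    _ = _ := by ring

/-- At the scale `t`, the function `f` may be replaced by a point mass at `y`, up to an increment of
its mass. -/
lemma TameKernel.norm_scaledConv_sub_le [CompleteSpace F] (hC : 0 < C) (hγ : 0 < γ) (ht : 0 < t)
    (hG : TameKernel C γ G)
    (hf : Integrable f) {x y : Euc d} (h : ‖x - y‖ ≤ 2 * t) :
    ‖scaledConv t G f x - signedMassAt γ t f y • G (t⁻¹ • (x - y))‖ ≤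
      C * (2 ^ (γ + 1) * (1 + γ) + 2 * (3 ^ γ + 1)) * (2 / γ) *
        (massAt γ (2 * t) f y - massAt γ t f y) := by
  rw [signedMassAt, ← integral_smul_const, scaledConv,
    ← integral_sub (hG.integrable_smul hC hγ hf t x)
      ((integrable_mul_dec hγ ht hf y).smul_const _),
    massAt_two_mul_sub hγ ht hf, ← integral_const_mul]
  have hint : Integrable fun y' => |f y'| *
      (dec γ (t⁻¹ * ‖y - y'‖ / 2) - dec γ (t⁻¹ * ‖y - y'‖)) := by
    simp only [mul_sub]
    exact (integrable_mul_dec_half hγ ht hf.abs y).sub (integrable_mul_dec hγ ht hf.abs y)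
  refine norm_integral_le_of_norm_le (hint.const_mul _) (Filter.Eventually.of_forall fun y' => ?_)
  have hz : ‖t⁻¹ • (x - y)‖ ≤ 2 := by
    rw [norm_inv_smul_sub ht, inv_mul_le_iff₀ ht]; linarith
  -- The pointwise error is the increment of `dec` at distance `‖y - y'‖ / t`; integrated against
  -- `|f|` it becomes exactly the increment of the mass.
  have h1 := hG.norm_sub_dec_smul_le hC hγ (w := t⁻¹ • (x - y')) hz
  have hr : ‖t⁻¹ • (x - y) - t⁻¹ • (x - y')‖ = t⁻¹ * ‖y - y'‖ := by
    rw [← smul_sub, sub_sub_sub_cancel_left, norm_inv_smul_sub ht, norm_sub_rev]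
  rw [hr] at h1
  rw [mul_smul, ← smul_sub, norm_smul, Real.norm_eq_abs]
  exact (mul_le_mul_of_nonneg_left h1 (abs_nonneg _)).trans_eq (by ring)

/-- A Lipschitz bump function. -/
noncomputable def bump (z : Euc d) : ℝ := max (2 - ‖z‖) 0

lemma bump_nonneg (z : Euc d) : 0 ≤ bump z := le_max_right _ _

lemma bump_le_two (z : Euc d) : bump z ≤ 2 :=
  max_le (by linarith [norm_nonneg z]) two_pos.le

lemma bump_eq_zero {z : Euc d} (hz : 2 ≤ ‖z‖) : bump z = 0 := max_eq_right (by linarith)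

lemma one_le_bump {z : Euc d} (hz : ‖z‖ ≤ 1) : 1 ≤ bump z := le_max_of_le_left (by linarith)

/-- Tameness allows the weight that localizes the jump to be replaced by its point-mass version,
just like the kernels. The constant reflects that `bump` is at most two and lives where `1 + ‖z‖ ≤
3`. -/
lemma tameKernel_bump (hγ : 0 < γ) : TameKernel (2 * 3 ^ γ) γ (bump : Euc d → ℝ) := by
  have h3 : (1 : ℝ) ≤ 3 ^ γ := Real.one_le_rpow (by norm_num) hγ.le
  refine ⟨fun z => ?_, fun z w => ?_⟩
  · rw [Real.norm_of_nonneg (bump_nonneg z)]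
    have hd := dec_pos (γ := γ) (norm_nonneg z)
    rcases le_total 2 ‖z‖ with h | h
    · rw [bump_eq_zero h]; positivity
    · have h1 : dec γ 0 ≤ 3 ^ γ * dec γ ‖z‖ :=
        dec_le_mul_of_le hγ le_rfl (norm_nonneg _) (by norm_num) (by linarith)
      have h2 : dec γ 0 = 1 := by simp [dec]
      linarith [bump_le_two z]
  · rw [Real.norm_eq_abs]
    have h1 : |bump z - bump w| ≤ ‖z - w‖ := by
      refine (abs_max_sub_max_le_abs _ _ _).trans ?_
      rw [sub_sub_sub_cancel_left, abs_sub_comm]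
      exact abs_norm_sub_norm_le z w
    nlinarith [norm_nonneg (z - w)]

end ScaledConv

/-! ### Comparison of the jump between scales with that of a point mass -/

section Jump

variable {d : ℕ} {F : Type*} [NormedAddCommGroup F] [NormedSpace ℝ F] {γ p : ℝ}
  {Φ : F → ℝ} {K : Euc d → F}

/-- The increment between two consecutive scales of `Φ` of the cut-off convolution. -/
noncomputable def scaleJump (γ : ℝ) (Φ : F → ℝ) (K : Euc d → F) (t : ℝ) (f : Euc d → ℝ)
    (x : Euc d) : ℝ :=
  Φ (scaledConv t (cutKer γ 2 K) f x) - Φ (scaledConv t (cutKer γ 1 K) f x)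

lemma cutKer_smul (γ s a : ℝ) (K : Euc d → F) (z : Euc d) :
    cutKer γ s (fun z => a • K z) z = a • cutKer γ s K z := by
  rw [cutKer, cutKer, smul_comm]

/-- The increment between two scales is local. -/
lemma exists_abs_scaleJump_le (hγ : 0 < γ) (hp : 1 < p)
    (hΦ : PosHomogeneous p Φ) (hΦL : LipschitzOnUnitSphere Φ)
    (hK : PosHomogeneous (-γ) K) (hKL : LipschitzOnUnitSphere K) :
    ∃ C, 0 < C ∧ ∀ (f : Euc d → ℝ) (t : ℝ) (x : Euc d), Integrable f → 0 < t →
      |scaleJump γ Φ K t f x| ≤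
        C * (scaledConv t bump (fun y => |f y|) x * massAt γ t f x ^ (p - 1)) := by
  obtain ⟨A, hA, h1, h2⟩ := hK.exists_tameKernel_cutKer hγ hKL
  obtain ⟨B, hB, hb⟩ := hΦ.exists_norm_sub_le hΦL hp.le
  refine ⟨B * (A ^ (p - 1) * (2 * A)), by positivity, fun f t x hf ht => ?_⟩
  have hm := massAt_nonneg γ ht f x
  have h3 := hb (A * massAt γ t f x) _ _ (h2.norm_scaledConv_le hγ ht hf x)
    (h1.norm_scaledConv_le hγ ht hf x)
  -- The two cut-off kernels agree outside the unit ball, where `bump` is not needed, and inside it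
  -- `bump` is at least one. This supplies the local factor; the other `p - 1` powers only see the
  -- mass with tails.
  have h4 : ‖scaledConv t (cutKer γ 2 K) f x - scaledConv t (cutKer γ 1 K) f x‖ ≤
      2 * A * scaledConv t bump (fun y => |f y|) x := by
    rw [scaledConv, scaledConv, scaledConv, ← integral_sub (h2.integrable_smul hA hγ hf t x)
      (h1.integrable_smul hA hγ hf t x), ← integral_const_mul]
    refine norm_integral_le_of_norm_le (((tameKernel_bump hγ).integrable_smul (by positivity) hγ
      hf.abs t x).const_mul _) (Filter.Eventually.of_forall fun y => ?_)
    rw [← smul_sub, norm_smul, Real.norm_eq_abs, smul_eq_mul]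
    set z := t⁻¹ • (x - y)
    have h5 : ‖cutKer γ 2 K z - cutKer γ 1 K z‖ ≤ 2 * A * bump z := by
      rcases le_total 1 ‖z‖ with hz | hz
      · rw [cutKer_of_one_le (by linarith), cutKer_of_one_le (by linarith), sub_self, norm_zero]
        have := bump_nonneg z
        positivity
      · have h6 := h2.norm_le_const hA hγ z
        have h7 := h1.norm_le_const hA hγ z
        have h8 := one_le_bump hz
        have h9 := norm_sub_le (cutKer γ 2 K z) (cutKer γ 1 K z)
        nlinarith
    calc _ ≤ |f y| * (2 * A * bump z) := by gcongr
      _ = _ := by ring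
  rw [Real.mul_rpow hA.le hm] at h3
  calc |scaleJump γ Φ K t f x| ≤ _ := h3
    _ ≤ B * (A ^ (p - 1) * massAt γ t f x ^ (p - 1) *
        (2 * A * scaledConv t bump (fun y => |f y|) x)) := by gcongr
    _ = _ := by ring

/-- Comparison of the increment between two scales with the increment for a point mass. The error
telescopes. -/
lemma exists_abs_bump_mul_scaleJump_sub_le [CompleteSpace F] (hγ : 0 < γ) (hp : 1 < p)
    (hΦ : PosHomogeneous p Φ) (hΦL : LipschitzOnUnitSphere Φ)
    (hK : PosHomogeneous (-γ) K) (hKL : LipschitzOnUnitSphere K) :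
    ∃ C, 0 < C ∧ ∀ (f : Euc d → ℝ) (t : ℝ) (x y : Euc d), Integrable f → 0 < t →
      ‖x - y‖ ≤ 2 * t → 0 < massAt γ t f y →
      |bump (t⁻¹ • (x - y)) * (scaleJump γ Φ K t f x / scaledConv t bump (fun y => |f y|) x) -
        scaleDiff γ Φ (fun z => signedMassAt γ t f y • K z) (t⁻¹ • (x - y)) / massAt γ t f y| ≤
        C * (massAt γ (2 * t) f y ^ (p - 1) - massAt γ t f y ^ (p - 1)) := by
  obtain ⟨A, hA, h1, h2⟩ := hK.exists_tameKernel_cutKer hγ hKL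
  obtain ⟨B, hB, hb⟩ := hΦ.exists_norm_sub_le hΦL hp.le
  obtain ⟨C, hC, hJ⟩ := exists_abs_scaleJump_le hγ hp hΦ hΦL hK hKL
  set c : ℝ := (2 ^ (γ + 1) * (1 + γ) + 2 * (3 ^ γ + 1)) * (2 / γ) with hc
  have hc0 : 0 < c := by positivity
  -- The first summand is the error in replacing the weight, times the bound for the ratio. The
  -- second is the error in replacing the jump, once for each of the two cut-offs.
  set Q : ℝ := 2 * 3 ^ γ * c * (C * (3 ^ γ) ^ (p - 1)) +
    2 * (B * ((A * 3 ^ γ) ^ (p - 1) * (A * c))) with hQ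
  have hQ0 : 0 < Q := by positivity
  refine ⟨Q * (2 ^ γ / (p - 1)), by have : 0 < p - 1 := by linarith
                                    positivity, fun f t x y hf ht hxy hN => ?_⟩
  set N := massAt γ t f y with hNdef
  set N2 := massAt γ (2 * t) f y with hN2def
  set a := signedMassAt γ t f y with hadef
  set z := t⁻¹ • (x - y) with hzdef
  set V := scaledConv t bump (fun y => |f y|) x with hVdef
  set D := scaleJump γ Φ K t f x with hDdef
  have hNx0 := massAt_nonneg γ ht f x
  have hNx : massAt γ t f x ≤ 3 ^ γ * N := massAt_le_of_norm_sub_le hγ ht hf hxy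
  have hNN2 : N ≤ N2 := massAt_le_two_mul hγ ht hf y
  have hN2N : N2 ≤ 2 ^ γ * N := massAt_two_mul_le hγ ht hf y
  have hV0 : 0 ≤ V := integral_nonneg fun y' => by
    have := bump_nonneg (t⁻¹ • (x - y'))
    simp only [smul_eq_mul]
    positivity
  have hD := hJ f t x hf ht
  rw [← hDdef, ← hVdef] at hD
  have hNxp : massAt γ t f x ^ (p - 1) ≤ (3 ^ γ) ^ (p - 1) * N ^ (p - 1) := by
    rw [← Real.mul_rpow (by positivity) hN.le]
    exact Real.rpow_le_rpow hNx0 hNx (by linarith)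
  have hDV : |D / V| ≤ C * (3 ^ γ) ^ (p - 1) * N ^ (p - 1) := by
    rw [abs_div, abs_of_nonneg hV0]
    refine div_le_of_le_mul₀ hV0 (by positivity) (hD.trans ?_)
    calc _ ≤ C * (V * ((3 ^ γ) ^ (p - 1) * N ^ (p - 1))) := by gcongr
      _ = _ := by ring
  -- If the weight vanishes, locality forces the jump to vanish too, so division by zero is
  -- harmless.
  have hDVV : V * (D / V) = D := by
    rcases eq_or_ne V 0 with h0 | h0
    · rw [h0, zero_mul, mul_zero, abs_nonpos_iff] at hD
      · rw [hD, zero_div, mul_zero]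
    · rw [mul_div_cancel₀ _ h0]
  have hVN : |N * bump z - V| ≤ 2 * 3 ^ γ * c * (N2 - N) := by
    have h3 := (tameKernel_bump (d := d) hγ).norm_scaledConv_sub_le (by positivity) hγ ht hf.abs hxy
    rw [signedMassAt_abs] at h3
    have e1 : ∀ s, massAt γ s (fun y => |f y|) y = massAt γ s f y := fun s => by
      simp only [massAt, abs_abs]
    rw [e1, e1, smul_eq_mul, Real.norm_eq_abs, abs_sub_comm] at h3
    refine h3.trans_eq ?_
    rw [hc]; ring
  have ha : |a| ≤ N := abs_signedMassAt_le ht y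
  have h3γ : (1 : ℝ) ≤ 3 ^ γ := Real.one_le_rpow (by norm_num) hγ.le
  have hG : ∀ G : Euc d → F, TameKernel A γ G →
      |Φ (scaledConv t G f x) - Φ (a • G z)| ≤
        B * ((A * 3 ^ γ) ^ (p - 1) * (A * c)) * (N2 - N) * N ^ (p - 1) := by
    intro G hG
    have h4 := hG.norm_scaledConv_le hγ ht hf x
    have h5 : ‖a • G z‖ ≤ A * 3 ^ γ * N := by
      rw [norm_smul, Real.norm_eq_abs]
      have := hG.norm_le_const hA hγ z
      calc |a| * ‖G z‖ ≤ N * A := by gcongr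
        _ = A * 1 * N := by ring
        _ ≤ _ := by gcongr
    have h6 := hG.norm_scaledConv_sub_le hA hγ ht hf hxy
    have h7 := hb (A * 3 ^ γ * N) _ _ (h4.trans (by rw [mul_assoc]; gcongr)) h5
    rw [Real.mul_rpow (by positivity) hN.le] at h7
    calc _ ≤ _ := h7
      _ ≤ B * ((A * 3 ^ γ) ^ (p - 1) * N ^ (p - 1) *
          (A * (2 ^ (γ + 1) * (1 + γ) + 2 * (3 ^ γ + 1)) * (2 / γ) * (N2 - N))) := by gcongr
      _ = _ := by rw [hc]; ring
  have hDy : |D - scaleDiff γ Φ (fun z => a • K z) z| ≤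
      2 * (B * ((A * 3 ^ γ) ^ (p - 1) * (A * c))) * (N2 - N) * N ^ (p - 1) := by
    rw [hDdef, scaleJump, scaleDiff, cutKer_smul, cutKer_smul, sub_sub_sub_comm]
    refine (abs_sub _ _).trans ((add_le_add (hG _ h2) (hG _ h1)).trans_eq ?_)
    ring
  have hid : bump z * (D / V) - scaleDiff γ Φ (fun z => a • K z) z / N =
      ((N * bump z - V) * (D / V) + (D - scaleDiff γ Φ (fun z => a • K z) z)) / N := by
    rw [sub_mul, hDVV]
    field_simp
    ring
  -- Converts `(N2 - N) * N ^ (p - 2)` into a telescoping difference of `(p - 1)`-th powers;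
  -- doubling the scale increases the mass by a bounded factor only.
  have hkey := sub_mul_rpow_le hN hNN2 hN2N (show 0 < p - 1 by linarith)
  rw [Real.rpow_sub_one hN.ne'] at hkey
  rw [hid, abs_div, abs_of_pos hN]
  have hnum : |(N * bump z - V) * (D / V) + (D - scaleDiff γ Φ (fun z => a • K z) z)| ≤
      Q * ((N2 - N) * N ^ (p - 1)) := by
    refine (abs_add_le _ _).trans ?_
    rw [abs_mul]
    have : 0 ≤ N2 - N := by linarith
    calc _ ≤ (2 * 3 ^ γ * c * (N2 - N)) * (C * (3 ^ γ) ^ (p - 1) * N ^ (p - 1)) +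
          2 * (B * ((A * 3 ^ γ) ^ (p - 1) * (A * c))) * (N2 - N) * N ^ (p - 1) := by gcongr
      _ = _ := by rw [hQ]; ring
  calc _ ≤ Q * ((N2 - N) * N ^ (p - 1)) / N := by gcongr
    _ = Q * ((N2 - N) * (N ^ (p - 1) / N)) := by ring
    _ ≤ Q * (2 ^ γ / (p - 1) * (N2 ^ (p - 1) - N ^ (p - 1))) := by gcongr
    _ = _ := by ring

end Jump

/-! ### Distribution of the jump over the points of the support -/

section Fubini

variable {d : ℕ} {F : Type*} [NormedAddCommGroup F] [NormedSpace ℝ F] {γ p : ℝ}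
  {Φ : F → ℝ} {K : Euc d → F} {Ω : Set (Euc d)}

lemma TameKernel.continuous_scaledConv {C t : ℝ} (hC : 0 < C) (hγ : 0 < γ) {G : Euc d → F}
    (hG : TameKernel C γ G) {f : Euc d → ℝ} (hf : Integrable f) :
    Continuous (scaledConv t G f) := by
  refine continuous_of_dominated (bound := fun y => ‖f y‖ * C) (fun x => ?_) (fun x => ?_)
    (hf.norm.mul_const C) ?_
  · exact (hG.integrable_smul hC hγ hf t x).1
  · refine Filter.Eventually.of_forall fun y => ?_
    rw [norm_smul]
    gcongr
    exact hG.norm_le_const hC hγ _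
  · refine Filter.Eventually.of_forall fun y => ?_
    exact (hG.continuous.comp (by fun_prop)).const_smul _

lemma continuous_scaleJump (hγ : 0 < γ) (hp : 1 < p)
    (hΦ : PosHomogeneous p Φ) (hΦL : LipschitzOnUnitSphere Φ)
    (hK : PosHomogeneous (-γ) K) (hKL : LipschitzOnUnitSphere K) {f : Euc d → ℝ}
    (hf : Integrable f) (t : ℝ) : Continuous (scaleJump γ Φ K t f) := by
  obtain ⟨A, hA, h1, h2⟩ := hK.exists_tameKernel_cutKer hγ hKL
  have hc := hΦ.continuous hΦL hp.le
  exact (hc.comp (h2.continuous_scaledConv hA hγ hf)).sub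
    (hc.comp (h1.continuous_scaledConv hA hγ hf))

/-- The density of the increment between two scales with respect to the smoothed mass. -/
noncomputable def jumpRatio (γ : ℝ) (Φ : F → ℝ) (K : Euc d → F) (t : ℝ) (f : Euc d → ℝ)
    (x : Euc d) : ℝ :=
  scaleJump γ Φ K t f x / scaledConv t bump (fun y => |f y|) x

lemma measurable_jumpRatio (hγ : 0 < γ) (hp : 1 < p)
    (hΦ : PosHomogeneous p Φ) (hΦL : LipschitzOnUnitSphere Φ)
    (hK : PosHomogeneous (-γ) K) (hKL : LipschitzOnUnitSphere K) {f : Euc d → ℝ}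
    (hf : Integrable f) (t : ℝ) : Measurable (jumpRatio γ Φ K t f) := by
  refine (continuous_scaleJump hγ hp hΦ hΦL hK hKL hf t).measurable.div ?_
  exact ((tameKernel_bump hγ).continuous_scaledConv (by positivity) hγ hf.abs).measurable

lemma exists_abs_jumpRatio_le (hγ : 0 < γ) (hp : 1 < p)
    (hΦ : PosHomogeneous p Φ) (hΦL : LipschitzOnUnitSphere Φ)
    (hK : PosHomogeneous (-γ) K) (hKL : LipschitzOnUnitSphere K) {f : Euc d → ℝ}
    (hf : Integrable f) {t : ℝ} (ht : 0 < t) :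
    (∃ B, 0 ≤ B ∧ ∀ x, |jumpRatio γ Φ K t f x| ≤ B) ∧
    ∀ x, jumpRatio γ Φ K t f x * scaledConv t bump (fun y => |f y|) x = scaleJump γ Φ K t f x := by
  obtain ⟨C, hC, hJ⟩ := exists_abs_scaleJump_le hγ hp hΦ hΦL hK hKL
  have hS : 0 ≤ ∫ y, |f y| := integral_nonneg fun y => abs_nonneg _
  have hV0 : ∀ x, 0 ≤ scaledConv t bump (fun y => |f y|) x := fun x => integral_nonneg fun y' => by
    have := bump_nonneg (t⁻¹ • (x - y'))
    simp only [smul_eq_mul]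
    positivity
  refine ⟨⟨C * (∫ y, |f y|) ^ (p - 1), by positivity, fun x => ?_⟩, fun x => ?_⟩
  · rw [jumpRatio, abs_div, abs_of_nonneg (hV0 x)]
    refine div_le_of_le_mul₀ (hV0 x) (by positivity) ((hJ f t x hf ht).trans ?_)
    have h1 : massAt γ t f x ^ (p - 1) ≤ (∫ y, |f y|) ^ (p - 1) :=
      Real.rpow_le_rpow (massAt_nonneg γ ht f x) (massAt_le hγ ht hf x) (by linarith)
    have h2 := hV0 x
    calc _ ≤ C * (scaledConv t bump (fun y => |f y|) x * (∫ y, |f y|) ^ (p - 1)) := by gcongr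
      _ = _ := by ring
  · rcases eq_or_ne (scaledConv t bump (fun y => |f y|) x) 0 with h0 | h0
    · have h1 := hJ f t x hf ht
      rw [h0, zero_mul, mul_zero, abs_nonpos_iff] at h1
      rw [h0, mul_zero, h1]
    · rw [jumpRatio, div_mul_cancel₀ _ h0]

/-- The part of the increment between two scales that is attributed to the point `y`. -/
noncomputable def localJump (γ : ℝ) (Φ : F → ℝ) (K : Euc d → F) (Ω : Set (Euc d)) (t : ℝ)
    (f : Euc d → ℝ) (y : Euc d) : ℝ :=
  ∫ x in Ω, bump (t⁻¹ • (x - y)) * jumpRatio γ Φ K t f x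

/-- The jump is its density times an average of `|f|`. Writing that average as an integral in `y`
and exchanging the order of integration reduces the theorem to estimates at a single point `y`. -/
lemma integral_scaleJump_eq (hγ : 0 < γ) (hp : 1 < p)
    (hΦ : PosHomogeneous p Φ) (hΦL : LipschitzOnUnitSphere Φ)
    (hK : PosHomogeneous (-γ) K) (hKL : LipschitzOnUnitSphere K)
    (hΩ : volume Ω ≠ ⊤) {f : Euc d → ℝ}
    (hf : Integrable f) {t : ℝ} (ht : 0 < t) :
    Integrable (fun y => |f y| * localJump γ Φ K Ω t f y) ∧
    ∫ x in Ω, scaleJump γ Φ K t f x = ∫ y, |f y| * localJump γ Φ K Ω t f y := by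
  obtain ⟨⟨B, hB, hb⟩, hH⟩ := exists_abs_jumpRatio_le hγ hp hΦ hΦL hK hKL hf ht
  have hm := measurable_jumpRatio hγ hp hΦ hΦL hK hKL hf t
  have : IsFiniteMeasure (volume.restrict Ω) := ⟨by rw [Measure.restrict_apply_univ]; exact hΩ.lt_top⟩
  have hbc : Continuous (fun q : Euc d × Euc d => bump (t⁻¹ • (q.1 - q.2))) :=
    (tameKernel_bump (d := d) hγ).continuous.comp (by fun_prop)
  have hint : Integrable (fun q : Euc d × Euc d =>
      |f q.2| * (bump (t⁻¹ • (q.1 - q.2)) * jumpRatio γ Φ K t f q.1))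
      ((volume.restrict Ω).prod volume) := by
    have hdom : Integrable (fun q : Euc d × Euc d => (2 * B) * |f q.2|)
        ((volume.restrict Ω).prod volume) :=
      (integrable_const (2 * B)).mul_prod hf.abs
    refine hdom.mono' ?_ (Filter.Eventually.of_forall fun q => ?_)
    · refine AEStronglyMeasurable.mul hf.abs.1.comp_snd ?_
      exact hbc.aestronglyMeasurable.mul (hm.comp measurable_fst).aestronglyMeasurable
    · rw [norm_mul, norm_mul, Real.norm_eq_abs, Real.norm_eq_abs, Real.norm_eq_abs, abs_abs,
        abs_of_nonneg (bump_nonneg _), mul_comm]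
      gcongr
      · exact bump_le_two _
      · exact hb _
  have hloc : ∀ y, ∫ x in Ω, |f y| * (bump (t⁻¹ • (x - y)) * jumpRatio γ Φ K t f x) =
      |f y| * localJump γ Φ K Ω t f y := fun y => integral_const_mul _ _
  constructor
  · have := hint.integral_prod_right
    simpa only [hloc] using this
  · have hswap := integral_integral_swap (f := fun x y =>
      |f y| * (bump (t⁻¹ • (x - y)) * jumpRatio γ Φ K t f x)) hint
    simp only [hloc] at hswap
    rw [← hswap]
    congr 1
    ext x
    rw [← hH x, scaledConv, ← integral_const_mul]
    congr 1
    ext y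
    rw [smul_eq_mul]
    ring

/-- The point mass carries a signed weight `a`, but `Φ` is homogeneous for positive factors only.
Negative `a` leads to the kernel `-K`, which is why both cancellation conditions enter. -/
lemma exists_abs_scaleDiff_smul_integral (hγ : 0 < γ) (hp : 1 < p) (hd : 0 < d)
    (hΦ : PosHomogeneous p Φ) (hΦL : LipschitzOnUnitSphere Φ)
    (hK : PosHomogeneous (-γ) K) (hKL : LipschitzOnUnitSphere K)
    (hΩ : IsOpen Ω) (hne : Ω.Nonempty) (hb : Bornology.IsBounded Ω)
    {β C r : ℝ} (hβ : 0 < β) (hC : 0 ≤ C) (h : ∀ z ∈ frontier Ω, ∃ ξ, IsTangent Ω β C r z ξ)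
    (hhalf : ∀ ξ : Euc d, ‖ξ‖ = 1 → ∫ u in halfSpace ξ, scaleDiff γ Φ K u = 0)
    (hhalf' : ∀ ξ : Euc d, ‖ξ‖ = 1 → ∫ u in halfSpace ξ, scaleDiff γ Φ (fun z => -K z) u = 0) :
    ∃ M, 0 < M ∧ ∀ (a t : ℝ) (y : Euc d), 0 < t → 2 * t ≤ r →
      |∫ x in Ω, scaleDiff γ Φ (fun z => a • K z) (t⁻¹ • (x - y))| ≤ |a| ^ p * (t ^ d * (M *
      ((if infDist y (frontier Ω) < t then infDist y (frontier Ω) / t else 0) +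
        C * 2 ^ (1 + β) * t ^ β))) := by
  have key : ∀ K : Euc d → F, PosHomogeneous (-γ) K → LipschitzOnUnitSphere K →
      (∀ ξ : Euc d, ‖ξ‖ = 1 → ∫ u in halfSpace ξ, scaleDiff γ Φ K u = 0) →
      ∃ M, 0 < M ∧ ∀ (t : ℝ) (y : Euc d), 0 < t → 2 * t ≤ r →
      |∫ x in Ω, scaleDiff γ Φ K (t⁻¹ • (x - y))| ≤ t ^ d * (M *
      ((if infDist y (frontier Ω) < t then infDist y (frontier Ω) / t else 0) +
        C * 2 ^ (1 + β) * t ^ β)) := by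
    intro K hK hKL hh
    obtain ⟨M, hM, hMb⟩ := exists_abs_scaleDiff_le hγ hp.le hΦ hΦL hK hKL
    have hcont := continuous_scaleDiff hγ hp.le hΦ hΦL hK hKL
    have hcs : HasCompactSupport (scaleDiff γ Φ K) := by
      refine HasCompactSupport.of_support_subset_isCompact (isCompact_closedBall (0 : Euc d) 1) ?_
      intro u hu
      rw [mem_closedBall_zero_iff]
      by_contra hc
      exact hu (scaleDiff_eq_zero (by linarith))
    refine ⟨M * 2 ^ d, by positivity, fun t y ht htr => ?_⟩
    have h1 := abs_setIntegral_le_of_halfSpace hd hΩ hne hb (hcont.integrable_of_hasCompactSupport hcs)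
      hMb (fun u hu => scaleDiff_eq_zero hu) hh hβ hC h y ht htr
    rwa [← mul_assoc M] at h1
  obtain ⟨M1, hM1, h1⟩ := key K hK hKL hhalf
  obtain ⟨M2, hM2, h2⟩ := key _ hK.neg hKL.neg hhalf'
  refine ⟨max M1 M2, lt_max_of_lt_left hM1, fun a t y ht htr => ?_⟩
  set δ := (if infDist y (frontier Ω) < t then infDist y (frontier Ω) / t else 0) +
        C * 2 ^ (1 + β) * t ^ β with hδ
  have hδ0 : 0 ≤ δ := by
    have : 0 ≤ infDist y (frontier Ω) := infDist_nonneg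
    rw [hδ]
    split_ifs <;> positivity
  have hscale : ∀ (K : Euc d → F) (b : ℝ), 0 < b → ∀ u, scaleDiff γ Φ (fun z => b • K z) u =
      b ^ p * scaleDiff γ Φ K u := by
    intro K b hb u
    rw [scaleDiff, scaleDiff, cutKer_smul, cutKer_smul, hΦ _ b hb, hΦ _ b hb, smul_eq_mul,
      smul_eq_mul, mul_sub]
  rcases lt_trichotomy a 0 with ha | ha | ha
  · have e : (fun z => a • K z) = fun z => (-a) • (-K z) := by
      ext z; rw [smul_neg, neg_smul, neg_neg]
    rw [e]
    simp only [hscale (fun z => -K z) (-a) (by linarith)]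
    rw [integral_const_mul, abs_mul, abs_of_neg ha, abs_of_pos (Real.rpow_pos_of_pos (by linarith) _)]
    have : 0 < -a := by linarith
    gcongr
    refine (h2 t y ht htr).trans ?_
    gcongr
    exact le_max_right _ _
  · have e : ∀ u, scaleDiff γ Φ (fun z => a • K z) u = 0 := by
      intro u
      rw [scaleDiff, cutKer_smul, cutKer_smul, ha, zero_smul, zero_smul, sub_self]
    simp only [e, integral_zero, abs_zero]
    positivity
  · simp only [hscale K a ha]
    rw [integral_const_mul, abs_mul, abs_of_pos ha, abs_of_pos (Real.rpow_pos_of_pos ha _)]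
    gcongr
    refine (h1 t y ht htr).trans ?_
    gcongr
    exact le_max_left _ _

/-- The central estimate: the point-mass comparison yields the telescoping first term, the
half-space comparison the second. Both are summable over dyadic scales with a bound independent of
`y`. -/
lemma exists_abs_localJump_le [CompleteSpace F] (hγ : 0 < γ) (hp : 1 < p) (hd : 0 < d)
    (hΦ : PosHomogeneous p Φ) (hΦL : LipschitzOnUnitSphere Φ)
    (hK : PosHomogeneous (-γ) K) (hKL : LipschitzOnUnitSphere K)
    (hΩ : IsOpen Ω) (hne : Ω.Nonempty) (hb : Bornology.IsBounded Ω)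
    {β C r : ℝ} (hβ : 0 < β) (hC : 0 ≤ C) (h : ∀ z ∈ frontier Ω, ∃ ξ, IsTangent Ω β C r z ξ)
    (hhalf : ∀ ξ : Euc d, ‖ξ‖ = 1 → ∫ u in halfSpace ξ, scaleDiff γ Φ K u = 0)
    (hhalf' : ∀ ξ : Euc d, ‖ξ‖ = 1 → ∫ u in halfSpace ξ, scaleDiff γ Φ (fun z => -K z) u = 0) :
    ∃ B, 0 < B ∧ ∀ (f : Euc d → ℝ) (t : ℝ) (y : Euc d), Integrable f → 0 < ∫ x, |f x| → 0 < t →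
      2 * t ≤ r →
      |(t ^ d)⁻¹ * localJump γ Φ K Ω t f y| ≤
        B * (massAt γ (2 * t) f y ^ (p - 1) - massAt γ t f y ^ (p - 1)) +
        B * ((∫ x, |f x|) ^ (p - 1) *
          ((if infDist y (frontier Ω) < t then infDist y (frontier Ω) / t else 0) + t ^ β)) := by
  obtain ⟨A, hA, hAb⟩ := exists_abs_bump_mul_scaleJump_sub_le hγ hp hΦ hΦL hK hKL
  obtain ⟨M, hM, hMb⟩ := exists_abs_scaleDiff_smul_integral hγ hp hd hΦ hΦL hK hKL hΩ hne hb hβ hC h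
    hhalf hhalf'
  set w : ℝ := volume.real (ball (0 : Euc d) 1)
  have hw : 0 ≤ w := measureReal_nonneg
  set c := C * 2 ^ (1 + β) with hc
  have hc0 : 0 ≤ c := by positivity
  refine ⟨A * (2 ^ d * w) + M * (1 + c), by positivity, fun f t y hf hS ht htr => ?_⟩
  have hN := massAt_pos hγ ht hf hS y
  have hNS := massAt_le hγ ht hf y
  have hNN2 := massAt_le_two_mul hγ ht hf y
  set N := massAt γ t f y with hNdef
  set N2 := massAt γ (2 * t) f y with hN2def
  set a := signedMassAt γ t f y with hadef
  set S := ∫ x, |f x| with hSdef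
  set δ := (if infDist y (frontier Ω) < t then infDist y (frontier Ω) / t else 0) with hδ
  have hδ0 : 0 ≤ δ := by
    have : 0 ≤ infDist y (frontier Ω) := infDist_nonneg
    rw [hδ]
    split_ifs <;> positivity
  have htd : 0 < t ^ d := by positivity
  have hΔ : 0 ≤ N2 ^ (p - 1) - N ^ (p - 1) :=
    sub_nonneg.2 (Real.rpow_le_rpow hN.le hNN2 (by linarith))
  have hΩfin : volume Ω ≠ ⊤ := hb.measure_lt_top.ne
  have : IsFiniteMeasure (volume.restrict Ω) := ⟨by
    rw [Measure.restrict_apply_univ]; exact hΩfin.lt_top⟩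
  obtain ⟨⟨R, hR, hRb⟩, -⟩ := exists_abs_jumpRatio_le hγ hp hΦ hΦL hK hKL hf ht
  have hi1 : Integrable (fun x => bump (t⁻¹ • (x - y)) * jumpRatio γ Φ K t f x)
      (volume.restrict Ω) := by
    refine (integrable_const (2 * R)).mono' ?_ (Filter.Eventually.of_forall fun x => ?_)
    · have : Continuous (fun x : Euc d => bump (t⁻¹ • (x - y))) :=
        (tameKernel_bump (d := d) hγ).continuous.comp (by fun_prop)
      exact this.aestronglyMeasurable.mul
        (measurable_jumpRatio hγ hp hΦ hΦL hK hKL hf t).aestronglyMeasurable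
    · rw [norm_mul, Real.norm_of_nonneg (bump_nonneg _), Real.norm_eq_abs]
      gcongr
      · exact bump_le_two _
      · exact hRb _
  have haK : PosHomogeneous (-γ) (fun z => a • K z) := fun z s hs => by
    simp only [hK z s hs, smul_comm a]
  have haKL : LipschitzOnUnitSphere (fun z => a • K z) := by
    obtain ⟨L, hL⟩ := hKL
    refine ⟨‖a‖₊ * L, LipschitzOnWith.of_dist_le_mul fun x hx z hz => ?_⟩
    have h1 := hL.dist_le_mul x hx z hz
    rw [dist_smul₀, NNReal.coe_mul, mul_assoc]
    exact mul_le_mul_of_nonneg_left h1 (norm_nonneg a)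
  have hi2 : Integrable (fun x => scaleDiff γ Φ (fun z => a • K z) (t⁻¹ • (x - y)) / N)
      (volume.restrict Ω) := by
    obtain ⟨M', -, hM'⟩ := exists_abs_scaleDiff_le hγ hp.le hΦ hΦL haK haKL
    refine Integrable.div_const ?_ _
    refine (integrable_const M').mono' ?_ (Filter.Eventually.of_forall fun x => hM' _)
    exact ((continuous_scaleDiff hγ hp.le hΦ hΦL haK haKL).comp (by fun_prop)).aestronglyMeasurable
  have hsplit : localJump γ Φ K Ω t f y =
      (∫ x in Ω, (bump (t⁻¹ • (x - y)) * jumpRatio γ Φ K t f x -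
        scaleDiff γ Φ (fun z => a • K z) (t⁻¹ • (x - y)) / N)) +
      (∫ x in Ω, scaleDiff γ Φ (fun z => a • K z) (t⁻¹ • (x - y))) / N := by
    rw [integral_sub hi1 hi2, integral_div, localJump, sub_add_cancel]
  have hE : |∫ x in Ω, (bump (t⁻¹ • (x - y)) * jumpRatio γ Φ K t f x -
        scaleDiff γ Φ (fun z => a • K z) (t⁻¹ • (x - y)) / N)| ≤
      t ^ d * (A * (2 ^ d * w) * (N2 ^ (p - 1) - N ^ (p - 1))) := by
    set b := A * (N2 ^ (p - 1) - N ^ (p - 1)) with hbdef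
    have hb0 : 0 ≤ b := by positivity
    have hbi : Integrable ((closedBall y (2 * t)).indicator fun _ => b) := by
      rw [integrable_indicator_iff measurableSet_closedBall]
      exact integrableOn_const measure_closedBall_lt_top.ne
    have hpt : ∀ x, ‖bump (t⁻¹ • (x - y)) * jumpRatio γ Φ K t f x -
        scaleDiff γ Φ (fun z => a • K z) (t⁻¹ • (x - y)) / N‖ ≤
        (closedBall y (2 * t)).indicator (fun _ => b) x := by
      intro x
      by_cases hx : x ∈ closedBall y (2 * t)
      · rw [indicator_of_mem hx]
        rw [mem_closedBall_iff_norm] at hx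
        exact hAb f t x y hf ht hx hN
      · rw [indicator_of_notMem hx]
        rw [mem_closedBall_iff_norm, not_le] at hx
        -- Beyond distance `2 * t` both the bump and the point-mass jump vanish, so the error
        -- integral runs over a ball of volume comparable to `t ^ d`.
        have hz : 2 ≤ ‖t⁻¹ • (x - y)‖ := by
          rw [norm_inv_smul_sub ht, inv_mul_eq_div, le_div_iff₀ ht]; exact hx.le
        rw [bump_eq_zero hz, scaleDiff_eq_zero (by linarith)]
        simp
    refine (norm_integral_le_of_norm_le hbi.restrict (Filter.Eventually.of_forall hpt)).trans ?_
    refine (setIntegral_le_integral hbi (Filter.Eventually.of_forall fun x =>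
      indicator_nonneg (fun _ _ => hb0) x)).trans ?_
    rw [integral_indicator measurableSet_closedBall, setIntegral_const, smul_eq_mul,
      Measure.real, Measure.addHaar_closedBall _ _ (by positivity), ENNReal.toReal_mul,
      ENNReal.toReal_ofReal (by positivity)]
    simp only [finrank_euclideanSpace, Fintype.card_fin]
    refine le_of_eq ?_
    rw [mul_pow, hbdef]
    simp only [w, Measure.real]
    ring
  have hD := hMb a t y ht htr
  -- One power of the mass is kept to cancel the division by `N`; the others are bounded by the full
  -- `L_1` norm.
  have ha : |a| ^ p ≤ N * S ^ (p - 1) := by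
    calc |a| ^ p ≤ N ^ p := Real.rpow_le_rpow (abs_nonneg _) (abs_signedMassAt_le ht y) (by linarith)
      _ = N * N ^ (p - 1) := by rw [Real.rpow_sub_one hN.ne']; field_simp
      _ ≤ _ := by gcongr
  have hD2 : |(∫ x in Ω, scaleDiff γ Φ (fun z => a • K z) (t⁻¹ • (x - y))) / N| ≤
      t ^ d * (M * (1 + c) * (S ^ (p - 1) * (δ + t ^ β))) := by
    rw [abs_div, abs_of_pos hN, div_le_iff₀ hN]
    have htb : 0 ≤ t ^ β := by positivity
    calc _ ≤ (N * S ^ (p - 1)) * (t ^ d * (M * (δ + c * t ^ β))) := by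
          refine hD.trans ?_
          gcongr
      _ ≤ (N * S ^ (p - 1)) * (t ^ d * (M * ((1 + c) * (δ + t ^ β)))) := by
          gcongr
          nlinarith [mul_nonneg hc0 hδ0]
      _ = _ := by ring
  rw [hsplit, abs_mul, abs_of_pos (inv_pos.2 htd), inv_mul_le_iff₀ htd]
  refine (abs_add_le _ _).trans ((add_le_add hE hD2).trans ?_)
  rw [← mul_add]
  have htb : 0 ≤ t ^ β := by positivity
  gcongr
  · have : 0 ≤ M * (1 + c) := by positivity
    linarith
  · have : 0 ≤ A * (2 ^ d * w) := by positivity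
    linarith

end Fubini

/-! ### Cut-off convolutions at critical scaling and absolute convergence -/

section Limit

variable {d : ℕ} {F : Type*} [NormedAddCommGroup F] [NormedSpace ℝ F] {γ p : ℝ}
  {Φ : F → ℝ} {K : Euc d → F} {Ω : Set (Euc d)}

/-- The convolution with the kernel `K` cut off at the scale `t`. -/
noncomputable def cutConv (γ : ℝ) (K : Euc d → F) (t : ℝ) (f : Euc d → ℝ) (x : Euc d) : F :=
  t ^ (-γ) • scaledConv t (cutKer γ 1 K) f x

lemma PosHomogeneous.cutKer_inv (hK : PosHomogeneous (-γ) K) {t : ℝ} (ht : 0 < t) (z : Euc d) :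
    cutKer γ t⁻¹ K z = t ^ (-γ) • cutKer γ 1 K (t⁻¹ • z) := by
  rw [hK.smul_cutKer (inv_pos.2 ht), one_mul, smul_smul, Real.inv_rpow ht.le,
    mul_inv_cancel₀ (Real.rpow_pos_of_pos ht _).ne', one_smul]

lemma cutConv_eq (hK : PosHomogeneous (-γ) K) {t : ℝ} (ht : 0 < t) (f : Euc d → ℝ) (x : Euc d) :
    cutConv γ K t f x = ∫ y, f y • cutKer γ t⁻¹ K (x - y) := by
  rw [cutConv, scaledConv, ← integral_smul]
  congr 1
  ext y
  rw [hK.cutKer_inv ht, smul_comm]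

/-- The critical relation: the scaling of `Φ ∘ K` exactly offsets that of volume. -/
lemma rpow_neg_rpow_eq_inv_pow (hγp : γ * p = d) {t : ℝ} (ht : 0 < t) :
    (t ^ (-γ)) ^ p = (t ^ d)⁻¹ := by
  rw [← Real.rpow_mul ht.le, neg_mul, hγp, Real.rpow_neg ht.le, Real.rpow_natCast]

lemma apply_cutConv (hγp : γ * p = d) (hΦ : PosHomogeneous p Φ) {t : ℝ} (ht : 0 < t)
    (f : Euc d → ℝ) (x : Euc d) :
    Φ (cutConv γ K t f x) = (t ^ d)⁻¹ * Φ (scaledConv t (cutKer γ 1 K) f x) := by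
  rw [cutConv, hΦ _ _ (by positivity), rpow_neg_rpow_eq_inv_pow hγp ht, smul_eq_mul]

/-- Expressing the cut-off at `t / 2` at the same scale `t` as its predecessor, through `cutKer γ 2
K`, makes the increment a single `scaleJump`. -/
lemma cutConv_half (hK : PosHomogeneous (-γ) K) {t : ℝ} (ht : 0 < t)
    (f : Euc d → ℝ) (x : Euc d) :
    cutConv γ K (t / 2) f x = t ^ (-γ) • scaledConv t (cutKer γ 2 K) f x := by
  have h2 : (t / 2) ^ (-γ) = t ^ (-γ) * 2 ^ γ := by
    rw [Real.div_rpow ht.le two_pos.le, Real.rpow_neg two_pos.le, div_inv_eq_mul]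
  rw [cutConv, scaledConv, scaledConv, h2, mul_smul, ← integral_smul ((2 : ℝ) ^ γ)]
  congr 2
  ext y
  rw [hK.cutKer_two_eq, smul_comm, smul_smul 2]
  congr 4
  field_simp

lemma apply_cutConv_half_sub (hγp : γ * p = d) (hΦ : PosHomogeneous p Φ)
    (hK : PosHomogeneous (-γ) K) {t : ℝ} (ht : 0 < t) (f : Euc d → ℝ) (x : Euc d) :
    Φ (cutConv γ K (t / 2) f x) - Φ (cutConv γ K t f x) =
      (t ^ d)⁻¹ * scaleJump γ Φ K t f x := by
  rw [apply_cutConv hγp hΦ ht, cutConv_half hK ht, hΦ _ _ (by positivity),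
    rpow_neg_rpow_eq_inv_pow hγp ht, smul_eq_mul, scaleJump, mul_sub]

lemma norm_cutKer_le (hγ : 0 < γ) {s : ℝ} (hs : 0 ≤ s) (z : Euc d) :
    ‖cutKer γ s K z‖ ≤ ‖K z‖ := by
  have h0 : 0 ≤ min 1 (s * ‖z‖) := le_min zero_le_one (by positivity)
  rw [cutKer, norm_smul, Real.norm_of_nonneg (by positivity)]
  refine mul_le_of_le_one_left (norm_nonneg _) ?_
  exact Real.rpow_le_one h0 (min_le_left _ _) (by linarith)

lemma tendsto_cutKer (hγ : 0 < γ) (hK : PosHomogeneous (-γ) K) {t : ℕ → ℝ} (ht : ∀ n, 0 < t n)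
    (ht0 : Filter.Tendsto t Filter.atTop (nhds 0)) (z : Euc d) :
    Filter.Tendsto (fun n => cutKer γ (t n)⁻¹ K z) Filter.atTop (nhds (K z)) := by
  by_cases hz : z = 0
  · simp [hz, cutKer, hK.map_zero (by linarith)]
  · have hzp : 0 < ‖z‖ := norm_pos_iff.2 hz
    refine tendsto_const_nhds.congr' ?_
    filter_upwards [ht0.eventually (gt_mem_nhds hzp)] with n hn
    rw [cutKer_of_one_le]
    rw [inv_mul_eq_div, one_le_div (ht n)]
    exact hn.le

/-- The kernel is the pointwise limit of its continuous cut-offs; away from the origin they are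
eventually equal to it. -/
lemma stronglyMeasurable_kernel (hγ : 0 < γ) (hK : PosHomogeneous (-γ) K)
    (hKL : LipschitzOnUnitSphere K) : StronglyMeasurable K := by
  obtain ⟨A, hA, h1⟩ := hK.exists_tameKernel_cutKer_one hγ hKL
  have hpos : ∀ n : ℕ, 0 < 1 / ((n : ℝ) + 1) := fun n => by positivity
  refine stronglyMeasurable_of_tendsto (f := fun n : ℕ => cutKer γ (1 / ((n : ℝ) + 1))⁻¹ K)
    Filter.atTop (fun n => ?_) ?_
  · have : cutKer γ (1 / ((n : ℝ) + 1))⁻¹ K = fun z => (1 / ((n : ℝ) + 1)) ^ (-γ) •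
        cutKer γ 1 K ((1 / ((n : ℝ) + 1))⁻¹ • z) := by
      ext z; exact hK.cutKer_inv (hpos n) z
    rw [this]
    exact ((h1.continuous.comp (by fun_prop)).const_smul _).stronglyMeasurable
  · rw [tendsto_pi_nhds]
    exact fun z => tendsto_cutKer hγ hK hpos tendsto_one_div_add_atTop_nhds_zero_nat z

lemma integrable_indicator_ball_rpow (hd : 0 < d) (hγd : γ < d) (A : ℝ) :
    Integrable ((ball (0 : Euc d) 1).indicator fun z => A * ‖z‖ ^ (-γ)) := by
  have : Nontrivial (Euc d) :=
    Module.nontrivial_of_finrank_pos (R := ℝ) (by simpa using hd)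
  rw [integrable_indicator_iff measurableSet_ball]
  refine Integrable.const_mul ?_ A
  refine (integrableOn_fun_norm_addHaar volume (f := fun r : ℝ => r ^ (-γ))).2 ?_
  have h1 : IntegrableOn (fun r : ℝ => r ^ ((d : ℝ) - 1 - γ)) (Ioo 0 1) :=
    (intervalIntegral.integrableOn_Ioo_rpow_iff one_pos).2 (by linarith)
  refine h1.congr_fun (fun r hr => ?_) measurableSet_Ioo
  simp only [finrank_euclideanSpace, Fintype.card_fin, smul_eq_mul]
  rw [← Real.rpow_natCast, ← Real.rpow_add hr.1, Nat.cast_pred hd]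
  congr 1

/-- Convolutions of bounded integrable functions with the kernel are absolutely convergent, uniformly
in the point. -/
lemma exists_kernelConv_dominated (hd : 0 < d) (hγ : 0 < γ) (hγd : γ < d)
    (hK : PosHomogeneous (-γ) K) (hKL : LipschitzOnUnitSphere K) {f : Euc d → ℝ}
    (hf : Integrable f) {M : ℝ} (hM : ∀ x, |f x| ≤ M) :
    (∀ x, Integrable fun y => f y • K (x - y)) ∧
      ∃ R, ∀ x, ∫ y, ‖f y • K (x - y)‖ ≤ R := by
  obtain ⟨A, hA, hb⟩ := hK.exists_norm_le hKL (by linarith)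
  have hM0 : 0 ≤ M := (abs_nonneg _).trans (hM 0)
  -- The singular part near the origin is integrable because `γ < d` and is paired with the bound on
  -- `f`; the bounded remainder is paired with integrability of `f`.
  set κ : Euc d → ℝ := (ball (0 : Euc d) 1).indicator fun z => A * ‖z‖ ^ (-γ) with hκ
  have hκi : Integrable κ := integrable_indicator_ball_rpow hd hγd A
  have hκ0 : ∀ z, 0 ≤ κ z := fun z => indicator_nonneg (fun _ _ => by positivity) z
  have hKκ : ∀ z, ‖K z‖ ≤ κ z + A := by
    intro z
    by_cases hz : z ∈ ball (0 : Euc d) 1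
    · rw [hκ, indicator_of_mem hz]
      linarith [hb z]
    · rw [hκ, indicator_of_notMem hz, zero_add]
      rw [mem_ball_zero_iff, not_lt] at hz
      exact (hb z).trans (mul_le_of_le_one_right hA.le
        (Real.rpow_le_one_of_one_le_of_nonpos hz (by linarith)))
  have hdom : ∀ x, Integrable fun y => M * κ (x - y) + A * |f y| := fun x =>
    ((hκi.comp_sub_left x).const_mul M).add (hf.abs.const_mul A)
  have hle : ∀ x y, ‖f y • K (x - y)‖ ≤ M * κ (x - y) + A * |f y| := by
    intro x y
    rw [norm_smul, Real.norm_eq_abs]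
    calc |f y| * ‖K (x - y)‖ ≤ |f y| * (κ (x - y) + A) := by gcongr; exact hKκ _
      _ = |f y| * κ (x - y) + A * |f y| := by ring
      _ ≤ _ := by
        have := hκ0 (x - y)
        gcongr
        exact hM y
  have hint : ∀ x, Integrable fun y => f y • K (x - y) := by
    intro x
    refine (hdom x).mono' ?_ (Filter.Eventually.of_forall (hle x))
    refine hf.1.smul ?_
    exact ((stronglyMeasurable_kernel hγ hK hKL).comp_measurable
      (measurable_const.sub measurable_id)).aestronglyMeasurable
  refine ⟨hint, M * (∫ z, κ z) + A * ∫ y, |f y|, fun x => ?_⟩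
  refine (integral_mono (hint x).norm (hdom x) (hle x)).trans_eq ?_
  rw [integral_add ((hκi.comp_sub_left x).const_mul M) (hf.abs.const_mul A), integral_const_mul,
    integral_const_mul, integral_sub_left_eq_self]

end Limit

/-! ### Removal of the cut-off and sufficiency -/

section Euclidean

variable {d l : ℕ} {γ p : ℝ} {Φ : Euc l → ℝ} {K : Euc d → Euc l} {Ω : Set (Euc d)} {f : Euc d → ℝ}

lemma IsBoundedCompactlySupported.integrable {f : Euc d → ℝ} (hf : IsBoundedCompactlySupported f) :
    Integrable f := by
  obtain ⟨M, hM⟩ := hf.bounded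
  have hcs : IntegrableOn f (tsupport f) :=
    Measure.integrableOn_of_bounded hf.hasCompactSupport.measure_lt_top.ne hf.aestronglyMeasurable
      (Filter.Eventually.of_forall hM)
  exact (integrableOn_iff_integrable_of_support_subset (subset_tsupport f)).1 hcs

lemma continuous_cutConv (hγ : 0 < γ)
    (hK : PosHomogeneous (-γ) K) (hKL : LipschitzOnUnitSphere K) (hf : Integrable f)
    (t : ℝ) : Continuous (cutConv γ K t f) := by
  obtain ⟨A, hA, h1⟩ := hK.exists_tameKernel_cutKer_one hγ hKL
  have h2 : Continuous (scaledConv t (cutKer γ 1 K) f) := h1.continuous_scaledConv hA hγ hf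
  unfold cutConv
  fun_prop

lemma tendsto_cutConv (hd : 0 < d) (hγ : 0 < γ) (hγd : γ < d)
    (hK : PosHomogeneous (-γ) K) (hKL : LipschitzOnUnitSphere K)
    (hf : Integrable f) {M : ℝ} (hM : ∀ x, |f x| ≤ M) {t : ℕ → ℝ} (ht : ∀ n, 0 < t n)
    (ht0 : Filter.Tendsto t Filter.atTop (nhds 0)) (x : Euc d) :
    Filter.Tendsto (fun n => cutConv γ K (t n) f x) Filter.atTop (nhds (kernelConv K f x)) := by
  obtain ⟨A, hA, h1⟩ := hK.exists_tameKernel_cutKer_one hγ hKL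
  have hint := (exists_kernelConv_dominated hd hγ hγd hK hKL hf hM).1 x
  simp only [fun n => cutConv_eq hK (ht n) f x]
  refine tendsto_integral_of_dominated_convergence (fun y => ‖f y • K (x - y)‖) (fun n => ?_)
    hint.norm (fun n => Filter.Eventually.of_forall fun y => ?_)
    (Filter.Eventually.of_forall fun y => ?_)
  · simp only [hK.cutKer_inv (ht n)]
    have hc : Continuous fun y => (t n)⁻¹ • (x - y) := by fun_prop
    exact hf.1.smul ((h1.continuous.comp hc).const_smul ((t n) ^ (-γ))).aestronglyMeasurable
  · rw [norm_smul, norm_smul]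
    gcongr
    exact norm_cutKer_le hγ (inv_pos.2 (ht n)).le _
  · exact (tendsto_cutKer hγ hK ht ht0 _).const_smul _

lemma exists_norm_cutConv_le (hd : 0 < d) (hγ : 0 < γ) (hγd : γ < d)
    (hK : PosHomogeneous (-γ) K) (hKL : LipschitzOnUnitSphere K)
    (hf : Integrable f) {M : ℝ} (hM : ∀ x, |f x| ≤ M) :
    ∃ R, ∀ x, ‖kernelConv K f x‖ ≤ R ∧ ∀ t, 0 < t → ‖cutConv γ K t f x‖ ≤ R := by
  obtain ⟨hint, R, hR⟩ := exists_kernelConv_dominated hd hγ hγd hK hKL hf hM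
  refine ⟨R, fun x => ⟨(norm_integral_le_integral_norm _).trans (hR x), fun t ht => ?_⟩⟩
  rw [cutConv_eq hK ht]
  refine (norm_integral_le_of_norm_le (hint x).norm (Filter.Eventually.of_forall fun y => ?_)).trans
    (hR x)
  rw [norm_smul, norm_smul]
  gcongr
  exact norm_cutKer_le hγ (inv_pos.2 ht).le _

/-- Removal of the cut-off. -/
lemma tendsto_setIntegral_cutConv (hd : 0 < d) (hγ : 0 < γ) (hγd : γ < d) (hp : 1 < p)
    (hΦ : PosHomogeneous p Φ) (hΦL : LipschitzOnUnitSphere Φ)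
    (hK : PosHomogeneous (-γ) K) (hKL : LipschitzOnUnitSphere K)
    (hΩ : volume Ω ≠ ⊤)
    (hf : Integrable f) {M : ℝ} (hM : ∀ x, |f x| ≤ M) {t : ℕ → ℝ} (ht : ∀ n, 0 < t n)
    (ht0 : Filter.Tendsto t Filter.atTop (nhds 0)) :
    IntegrableOn (fun x => Φ (kernelConv K f x)) Ω ∧
    Filter.Tendsto (fun n => ∫ x in Ω, Φ (cutConv γ K (t n) f x)) Filter.atTop
      (nhds (∫ x in Ω, Φ (kernelConv K f x))) := by
  have : IsFiniteMeasure (volume.restrict Ω) := ⟨by rw [Measure.restrict_apply_univ]; exact hΩ.lt_top⟩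
  obtain ⟨R, hR⟩ := exists_norm_cutConv_le hd hγ hγd hK hKL hf hM
  obtain ⟨B, hB, hb⟩ := hΦ.exists_norm_le hΦL (by linarith)
  have hc := hΦ.continuous hΦL hp.le
  have hbd : ∀ w : Euc l, ‖w‖ ≤ R → ‖Φ w‖ ≤ B * R ^ p := fun w hw =>
    (hb w).trans (by gcongr)
  have hmeas : ∀ n, AEStronglyMeasurable (fun x => Φ (cutConv γ K (t n) f x))
      (volume.restrict Ω) := fun n =>
    (hc.comp (continuous_cutConv hγ hK hKL hf (t n))).aestronglyMeasurable
  have hlim : ∀ x, Filter.Tendsto (fun n => Φ (cutConv γ K (t n) f x)) Filter.atTop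
      (nhds (Φ (kernelConv K f x))) := fun x =>
    (hc.tendsto _).comp (tendsto_cutConv hd hγ hγd hK hKL hf hM ht ht0 x)
  constructor
  · refine (integrable_const (B * R ^ p)).mono' ?_ (Filter.Eventually.of_forall fun x =>
      hbd _ (hR x).1)
    exact aestronglyMeasurable_of_tendsto_ae Filter.atTop hmeas
      (Filter.Eventually.of_forall hlim)
  · exact tendsto_integral_of_dominated_convergence (fun _ => B * R ^ p) hmeas
      (integrable_const _) (fun n => Filter.Eventually.of_forall fun x => hbd _ ((hR x).2 _ (ht n)))
      (Filter.Eventually.of_forall hlim)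

/-- The terms double from one scale to the next and stop before exceeding one, so they form a
geometric sum dominated by its last term. The bound by the next term makes the induction close. -/
lemma sum_range_ite_div_le {h t₀ : ℝ} (hh : 0 ≤ h) (ht₀ : 0 < t₀) (n : ℕ) :
    ∑ k ∈ Finset.range n, (if h < t₀ * (1 / 2) ^ k then h / (t₀ * (1 / 2) ^ k) else 0) ≤ 2 := by
  suffices H : ∑ k ∈ Finset.range n, (if h < t₀ * (1 / 2) ^ k then h / (t₀ * (1 / 2) ^ k) else 0) ≤ 2 ∧
      ∑ k ∈ Finset.range n, (if h < t₀ * (1 / 2) ^ k then h / (t₀ * (1 / 2) ^ k) else 0) ≤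
        h / (t₀ * (1 / 2) ^ n) from H.1
  induction n with
  | zero => simp; positivity
  | succ n ih =>
    obtain ⟨ih1, ih2⟩ := ih
    rw [Finset.sum_range_succ]
    have hs : h / (t₀ * (1 / 2) ^ (n + 1)) = 2 * (h / (t₀ * (1 / 2) ^ n)) := by
      rw [pow_succ]; field_simp
    have h0 : 0 ≤ h / (t₀ * (1 / 2) ^ n) := by positivity
    rw [hs]
    split_ifs with hlt
    · have h1 : h / (t₀ * (1 / 2) ^ n) ≤ 1 := (div_le_one (by positivity)).2 hlt.le
      constructor <;> linarith
    · constructor <;> linarith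

lemma sum_range_rpow_le {β t₀ : ℝ} (hβ : 0 < β) (ht₀ : 0 < t₀) (n : ℕ) :
    ∑ k ∈ Finset.range n, (t₀ * (1 / 2) ^ k) ^ β ≤ t₀ ^ β * (1 - (1 / 2) ^ β)⁻¹ := by
  have hq : ((1 : ℝ) / 2) ^ β < 1 := Real.rpow_lt_one (by norm_num) (by norm_num) hβ
  have hq0 : 0 ≤ ((1 : ℝ) / 2) ^ β := by positivity
  have e : ∀ k : ℕ, (t₀ * (1 / 2) ^ k) ^ β = t₀ ^ β * (((1 : ℝ) / 2) ^ β) ^ k := by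
    intro k
    rw [Real.mul_rpow ht₀.le (by positivity), ← Real.rpow_natCast, ← Real.rpow_natCast,
      ← Real.rpow_mul (by norm_num), ← Real.rpow_mul (by norm_num), mul_comm (k : ℝ)]
  simp only [e]
  rw [← Finset.mul_sum, ← tsum_geometric_of_lt_one hq0 hq]
  gcongr
  exact (summable_geometric_of_lt_one hq0 hq).sum_le_tsum _ (fun k _ => by positivity)

/-- Cancellation over half-spaces implies the inequality. -/
lemma phiInequality_of_halfSpace (hd : 0 < d) (hγ : 0 < γ) (hγd : γ < d) (hp : 1 < p)
    (hγp : γ * p = d) (hΦ : PosHomogeneous p Φ) (hΦL : LipschitzOnUnitSphere Φ)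
    (hK : PosHomogeneous (-γ) K) (hKL : LipschitzOnUnitSphere K)
    (hΩ : IsOpen Ω) (hne : Ω.Nonempty) (hb : Bornology.IsBounded Ω)
    {β C r : ℝ} (hβ : 0 < β) (hC : 0 ≤ C) (hr : 0 < r)
    (h : ∀ z ∈ frontier Ω, ∃ ξ, IsTangent Ω β C r z ξ)
    (hhalf : ∀ ξ : Euc d, ‖ξ‖ = 1 → ∫ u in halfSpace ξ, scaleDiff γ Φ K u = 0)
    (hhalf' : ∀ ξ : Euc d, ‖ξ‖ = 1 → ∫ u in halfSpace ξ, scaleDiff γ Φ (fun z => -K z) u = 0) :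
    PhiInequality Ω K Φ p := by
  obtain ⟨B, hB, hBb⟩ := exists_abs_localJump_le hγ hp hd hΦ hΦL hK hKL hΩ hne hb hβ hC h hhalf hhalf'
  obtain ⟨A, hA, h1⟩ := hK.exists_tameKernel_cutKer_one hγ hKL
  obtain ⟨D, hD, hDb⟩ := hΦ.exists_norm_le hΦL (by linarith)
  have hΩfin : volume Ω ≠ ⊤ := hb.measure_lt_top.ne
  have : IsFiniteMeasure (volume.restrict Ω) := ⟨by
    rw [Measure.restrict_apply_univ]; exact hΩfin.lt_top⟩
  set t₀ := r / 2 with ht₀def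
  have ht₀ : 0 < t₀ := by positivity
  set T : ℕ → ℝ := fun k => t₀ * (1 / 2) ^ k with hT
  have hTpos : ∀ k, 0 < T k := fun k => by positivity
  have hTle : ∀ k, 2 * T k ≤ r := fun k => by
    have : ((1 : ℝ) / 2) ^ k ≤ 1 := pow_le_one₀ (by norm_num) (by norm_num)
    have : T k ≤ t₀ := mul_le_of_le_one_right ht₀.le this
    linarith
  have hTsucc : ∀ k, T (k + 1) = T k / 2 := fun k => by simp only [hT, pow_succ]; ring
  have hT0 : Filter.Tendsto T Filter.atTop (nhds 0) := by
    have := (tendsto_pow_atTop_nhds_zero_of_lt_one (r := (1 : ℝ) / 2) (by norm_num)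
      (by norm_num)).const_mul t₀
    rwa [mul_zero] at this
  set G := t₀ ^ β * (1 - (1 / 2) ^ β)⁻¹ with hG
  have hq : ((1 : ℝ) / 2) ^ β < 1 := Real.rpow_lt_one (by norm_num) (by norm_num) hβ
  have hG0 : 0 ≤ G := mul_nonneg (by positivity) (inv_nonneg.2 (by linarith))
  set C0 := volume.real Ω * ((t₀ ^ d)⁻¹ * (D * A ^ p)) with hC0
  set C1 := B * (1 + (2 + G)) with hC1
  refine ⟨C0 + C1, fun f hf => ?_⟩
  obtain ⟨M, hM⟩ := hf.bounded
  have hfi := hf.integrable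
  set S := ∫ x, |f x| with hS
  have hS0 : 0 ≤ S := integral_nonneg fun _ => abs_nonneg _
  -- A vanishing norm is treated separately, since the pointwise estimate divides by the mass.
  rcases hS0.eq_or_lt with hz | hSpos
  · have hf0 : f =ᵐ[volume] 0 := by
      have := (integral_eq_zero_iff_of_nonneg (fun x => abs_nonneg (f x)) hfi.abs).1 hz.symm
      filter_upwards [this] with x hx
      simpa using hx
    have hk0 : ∀ x, kernelConv K f x = 0 := by
      intro x
      rw [kernelConv, integral_eq_zero_of_ae]
      filter_upwards [hf0] with y hy
      simp [hy]
    simp only [hk0, hΦ.map_zero (show p ≠ 0 by linarith)]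
    rw [← hz, Real.zero_rpow (by linarith)]
    simp
  have hJi : ∀ t, Integrable (fun x => Φ (cutConv γ K t f x)) (volume.restrict Ω) := by
    intro t
    have hcont := (hΦ.continuous hΦL hp.le).comp (continuous_cutConv hγ hK hKL hfi t)
    have := hcont.continuousOn.integrableOn_compact hb.isCompact_closure (μ := volume)
    exact this.mono_set subset_closure
  have hstep : ∀ k, (∫ x in Ω, Φ (cutConv γ K (T (k + 1)) f x)) -
      ∫ x in Ω, Φ (cutConv γ K (T k) f x) =
      ∫ y, |f y| * ((T k ^ d)⁻¹ * localJump γ Φ K Ω (T k) f y) := by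
    intro k
    rw [← integral_sub (hJi _) (hJi _), hTsucc]
    simp only [apply_cutConv_half_sub hγp hΦ hK (hTpos k)]
    rw [integral_const_mul,
      (integral_scaleJump_eq hγ hp hΦ hΦL hK hKL hΩfin hfi (hTpos k)).2, ← integral_const_mul]
    congr 1
    ext y
    ring
  have hstepi : ∀ k, Integrable fun y => |f y| * ((T k ^ d)⁻¹ * localJump γ Φ K Ω (T k) f y) := by
    intro k
    have := (integral_scaleJump_eq hγ hp hΦ hΦL hK hKL hΩfin hfi (hTpos k)).1.const_mul (T k ^ d)⁻¹
    refine this.congr (Filter.Eventually.of_forall fun y => ?_)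
    simp only
    ring
  have hSp : S * S ^ (p - 1) = S ^ p := by
    rw [Real.rpow_sub_one hSpos.ne']; field_simp
  have hsum : ∀ n, |(∫ x in Ω, Φ (cutConv γ K (T n) f x)) -
      ∫ x in Ω, Φ (cutConv γ K (T 0) f x)| ≤ C1 * S ^ p := by
    intro n
    rw [← Finset.sum_range_sub (fun k => ∫ x in Ω, Φ (cutConv γ K (T k) f x)) n]
    simp only [hstep]
    rw [← integral_finsetSum _ (fun k _ => hstepi k)]
    simp only [← Finset.mul_sum]
    have hpt : ∀ y, ‖|f y| * ∑ k ∈ Finset.range n, (T k ^ d)⁻¹ * localJump γ Φ K Ω (T k) f y‖ ≤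
        |f y| * (C1 * S ^ (p - 1)) := by
      intro y
      rw [norm_mul, Real.norm_eq_abs, Real.norm_eq_abs, abs_abs]
      gcongr
      refine (Finset.abs_sum_le_sum_abs _ _).trans
        ((Finset.sum_le_sum fun k _ => hBb f (T k) y hfi hSpos (hTpos k) (hTle k)).trans ?_)
      rw [Finset.sum_add_distrib, ← Finset.mul_sum, ← Finset.mul_sum, ← Finset.mul_sum,
        Finset.sum_add_distrib]
      -- Consecutive scales differ by a factor of two, so the subtracted mass at one scale is the
      -- added mass at the next and the sum telescopes.
      have hm : ∀ k, massAt γ (T k) f y = massAt γ (2 * T (k + 1)) f y := fun k => by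
        rw [hTsucc]; congr 1; ring
      have htel : ∑ k ∈ Finset.range n,
          (massAt γ (2 * T k) f y ^ (p - 1) - massAt γ (T k) f y ^ (p - 1)) ≤ S ^ (p - 1) := by
        simp only [hm]
        rw [Finset.sum_range_sub' (fun k => massAt γ (2 * T k) f y ^ (p - 1))]
        have h2T : ∀ k, 0 < 2 * T k := fun k => by have := hTpos k; positivity
        have e1 : massAt γ (2 * T 0) f y ^ (p - 1) ≤ S ^ (p - 1) :=
          Real.rpow_le_rpow (massAt_nonneg γ (h2T 0) f y) (massAt_le hγ (h2T 0) hfi y) (by linarith)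
        have e2 : 0 ≤ massAt γ (2 * T n) f y ^ (p - 1) :=
          Real.rpow_nonneg (massAt_nonneg γ (h2T n) f y) _
        linarith
      have hd1 := sum_range_ite_div_le (infDist_nonneg (x := y) (s := frontier Ω)) ht₀ n
      have hd2 := sum_range_rpow_le hβ ht₀ n
      calc _ ≤ B * S ^ (p - 1) + B * (S ^ (p - 1) * (2 + G)) := by
            gcongr
        _ = _ := by rw [hC1]; ring
    refine (norm_integral_le_of_norm_le (hfi.abs.mul_const _) (Filter.Eventually.of_forall hpt)).trans_eq ?_
    rw [integral_mul_const, ← hSp]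
    ring
  -- At the coarsest scale the kernel is bounded and `Ω` has finite volume, so no cancellation is
  -- needed.
  have hinit : |∫ x in Ω, Φ (cutConv γ K (T 0) f x)| ≤ C0 * S ^ p := by
    have hT0' : T 0 = t₀ := by simp [hT]
    have hpt : ∀ x, ‖Φ (cutConv γ K (T 0) f x)‖ ≤ (t₀ ^ d)⁻¹ * (D * (A * S) ^ p) := by
      intro x
      rw [hT0', apply_cutConv hγp hΦ ht₀, norm_mul, Real.norm_of_nonneg (by positivity)]
      gcongr
      refine (hDb _).trans ?_
      gcongr
      refine (h1.norm_scaledConv_le hγ ht₀ hfi x).trans ?_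
      gcongr
      exact massAt_le hγ ht₀ hfi x
    have := norm_setIntegral_le_of_norm_le_const hΩfin.lt_top
      (fun x (_ : x ∈ Ω) => hpt x)
    refine this.trans_eq ?_
    rw [Real.mul_rpow hA.le hS0, hC0]
    ring
  have hlim := (tendsto_setIntegral_cutConv hd hγ hγd hp hΦ hΦL hK hKL hΩfin hfi hM hTpos hT0).2
  refine le_of_tendsto hlim.abs (Filter.Eventually.of_forall fun n => ?_)
  have h2 := hsum n
  have h3 := abs_add_le ((∫ x in Ω, Φ (cutConv γ K (T n) f x)) -
      ∫ x in Ω, Φ (cutConv γ K (T 0) f x)) (∫ x in Ω, Φ (cutConv γ K (T 0) f x))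
  rw [sub_add_cancel] at h3
  linarith

end Euclidean

/-! ### Necessity: testing on approximate point masses -/

section Necessity

variable {d l : ℕ} {γ p : ℝ} {Φ : Euc l → ℝ} {K : Euc d → Euc l} {Ω : Set (Euc d)}

/-- The normalized indicator function of the unit ball. -/
noncomputable def ballDensity (u : Euc d) : ℝ :=
  (ball (0 : Euc d) 1).indicator (fun _ => (volume.real (ball (0 : Euc d) 1))⁻¹) u

lemma ballDensity_nonneg (u : Euc d) : 0 ≤ ballDensity u :=
  indicator_nonneg (fun _ _ => inv_nonneg.2 measureReal_nonneg) u

lemma ballDensity_le (u : Euc d) : ballDensity u ≤ (volume.real (ball (0 : Euc d) 1))⁻¹ :=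
  indicator_apply_le' (fun _ => le_rfl) fun _ => inv_nonneg.2 measureReal_nonneg

lemma measurable_ballDensity : Measurable (ballDensity : Euc d → ℝ) :=
  measurable_const.indicator measurableSet_ball

lemma integrable_ballDensity : Integrable (ballDensity : Euc d → ℝ) := by
  have h : IntegrableOn (fun _ : Euc d => (volume.real (ball (0 : Euc d) 1))⁻¹)
      (ball (0 : Euc d) 1) := integrableOn_const measure_ball_lt_top.ne
  exact h.integrable_indicator measurableSet_ball

lemma integral_ballDensity : ∫ u : Euc d, ballDensity u = 1 := by
  have h : volume.real (ball (0 : Euc d) 1) ≠ 0 :=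
    (ENNReal.toReal_pos (measure_ball_pos volume _ one_pos).ne' measure_ball_lt_top.ne).ne'
  simp only [ballDensity]
  rw [integral_indicator measurableSet_ball, setIntegral_const, smul_eq_mul, mul_inv_cancel₀ h]

/-- An approximation of the unit mass at `z`. -/
noncomputable def approxDelta (ε : ℝ) (z x : Euc d) : ℝ := (ε ^ d)⁻¹ * ballDensity (ε⁻¹ • (x - z))

lemma isBoundedCompactlySupported_approxDelta {ε : ℝ} (hε : 0 < ε) (z : Euc d) :
    IsBoundedCompactlySupported (approxDelta ε z) where
  aestronglyMeasurable := by
    have : Measurable fun x : Euc d => ε⁻¹ • (x - z) := by fun_prop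
    exact ((measurable_ballDensity.comp this).const_mul _).aestronglyMeasurable
  bounded := by
    refine ⟨(ε ^ d)⁻¹ * (volume.real (ball (0 : Euc d) 1))⁻¹, fun x => ?_⟩
    rw [approxDelta, abs_mul, abs_of_nonneg (ballDensity_nonneg _), abs_of_pos (by positivity)]
    gcongr
    exact ballDensity_le _
  hasCompactSupport := by
    refine HasCompactSupport.of_support_subset_isCompact (isCompact_closedBall z ε) fun x hx => ?_
    rw [mem_closedBall_iff_norm]
    by_contra hlt
    rw [not_le] at hlt
    refine hx ?_
    rw [approxDelta, ballDensity, indicator_of_notMem, mul_zero]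
    rw [mem_ball_zero_iff, norm_inv_smul_sub hε, inv_mul_eq_div, div_lt_one hε]
    exact not_lt.2 hlt.le

lemma integral_abs_approxDelta {ε : ℝ} (hε : 0 < ε) (z : Euc d) :
    ∫ x, |approxDelta ε z x| = 1 := by
  have h : ∀ x, |approxDelta ε z x| = (ε ^ d)⁻¹ * ballDensity (ε⁻¹ • (x - z)) := fun x => by
    rw [approxDelta, abs_of_nonneg (mul_nonneg (by positivity) (ballDensity_nonneg _))]
  simp only [h]
  rw [integral_const_mul, integral_comp_rescale _ hε, integral_ballDensity, smul_eq_mul, mul_one,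
    inv_mul_cancel₀ (by positivity)]

lemma kernelConv_approxDelta (hK : PosHomogeneous (-γ) K) {ε : ℝ} (hε : 0 < ε) (z x : Euc d) :
    kernelConv K (approxDelta ε z) x =
      ε ^ (-γ) • kernelConv K ballDensity (ε⁻¹ • (x - z)) := by
  set u₀ := ε⁻¹ • (x - z) with hu₀
  have h : ∀ y, approxDelta ε z y • K (x - y) =
      (ε ^ d)⁻¹ • ((fun u => ballDensity u • (ε ^ (-γ) • K (u₀ - u))) (ε⁻¹ • (y - z))) := by
    intro y
    have e : x - y = ε • (u₀ - ε⁻¹ • (y - z)) := by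
      rw [hu₀, ← smul_sub, smul_smul, mul_inv_cancel₀ hε.ne', one_smul, sub_sub_sub_cancel_right]
    simp only [approxDelta]
    rw [mul_smul, ← hK _ ε hε, ← e]
  rw [kernelConv]
  simp only [h]
  rw [integral_smul, integral_comp_rescale (fun u => ballDensity u • (ε ^ (-γ) • K (u₀ - u))) hε,
    smul_smul, inv_mul_cancel₀ (by positivity), one_smul, kernelConv, ← integral_smul]
  congr 1
  ext1 u
  rw [smul_comm]

lemma dec_add_one_le {r : ℝ} (hr : 0 ≤ r) : dec (γ + 1) r ≤ dec γ r :=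
  Real.rpow_le_rpow_of_exponent_le (by linarith) (by linarith)

/-- The averaged kernel is asymptotic to the kernel. -/
lemma exists_norm_kernelConv_ballDensity_sub_le (hd : 0 < d) (hγ : 0 < γ) (hγd : γ < d)
    (hK : PosHomogeneous (-γ) K) (hKL : LipschitzOnUnitSphere K) :
    ∃ C, 0 < C ∧ ∀ u, ‖kernelConv K ballDensity u - cutKer γ 1 K u‖ ≤ C * dec (γ + 1) ‖u‖ := by
  obtain ⟨A, hA, hT⟩ := hK.exists_tameKernel_cutKer_one hγ hKL
  have hMb : ∀ x : Euc d, |ballDensity x| ≤ (volume.real (ball (0 : Euc d) 1))⁻¹ := fun x => by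
    rw [abs_of_nonneg (ballDensity_nonneg _)]; exact ballDensity_le x
  obtain ⟨R, hR⟩ := exists_norm_cutConv_le hd hγ hγd hK hKL integrable_ballDensity hMb
  have hR0 : 0 ≤ R := (norm_nonneg _).trans (hR 0).1
  have hint := (exists_kernelConv_dominated hd hγ hγd hK hKL integrable_ballDensity hMb).1
  refine ⟨3 ^ (γ + 1) * (R + A), by positivity, fun u => ?_⟩
  have hdec := dec_pos (γ := γ + 1) (norm_nonneg u)
  rcases lt_or_ge ‖u‖ 2 with hu | hu
  · have h1 : dec (γ + 1) 0 ≤ 3 ^ (γ + 1) * dec (γ + 1) ‖u‖ :=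
      dec_le_mul_of_le (by linarith) le_rfl (norm_nonneg _) (by norm_num) (by linarith)
    have h2 : dec (γ + 1) 0 = 1 := by simp [dec]
    rw [h2] at h1
    calc _ ≤ R + A := (norm_sub_le _ _).trans (add_le_add (hR u).1 (hT.norm_le_const hA hγ u))
      _ = (R + A) * 1 := (mul_one _).symm
      _ ≤ (R + A) * (3 ^ (γ + 1) * dec (γ + 1) ‖u‖) := by gcongr
      _ = _ := by ring
  · set ρ := ‖u‖ / 2 with hρ
    have hρ1 : 1 ≤ ρ := by rw [hρ]; linarith
    have hρ0 : 0 < ρ := by linarith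
    have hρdec : ρ ^ (-(γ + 1)) ≤ 3 ^ (γ + 1) * dec (γ + 1) ‖u‖ := by
      have e : (3 : ℝ) ^ (γ + 1) * dec (γ + 1) ‖u‖ = ((1 + ‖u‖) / 3) ^ (-(γ + 1)) := by
        rw [Real.div_rpow (by positivity) (by norm_num), dec, Real.rpow_neg (x := 3) (by norm_num)]
        field_simp
      rw [e]
      exact Real.rpow_le_rpow_of_nonpos (by positivity) (by rw [hρ]; linarith) (by linarith)
    -- Rescaling by `ρ` turns the Lipschitz bound for the cut-off kernel into a Lipschitz bound of
    -- order `ρ ^ (-(γ + 1))` for `K` itself outside the ball of radius `ρ`. Shifts of length below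
    -- one stay there since `ρ = ‖u‖ / 2 ≥ 1`.
    have hKeq : ∀ v : Euc d, ρ ≤ ‖v‖ → K v = ρ ^ (-γ) • cutKer γ 1 K (ρ⁻¹ • v) := by
      intro v hv
      rw [cutKer_of_one_le, ← hK _ ρ hρ0, smul_smul, mul_inv_cancel₀ hρ0.ne', one_smul]
      rw [one_mul, norm_smul, norm_inv, Real.norm_of_nonneg hρ0.le, inv_mul_eq_div,
        one_le_div hρ0]
      exact hv
    have hdiff : ∀ s : Euc d, ‖s‖ < 1 → ‖K (u - s) - K u‖ ≤ A * ρ ^ (-(γ + 1)) := by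
      intro s hs
      have h1 : ρ ≤ ‖u - s‖ := by
        have := norm_sub_norm_le u s
        linarith
      rw [hKeq _ h1, hKeq u (by linarith), ← smul_sub, norm_smul, Real.norm_of_nonneg (by positivity)]
      have h2 := hT.sub_le (ρ⁻¹ • (u - s)) (ρ⁻¹ • u)
      rw [← smul_sub, sub_sub_cancel_left, norm_smul, norm_neg, norm_inv,
        Real.norm_of_nonneg hρ0.le] at h2
      calc _ ≤ ρ ^ (-γ) * (A * (ρ⁻¹ * 1)) := by
            gcongr
            refine h2.trans ?_
            gcongr
        _ = _ := by
            rw [neg_add, ← sub_eq_add_neg, Real.rpow_sub_one hρ0.ne']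
            field_simp
    have e1 : kernelConv K ballDensity u - cutKer γ 1 K u =
        ∫ s, ballDensity s • (K (u - s) - K u) := by
      simp only [smul_sub]
      rw [integral_sub (hint u) (integrable_ballDensity.smul_const _), integral_smul_const,
        integral_ballDensity, one_smul, cutKer_of_one_le (by linarith), kernelConv]
    rw [e1]
    have hpt : ∀ s, ‖ballDensity s • (K (u - s) - K u)‖ ≤
        ballDensity s * (A * ρ ^ (-(γ + 1))) := by
      intro s
      rw [norm_smul, Real.norm_of_nonneg (ballDensity_nonneg s)]
      by_cases hs : s ∈ ball (0 : Euc d) 1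
      · have := ballDensity_nonneg s
        gcongr
        exact hdiff s (mem_ball_zero_iff.1 hs)
      · have : ballDensity s = 0 := indicator_of_notMem hs _
        rw [this, zero_mul, zero_mul]
    refine (norm_integral_le_of_norm_le (integrable_ballDensity.mul_const _)
      (Filter.Eventually.of_forall hpt)).trans ?_
    rw [integral_mul_const, integral_ballDensity, one_mul]
    calc _ ≤ A * (3 ^ (γ + 1) * dec (γ + 1) ‖u‖) := by gcongr
      _ = 3 ^ (γ + 1) * A * dec (γ + 1) ‖u‖ := by ring
      _ ≤ _ := by
        gcongr
        linarith

/-- Of the `p` powers of decay, one is improved from `γ` to `γ + 1`. The total exponent is `d + 1`,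
so averaging the kernel changes `Φ` by an integrable amount. -/
lemma exists_abs_apply_kernelConv_ballDensity_sub_le (hd : 0 < d) (hγ : 0 < γ) (hγd : γ < d)
    (hp : 1 < p) (hγp : γ * p = d) (hΦ : PosHomogeneous p Φ) (hΦL : LipschitzOnUnitSphere Φ)
    (hK : PosHomogeneous (-γ) K) (hKL : LipschitzOnUnitSphere K) :
    ∃ C, 0 < C ∧ ∀ u, |Φ (kernelConv K ballDensity u) - Φ (cutKer γ 1 K u)| ≤
      C * (1 + ‖u‖) ^ (-((d : ℝ) + 1)) := by
  obtain ⟨A, hA, hT⟩ := hK.exists_tameKernel_cutKer_one hγ hKL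
  obtain ⟨C, hC, hCb⟩ := exists_norm_kernelConv_ballDensity_sub_le hd hγ hγd hK hKL
  obtain ⟨B, hB, hb⟩ := hΦ.exists_norm_sub_le hΦL hp.le
  refine ⟨B * ((A + C) ^ (p - 1) * C), by positivity, fun u => ?_⟩
  have hdec := dec_pos (γ := γ) (norm_nonneg u)
  have h1 : ‖cutKer γ 1 K u‖ ≤ (A + C) * dec γ ‖u‖ :=
    (hT.norm_le u).trans (by gcongr; linarith)
  have h2 : ‖kernelConv K ballDensity u‖ ≤ (A + C) * dec γ ‖u‖ := by
    have h3 := norm_le_norm_add_norm_sub (cutKer γ 1 K u) (kernelConv K ballDensity u)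
    rw [norm_sub_rev] at h3
    have h4 := hCb u
    have h5 : C * dec (γ + 1) ‖u‖ ≤ C * dec γ ‖u‖ := by
      gcongr
      exact dec_add_one_le (norm_nonneg u)
    have h6 := hT.norm_le u
    linarith
  have h7 := hb _ _ _ h2 h1
  rw [Real.mul_rpow (by positivity) hdec.le] at h7
  have e : dec γ ‖u‖ ^ (p - 1) * dec (γ + 1) ‖u‖ = (1 + ‖u‖) ^ (-((d : ℝ) + 1)) := by
    have hu : 0 < 1 + ‖u‖ := by positivity
    rw [dec, dec, ← Real.rpow_mul hu.le, ← Real.rpow_add hu]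
    congr 1
    rw [← hγp]
    ring
  calc _ ≤ _ := h7
    _ ≤ B * ((A + C) ^ (p - 1) * dec γ ‖u‖ ^ (p - 1) * (C * dec (γ + 1) ‖u‖)) := by
      gcongr
      exact hCb u
    _ = B * ((A + C) ^ (p - 1) * C) * (dec γ ‖u‖ ^ (p - 1) * dec (γ + 1) ‖u‖) := by ring
    _ = _ := by rw [e]

/-- The inequality applied to approximations of a point mass bounds the integrals of the cut-off
kernel. -/
lemma PhiInequality.exists_abs_setIntegral_le (hd : 0 < d) (hγ : 0 < γ) (hγd : γ < d)
    (hp : 1 < p) (hγp : γ * p = d) (hΦ : PosHomogeneous p Φ) (hΦL : LipschitzOnUnitSphere Φ)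
    (hK : PosHomogeneous (-γ) K) (hKL : LipschitzOnUnitSphere K)
    (hb : Bornology.IsBounded Ω) (h : PhiInequality Ω K Φ p) (z : Euc d) :
    ∃ C, ∀ ε, 0 < ε → |(ε ^ d)⁻¹ * ∫ x in Ω, Φ (cutKer γ 1 K (ε⁻¹ • (x - z)))| ≤ C := by
  obtain ⟨C₁, h1⟩ := h
  obtain ⟨C₂, hC₂, h2⟩ :=
    exists_abs_apply_kernelConv_ballDensity_sub_le hd hγ hγd hp hγp hΦ hΦL hK hKL
  obtain ⟨A, hA, hT⟩ := hK.exists_tameKernel_cutKer_one hγ hKL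
  have hΩfin : volume Ω ≠ ⊤ := hb.measure_lt_top.ne
  set E : Euc d → ℝ := fun u => C₂ * (1 + ‖u‖) ^ (-((d : ℝ) + 1)) with hE
  have hE0 : ∀ u, 0 ≤ E u := fun u => by positivity
  have hEi : Integrable E := by
    refine Integrable.const_mul (integrable_one_add_norm ?_) _
    simp
  refine ⟨C₁ + ∫ u, E u, fun ε hε => ?_⟩
  have hf := isBoundedCompactlySupported_approxDelta hε z
  have h3 := h1 _ hf
  rw [integral_abs_approxDelta hε, Real.one_rpow, mul_one] at h3
  obtain ⟨M, hM⟩ := hf.bounded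
  have hi1 : IntegrableOn (fun x => Φ (kernelConv K (approxDelta ε z) x)) Ω :=
    (tendsto_setIntegral_cutConv hd hγ hγd hp hΦ hΦL hK hKL hΩfin hf.integrable hM
      (t := fun n : ℕ => 1 / ((n : ℝ) + 1)) (fun n => by positivity)
      tendsto_one_div_add_atTop_nhds_zero_nat).1
  have hi2 : IntegrableOn (fun x => (ε ^ d)⁻¹ * Φ (cutKer γ 1 K (ε⁻¹ • (x - z)))) Ω := by
    have hc : Continuous fun x => (ε ^ d)⁻¹ * Φ (cutKer γ 1 K (ε⁻¹ • (x - z))) :=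
      continuous_const.mul
        ((hΦ.continuous hΦL hp.le).comp (hT.continuous.comp (by fun_prop)))
    exact (hc.continuousOn.integrableOn_compact hb.isCompact_closure (μ := volume)).mono_set
      subset_closure
  have hEε : Integrable fun x => E (ε⁻¹ • (x - z)) :=
    (hEi.comp_smul (inv_pos.2 hε).ne').comp_sub_right z
  have hdiff : |(∫ x in Ω, Φ (kernelConv K (approxDelta ε z) x)) -
      ∫ x in Ω, (ε ^ d)⁻¹ * Φ (cutKer γ 1 K (ε⁻¹ • (x - z)))| ≤ ∫ u, E u := by
    rw [← integral_sub hi1 hi2]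
    have hpt : ∀ x, ‖Φ (kernelConv K (approxDelta ε z) x) -
        (ε ^ d)⁻¹ * Φ (cutKer γ 1 K (ε⁻¹ • (x - z)))‖ ≤ (ε ^ d)⁻¹ * E (ε⁻¹ • (x - z)) := by
      intro x
      rw [kernelConv_approxDelta hK hε, hΦ _ _ (by positivity), rpow_neg_rpow_eq_inv_pow hγp hε,
        smul_eq_mul, ← mul_sub, norm_mul, Real.norm_of_nonneg (by positivity)]
      gcongr
      exact h2 _
    refine (norm_integral_le_of_norm_le (hEε.const_mul _).restrict
      (Filter.Eventually.of_forall hpt)).trans ?_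
    refine (setIntegral_le_integral (hEε.const_mul _) (Filter.Eventually.of_forall fun x =>
      mul_nonneg (by positivity) (hE0 _))).trans_eq ?_
    -- The normalized dilation preserves the integral of `E`, so the error is bounded uniformly in
    -- `ε`.
    rw [integral_const_mul, integral_comp_rescale E hε, smul_eq_mul, ← mul_assoc,
      inv_mul_cancel₀ (by positivity), one_mul]
  rw [← integral_const_mul]
  have h4 := abs_sub_abs_le_abs_sub (∫ x in Ω, (ε ^ d)⁻¹ * Φ (cutKer γ 1 K (ε⁻¹ • (x - z))))
    (∫ x in Ω, Φ (kernelConv K (approxDelta ε z) x))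
  rw [abs_sub_comm] at h4
  linarith

/-- The inequality implies cancellation over half-spaces. -/
lemma PhiInequality.setIntegral_halfSpace_eq_zero (hd : 0 < d) (hγ : 0 < γ) (hγd : γ < d)
    (hp : 1 < p) (hγp : γ * p = d) (hΦ : PosHomogeneous p Φ) (hΦL : LipschitzOnUnitSphere Φ)
    (hK : PosHomogeneous (-γ) K) (hKL : LipschitzOnUnitSphere K)
    (hΩ : IsOpen Ω) (hne : Ω.Nonempty) (hb : Bornology.IsBounded Ω)
    {β C r : ℝ} (hβ : 0 < β) (hC : 0 ≤ C) (hr : 0 < r)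
    (htan : ∀ z ∈ frontier Ω, ∃ ξ, IsTangent Ω β C r z ξ)
    (h : PhiInequality Ω K Φ p) {ξ : Euc d} (hξ : ‖ξ‖ = 1) :
    ∫ u in halfSpace ξ, scaleDiff γ Φ K u = 0 := by
  obtain ⟨z, hz, hmax⟩ := exists_mem_frontier_max hΩ hne hb hξ
  obtain ⟨ξ', hξ'⟩ := htan z hz
  obtain rfl := hξ'.eq_of_max hβ hC hr hξ hmax
  obtain ⟨Q, hQ⟩ := h.exists_abs_setIntegral_le hd hγ hγd hp hγp hΦ hΦL hK hKL hb z
  obtain ⟨A, hA, hT⟩ := hK.exists_tameKernel_cutKer_one hγ hKL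
  obtain ⟨M, hM, hMb⟩ := exists_abs_scaleDiff_le hγ hp.le hΦ hΦL hK hKL
  have hcont := continuous_scaleDiff hγ hp.le hΦ hΦL hK hKL
  have hcs : HasCompactSupport (scaleDiff γ Φ K) := by
    refine HasCompactSupport.of_support_subset_isCompact (isCompact_closedBall (0 : Euc d) 1) ?_
    intro u hu
    rw [mem_closedBall_zero_iff]
    by_contra hc
    exact hu (scaleDiff_eq_zero (by linarith))
  set I := ∫ u in halfSpace ξ', scaleDiff γ Φ K u with hI
  set t₀ := r / 2 with ht₀def
  have ht₀ : 0 < t₀ := by positivity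
  set T : ℕ → ℝ := fun k => t₀ * (1 / 2) ^ k with hTdef
  have hTpos : ∀ k, 0 < T k := fun k => by positivity
  have hTle : ∀ k, 2 * T k ≤ r := fun k => by
    have : ((1 : ℝ) / 2) ^ k ≤ 1 := pow_le_one₀ (by norm_num) (by norm_num)
    have : T k ≤ t₀ := mul_le_of_le_one_right ht₀.le this
    linarith
  have hTsucc : ∀ k, T (k + 1) = T k / 2 := fun k => by simp only [hTdef, pow_succ]; ring
  set Λ : ℕ → ℝ := fun k => (T k ^ d)⁻¹ * ∫ x in Ω, Φ (cutKer γ 1 K ((T k)⁻¹ • (x - z))) with hΛ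
  have hint : ∀ t : ℝ, IntegrableOn (fun x => Φ (cutKer γ 1 K (t • (x - z)))) Ω := by
    intro t
    have hc : Continuous fun x => Φ (cutKer γ 1 K (t • (x - z))) :=
      (hΦ.continuous hΦL hp.le).comp (hT.continuous.comp (by fun_prop))
    exact (hc.continuousOn.integrableOn_compact hb.isCompact_closure (μ := volume)).mono_set
      subset_closure
  have hstep : ∀ k, Λ (k + 1) - Λ k =
      (T k ^ d)⁻¹ * ∫ x in Ω, scaleDiff γ Φ K ((T k)⁻¹ • (x - z)) := by
    intro k
    have e : ∀ x, (T (k + 1) ^ d)⁻¹ * Φ (cutKer γ 1 K ((T (k + 1))⁻¹ • (x - z))) =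
        (T k ^ d)⁻¹ * Φ (cutKer γ 2 K ((T k)⁻¹ • (x - z))) := by
      intro x
      have e1 : (2 : ℝ) • ((T k)⁻¹ • (x - z)) = (T (k + 1))⁻¹ • (x - z) := by
        rw [smul_smul, hTsucc, inv_div, div_eq_mul_inv]
      have e2 : ((2 : ℝ) ^ γ) ^ p = 2 ^ d := by
        rw [← Real.rpow_mul two_pos.le, hγp, Real.rpow_natCast]
      rw [hK.cutKer_two_eq, hΦ _ _ (by positivity), e1, e2, smul_eq_mul, ← mul_assoc]
      congr 1
      rw [hTsucc, div_pow, inv_div, div_eq_mul_inv, mul_comm]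
    simp only [hΛ]
    rw [← integral_const_mul, ← integral_const_mul, ← integral_const_mul,
      ← integral_sub ((hint _).const_mul _) ((hint _).const_mul _)]
    congr 1
    ext x
    rw [e, scaleDiff]
    ring
  -- The base point is the boundary point itself, so the shift term disappears and only the summable
  -- boundary error remains.
  have hclose : ∀ k, |Λ (k + 1) - Λ k - I| ≤ M * (2 ^ d * (C * 2 ^ (1 + β))) * T k ^ β := by
    intro k
    have h1 := hξ'.abs_setIntegral_sub_le hΩ.measurableSet (hcont.integrable_of_hasCompactSupport hcs)
      hMb (fun u hu => scaleDiff_eq_zero hu) hβ hC (y := z) (hTpos k)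
      (by rw [sub_self, norm_zero]; exact (hTpos k).le) (hTle k)
    have hTd : 0 < T k ^ d := pow_pos (hTpos k) d
    have e : Λ (k + 1) - Λ k - I = (T k ^ d)⁻¹ *
        ((∫ x in Ω, scaleDiff γ Φ K ((T k)⁻¹ • (x - z))) - T k ^ d * I) := by
      rw [hstep, mul_sub, ← mul_assoc _ _ I, inv_mul_cancel₀ hTd.ne', one_mul]
    rw [e, abs_mul, abs_of_pos (inv_pos.2 hTd), inv_mul_le_iff₀ hTd]
    refine h1.trans_eq ?_
    rw [sub_self, norm_zero, zero_div, zero_add]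
    ring
  set G := t₀ ^ β * (1 - (1 / 2) ^ β)⁻¹ with hG
  -- After `n` scales the increments accumulate `n * I` up to a bounded error, whereas `Λ` stays
  -- between `-Q` and `Q`.
  have hbound : ∀ n : ℕ, (n : ℝ) * |I| ≤ 2 * Q + M * (2 ^ d * (C * 2 ^ (1 + β))) * G := by
    intro n
    have h1 : ∑ k ∈ Finset.range n, (Λ (k + 1) - Λ k - I) = Λ n - Λ 0 - n * I := by
      rw [Finset.sum_sub_distrib, Finset.sum_range_sub, Finset.sum_const, Finset.card_range,
        nsmul_eq_mul]
    have h2 : |Λ n - Λ 0 - n * I| ≤ M * (2 ^ d * (C * 2 ^ (1 + β))) * G := by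
      rw [← h1]
      refine (Finset.abs_sum_le_sum_abs _ _).trans
        ((Finset.sum_le_sum fun k _ => hclose k).trans ?_)
      rw [← Finset.mul_sum]
      gcongr
      exact sum_range_rpow_le hβ ht₀ n
    have h3 := hQ (T n) (hTpos n)
    have h4 := hQ (T 0) (hTpos 0)
    change |Λ n| ≤ Q at h3
    change |Λ 0| ≤ Q at h4
    have h5 : |(n : ℝ) * I| ≤ |Λ n| + |Λ 0| + |Λ n - Λ 0 - n * I| := by
      have e : (n : ℝ) * I = Λ n - Λ 0 - (Λ n - Λ 0 - n * I) := by ring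
      calc |(n : ℝ) * I| = |Λ n - Λ 0 - (Λ n - Λ 0 - n * I)| := by rw [← e]
        _ ≤ |Λ n - Λ 0| + |Λ n - Λ 0 - n * I| := abs_sub _ _
        _ ≤ _ := by gcongr; exact abs_sub _ _
    rw [abs_mul, Nat.abs_cast] at h5
    linarith
  by_contra hI0
  obtain ⟨n, hn⟩ := exists_nat_gt ((2 * Q + M * (2 ^ d * (C * 2 ^ (1 + β))) * G) / |I|)
  rw [div_lt_iff₀ (abs_pos.2 hI0)] at hn
  exact absurd (hbound n) (not_le.2 hn)

end Necessity

/-! ### Sign symmetry and the equivalence -/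

lemma IsBoundedCompactlySupported.neg {d : ℕ} {f : Euc d → ℝ} (hf : IsBoundedCompactlySupported f) :
    IsBoundedCompactlySupported (fun x => -f x) where
  aestronglyMeasurable := hf.aestronglyMeasurable.neg
  bounded := by
    obtain ⟨M, hM⟩ := hf.bounded
    exact ⟨M, fun x => by rw [abs_neg]; exact hM x⟩
  hasCompactSupport := hf.hasCompactSupport.comp_left neg_zero

/-- Replacing `f` by `-f` preserves the norm, so the necessary condition for `-K` follows from the
one for `K`. -/
lemma PhiInequality.neg_kernel {d l : ℕ} {Ω : Set (Euc d)} {K : Euc d → Euc l} {Φ : Euc l → ℝ}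
    {p : ℝ} (h : PhiInequality Ω K Φ p) : PhiInequality Ω (fun z => -K z) Φ p := by
  obtain ⟨C, hC⟩ := h
  refine ⟨C, fun f hf => ?_⟩
  have h1 := hC _ hf.neg
  have e : ∀ x, kernelConv K (fun y => -f y) x = kernelConv (fun z => -K z) f x := fun x => by
    simp only [kernelConv, neg_smul, smul_neg]
  simpa only [e, abs_neg] using h1

lemma integrable_toSphere_comp {d l : ℕ} {K : Euc d → Euc l} {Φ : Euc l → ℝ}
    (hKL : LipschitzOnUnitSphere K) (hΦ : Continuous Φ) :
    Integrable (fun ζ : sphere (0 : Euc d) 1 => Φ (K ζ)) (volume : Measure (Euc d)).toSphere := by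
  obtain ⟨L, hL⟩ := hKL
  have hc : Continuous fun ζ : sphere (0 : Euc d) 1 => Φ (K ζ) :=
    hΦ.comp (continuousOn_iff_continuous_domRestrict.1 hL.continuousOn)
  exact hc.integrable_of_hasCompactSupport (HasCompactSupport.of_compactSpace _)

theorem mainTheorem1 (d l : ℕ) (α p : ℝ) (hα : 0 < α) (hαd : α < d) (hp : p = d / (d - α))
    (β : ℝ≥0) (hβ : 0 < β) (hβ1 : β < 1)
    (K : Euc d → Euc l) (hK : PosHomogeneous (α - d) K) (hKL : LipschitzOnUnitSphere K)
    (Φ : Euc l → ℝ) (hΦ : PosHomogeneous p Φ) (hΦL : LipschitzOnUnitSphere Φ)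
    (Ω : Set (Euc d)) (hΩ : IsBoundedDomain Ω) (hΩβ : HasC1HolderBoundary β Ω) :
    -- all the integrals that occur are absolutely convergent
    ((∀ f : Euc d → ℝ, IsBoundedCompactlySupported f →
        (∀ x, Integrable (fun y => f y • K (x - y))) ∧
        IntegrableOn (fun x => Φ (kernelConv K f x)) Ω) ∧
      Integrable (fun ζ : sphere (0 : Euc d) 1 => Φ (K ζ)) (volume : Measure (Euc d)).toSphere ∧
      Integrable (fun ζ : sphere (0 : Euc d) 1 => Φ (-K ζ)) (volume : Measure (Euc d)).toSphere) ∧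
    (PhiInequality Ω K Φ p ↔
      ∀ ξ : Euc d, ‖ξ‖ = 1 →
        halfSphereIntegral ξ (fun ζ => Φ (K ζ)) = 0 ∧
        halfSphereIntegral ξ (fun ζ => Φ (-K ζ)) = 0) := by

  have hd : 0 < d := by
    have : (0 : ℝ) < d := hα.trans hαd
    exact_mod_cast this
  obtain ⟨γ, hγdef⟩ : ∃ γ : ℝ, γ = d - α := ⟨_, rfl⟩
  have hγ : 0 < γ := by linarith
  have hγd : γ < d := by linarith
  rw [← hγdef] at hp
  have hp1 : 1 < p := by rw [hp, one_lt_div hγ]; exact hγd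
  have hγp : γ * p = d := by rw [hp]; field_simp
  rw [show α - d = -γ by linarith] at hK
  have hβ' : (0 : ℝ) < β := by exact_mod_cast hβ
  have hΩfin : volume Ω ≠ ⊤ := hΩ.isBounded.measure_lt_top.ne
  have hΦc := hΦ.continuous hΦL hp1.le
  refine ⟨⟨fun f hf => ?_, integrable_toSphere_comp hKL hΦc,
    integrable_toSphere_comp hKL.neg hΦc⟩, ?_⟩
  · obtain ⟨M, hM⟩ := hf.bounded
    exact ⟨(exists_kernelConv_dominated hd hγ hγd hK hKL hf.integrable hM).1,
      (tendsto_setIntegral_cutConv hd hγ hγd hp1 hΦ hΦL hK hKL hΩfin hf.integrable hM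
        (t := fun n : ℕ => 1 / ((n : ℝ) + 1)) (fun n => by positivity)
        tendsto_one_div_add_atTop_nhds_zero_nat).1⟩
  obtain ⟨C, r, hC, hr, htan⟩ := hΩβ.exists_isTangent hΩ.isOpen hΩ.isBounded
  have hne := hΩ.isConnected.nonempty
  have hprof := integral_scaleProfile_ne_zero hd hγ hp1.le
  have hpolar := fun ξ => setIntegral_halfSpace_scaleDiff hd hΦ hK ξ
  have hpolar' := fun ξ => setIntegral_halfSpace_scaleDiff hd hΦ hK.neg ξ
  constructor
  · intro h ξ hξ
    -- The half-sphere around `ξ` spans the half-space with outer normal `-ξ`.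
    have hξ' : ‖-ξ‖ = 1 := by rw [norm_neg, hξ]
    have h1 := h.setIntegral_halfSpace_eq_zero hd hγ hγd hp1 hγp hΦ hΦL hK hKL hΩ.isOpen hne
      hΩ.isBounded hβ' hC hr htan hξ'
    have h2 := h.neg_kernel.setIntegral_halfSpace_eq_zero hd hγ hγd hp1 hγp hΦ hΦL hK.neg hKL.neg
      hΩ.isOpen hne hΩ.isBounded hβ' hC hr htan hξ'
    rw [hpolar, neg_neg] at h1
    rw [hpolar', neg_neg] at h2
    exact ⟨(mul_eq_zero.1 h1).resolve_right hprof, (mul_eq_zero.1 h2).resolve_right hprof⟩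
  · intro h
    refine phiInequality_of_halfSpace hd hγ hγd hp1 hγp hΦ hΦL hK hKL hΩ.isOpen hne hΩ.isBounded
      hβ' hC hr htan (fun ξ hξ => ?_) (fun ξ hξ => ?_)
    · rw [hpolar, (h (-ξ) (by rw [norm_neg, hξ])).1, zero_mul]
    · rw [hpolar', (h (-ξ) (by rw [norm_neg, hξ])).2, zero_mul]
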